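/- **Setting.** Write $T_xf(t)=f(t-x)$, $M_\omega f(t)=e^{2\pi i\omega\cdot t}f(t)$, $\widehat f(\omega)=\int_{\mathbb R^m}f(t)e^{-2\pi i t\cdot\omega}\,dt$ and $B(x,R)=x+R[0,1]^m$. Let $\Gamma\subset\mathbb R^m\times\mathbb R$ be a lattice such that both coordinate projections $p_1:\mathbb R^m\times\mathbb R\to\mathbb R^m$ and $p_2:\mathbb R^m\times\mathbb R\to\mathbb R$ are injective on $\Gamma$ and $p_1(\Gamma)$, $p_2(\Gamma)$ are dense. Let $\Gamma^*=\{\eta\in\mathbb R^m\times\mathbb R:\gamma\cdot\eta\in\mathbb Z\ \text{for all}\ \gamma\in\Gamma\}$ be the dual lattice, and let $p_1^*,p_2^*$ be the coordinate projections on $\Gamma^*$. Let $\Omega\subset\mathbb R$ be a nonempty compact interval that is the closure of its interior, symmetric around the origin, with $\partial\Omega\cap p_2(\Gamma)=\emptyset$, and let $$\Lambda(\Omega)=\{p_1(\gamma):\gamma\in\Gamma,\ p_2(\gamma)\in\Omega\}$$ be the corresponding simple generic model set, with density $D(\Lambda(\Omega))=\lim_{R\to\infty}\#(\Lambda(\Omega)\cap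 B(x,R))/R^m$ (the limit exists and does not depend on $x\in\mathbb R^m$). Let $0<\varepsilon<1$, let $|\cdot|$ be Lebesgue measure on $\mathbb R$, $\operatorname{sinc}x=\frac{\sin\pi x}{\pi x}$ (with $\operatorname{sinc}0=1$), $\Omega_n=(1-\varepsilon^n)\Omega$ and $\widehat\psi_n(t)=\prod_{s=0}^\infty\operatorname{sinc}(t\,|\varepsilon^{ns}\Omega_n|)$. Let $\Psi$ be the uniform limit of $(\widehat\psi_n)_n$ (which exists), and let $\Phi=|\Omega|\,(\Psi*\Psi)$, where the convolution integral converges absolutely at every point. Let $\Delta\subset\mathbb R^m$ be relatively dense (for some $r>0$, every cube $B(t,r)$ meets $\Delta$) and uniformly discrete (distinct points of $\Delta$ have distance at least some $r'>0$). Let $W(L^2,\ell^1)$ be the space of $f\in L^2(\mathbb R^m)$ with $\sum_{k\in\mathbb Z^m}\|f\,\mathbb 1_{k+[0,1]^m}\|_2<\infty$, let $g_1,\dots,g_L,h_1,\dots,h_L\in W(L^2,\ell^1)$, and let $$\mathcal G(g,\Lambda(\Omega),\Delta)=\{T_\lambda M_\beta g_l:\ l=1,\dots,L,\ \lambda\in\Lambda(\Omega),\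 \beta\in\Delta\},$$ and similarly $\mathcal G(h,\Lambda(\Omega),\Delta)$. A family $(e_i)$ in $L^2(\mathbb R^m)$ is a Bessel sequence if for some constant $B>0$ one has $\sum_i|\langle f,e_i\rangle|^2\le B\|f\|_2^2$ for all $f\in L^2(\mathbb R^m)$. The system $\mathcal G(h,\Lambda(\Omega),\Delta)$ is dual to $\mathcal G(g,\Lambda(\Omega),\Delta)$ if $$f=\sum_{l=1}^L\sum_{\beta\in\Delta}\sum_{\lambda\in\Lambda(\Omega)}\langle f,T_\lambda M_\beta g_l\rangle\,T_\lambda M_\beta h_l\qquad\text{for all } f\in L^2(\mathbb R^m),$$ with unconditional convergence in $L^2(\mathbb R^m)$. **Statement.** Assume that $\mathcal G(g,\Lambda(\Omega),\Delta)$ and $\mathcal G(h,\Lambda(\Omega),\Delta)$ are Bessel sequences for $L^2(\mathbb R^m)$. Then $\mathcal G(h,\Lambda(\Omega),\Delta)$ is dual to $\mathcal G(g,\Lambda(\Omega),\Delta)$ if and only if, for every $\eta\in\Gamma^*$, $$D(\Lambda(\Omega))\,\Phi(-p_2^*(\eta))\sum_{l=1}^L\sum_{\beta\in\Delta}\overline{\widehat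 g_l(t-\beta)}\,\widehat h_l(t-\beta-p_1^*(\eta))=\delta_{\eta,0}\qquad\text{for a.e. } t\in\mathbb R^m,$$ where $\delta_{\eta,0}$ is $1$ for $\eta=0$ and $0$ otherwise. Here the series over $\Delta$ converges absolutely for a.e. $t$, for each $l$ and each $\eta\in\Gamma^*$. -/

import Mathlib

open MeasureTheory Filter Topology
open scoped FourierTransform Pointwise ENNReal NNReal ComplexConjugate InnerProductSpace

noncomputable section

namespace ModelSetGabor

/-- Euclidean space `ℝᵐ`. -/
abbrev Rm (m : ℕ) : Type := EuclideanSpace ℝ (Fin m)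

/-- Complex valued `L²(ℝᵐ)`. -/
abbrev L2 (m : ℕ) : Type := Lp ℂ 2 (volume : Measure (Rm m))

/-- The cube `B(x, R) = R [0,1]ᵐ + x`. -/
def cube {m : ℕ} (x : Rm m) (R : ℝ) : Set (Rm m) :=
  {y | ∀ i, x i ≤ y i ∧ y i ≤ x i + R}

/-! ### Model sets -/

/-- The dual lattice `Γ*` in `ℝᵐ × ℝ`, for the dot product of the orthogonal sum: all `η` with
`γ · η = p₁(γ) · p₁(η) + p₂(γ) p₂(η) ∈ ℤ` for every `γ ∈ Γ`. -/
def dualLattice {m : ℕ} (Γ : Submodule ℤ (Rm m × ℝ)) : Set (Rm m × ℝ) :=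
  {η | ∀ γ ∈ Γ, ∃ k : ℤ, ⟪γ.1, η.1⟫_ℝ + γ.2 * η.2 = k}

/-- Both coordinate projections are injective on `Γ` and map it onto a dense subgroup. -/
structure ProjectionsInjectiveDense {m : ℕ} (Γ : Submodule ℤ (Rm m × ℝ)) : Prop where
  injOn_fst : Set.InjOn Prod.fst (Γ : Set (Rm m × ℝ))
  dense_fst : Dense (Prod.fst '' (Γ : Set (Rm m × ℝ)))
  injOn_snd : Set.InjOn Prod.snd (Γ : Set (Rm m × ℝ))
  dense_snd : Dense (Prod.snd '' (Γ : Set (Rm m × ℝ)))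

/-- A window of a simple model set: a nonempty compact interval of the line which is the closure
of its interior. (The boundary of an interval is automatically a null set.) -/
structure IsSimpleWindow (Ω : Set ℝ) : Prop where
  nonempty : Ω.Nonempty
  isCompact : IsCompact Ω
  ordConnected : Ω.OrdConnected
  closure_interior : closure (interior Ω) = Ω

/-- The model set `Λ(Ω) = {p₁(γ) : γ ∈ Γ, p₂(γ) ∈ Ω}`. -/
def modelSet {m : ℕ} (Γ : Submodule ℤ (Rm m × ℝ)) (Ω : Set ℝ) : Set (Rm m) :=
  Prod.fst '' {γ : Rm m × ℝ | γ ∈ Γ ∧ γ.2 ∈ Ω}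

/-- The model set is generic: the boundary of the window does not meet `p₂(Γ)`. -/
def IsGeneric {m : ℕ} (Γ : Submodule ℤ (Rm m × ℝ)) (Ω : Set ℝ) : Prop :=
  ∀ γ ∈ Γ, γ.2 ∉ frontier Ω

/-- `Λ` has density `D`: for every `x`, `#(Λ ∩ B(x, R)) / Rᵐ → D` as `R → ∞`. -/
def HasDensity {m : ℕ} (Λ : Set (Rm m)) (D : ℝ) : Prop :=
  ∀ x : Rm m, Tendsto (fun R : ℝ => ((Λ ∩ cube x R).ncard : ℝ) / R ^ m) atTop (𝓝 D)

/-- The density `D(Λ) = lim_{R → ∞} #(Λ ∩ B(0, R)) / Rᵐ`. -/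
def density {m : ℕ} (Λ : Set (Rm m)) : ℝ :=
  limUnder atTop (fun R : ℝ => ((Λ ∩ cube 0 R).ncard : ℝ) / R ^ m)

def IsRelativelyDense {m : ℕ} (Δ : Set (Rm m)) : Prop :=
  ∃ r : ℝ, 0 < r ∧ ∀ t, (Δ ∩ cube t r).Nonempty

def IsUniformlyDiscrete {m : ℕ} (Δ : Set (Rm m)) : Prop :=
  ∃ r : ℝ, 0 < r ∧ ∀ x ∈ Δ, ∀ y ∈ Δ, x ≠ y → r ≤ dist x y

/-! ### The function `Φ` -/

/-- With `Ωₙ = (1 - εⁿ) Ω`, the function `t ↦ ∏_{s ≥ 0} sinc (t |ε^{ns} Ωₙ|)`, where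
`sinc x = sin (π x) / (π x)` (so `sinc x = Real.sinc (π x)`). -/
def psiHat (ε : ℝ) (Ω : Set ℝ) (n : ℕ) (t : ℝ) : ℝ :=
  ∏' s : ℕ, Real.sinc (Real.pi * (t * volume.real (ε ^ (n * s) • ((1 - ε ^ n) • Ω))))

/-- The limit `Ψ` of the functions `psiHat ε Ω n` as `n → ∞`. -/
def Psi (ε : ℝ) (Ω : Set ℝ) (t : ℝ) : ℝ :=
  limUnder atTop (fun n : ℕ => psiHat ε Ω n t)

/-- `Φ = |Ω| (Ψ * Ψ)`, with `*` the convolution on the line. -/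
def Phi (ε : ℝ) (Ω : Set ℝ) (t : ℝ) : ℝ :=
  volume.real Ω * ∫ x : ℝ, Psi ε Ω x * Psi ε Ω (t - x)

/-! ### Wiener amalgam space, Gabor systems, Bessel sequences, duals -/

/-- Membership in the Wiener amalgam space `W(L², ℓ¹)`: the `L²` norms over the unit cubes
`[0,1]ᵐ + k`, `k ∈ ℤᵐ`, are summable. -/
def MemWiener {m : ℕ} (f : L2 m) : Prop :=
  ∑' k : Fin m → ℤ,
    eLpNorm ((cube (WithLp.toLp 2 fun i => (k i : ℝ)) 1).indicator (f : Rm m → ℂ)) 2 volume < ∞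

/-- The translation `T_x f (t) = f (t - x)`. -/
def translate {m : ℕ} (x : Rm m) (f : Rm m → ℂ) (t : Rm m) : ℂ := f (t - x)

/-- The modulation `M_ω f (t) = e^{2 π i ω · t} f (t)`. -/
def modulate {m : ℕ} (ω : Rm m) (f : Rm m → ℂ) (t : Rm m) : ℂ :=
  Complex.exp (2 * Real.pi * Complex.I * (⟪ω, t⟫_ℝ : ℝ)) * f t

theorem memLp_translate_modulate {m : ℕ} (x ω : Rm m) (f : L2 m) :
    MemLp (translate x (modulate ω f)) 2 (volume : Measure (Rm m)) := by
  have h : MemLp (modulate ω (f : Rm m → ℂ)) 2 (volume : Measure (Rm m)) := by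
    refine (Lp.memLp f).of_le ?_ (Eventually.of_forall fun t => ?_)
    · refine AEStronglyMeasurable.mul ?_ (Lp.memLp f).1
      exact Continuous.aestronglyMeasurable (by fun_prop)
    · have : (2 * Real.pi * Complex.I * (⟪ω, t⟫_ℝ : ℝ) : ℂ)
          = ((2 * Real.pi * ⟪ω, t⟫_ℝ : ℝ) : ℂ) * Complex.I := by push_cast; ring
      rw [modulate, norm_mul, this, Complex.norm_exp_ofReal_mul_I, one_mul]
  exact h.comp_measurePreserving (measurePreserving_sub_right volume x)

/-- The Gabor system `𝒢(g, Λ, Δ) = {T_λ M_β g_l : l, β ∈ Δ, λ ∈ Λ}`, as an indexed family in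
`L²(ℝᵐ)`. -/
def gaborSystem {m L : ℕ} (g : Fin L → L2 m) (Λ Δ : Set (Rm m)) :
    (Fin L × Δ) × Λ → L2 m :=
  fun i => (memLp_translate_modulate (i.2 : Rm m) (i.1.2 : Rm m) (g i.1.1)).toLp

/-- `e` is a Bessel sequence: `∑ᵢ |⟨f, eᵢ⟩|² ≤ B ‖f‖²` for all `f`, with a finite constant `B`. -/
def IsBessel {ι H : Type*} [NormedAddCommGroup H] [InnerProductSpace ℂ H] (e : ι → H) : Prop :=
  ∃ B : ℝ, 0 < B ∧ ∀ f : H, Summable (fun i => ‖⟪e i, f⟫_ℂ‖ ^ 2) ∧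
    ∑' i, ‖⟪e i, f⟫_ℂ‖ ^ 2 ≤ B * ‖f‖ ^ 2

/-- `e'` is a dual of `e`: the mixed frame operator `f ↦ ∑ᵢ ⟨f, eᵢ⟩ e'ᵢ` is the identity.
(Mathlib's inner product is linear in the second variable, so `⟨f, eᵢ⟩` is `⟪e i, f⟫_ℂ`.) -/
def IsDualSystem {ι H : Type*} [NormedAddCommGroup H] [InnerProductSpace ℂ H]
    (e' e : ι → H) : Prop :=
  ∀ f : H, HasSum (fun i => ⟪e i, f⟫_ℂ • e' i) f

open scoped Classical in
/-- The Kronecker delta `δ_{η,0}`. -/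
def delta {m : ℕ} (η : Rm m × ℝ) : ℂ := if η = 0 then 1 else 0

end ModelSetGabor

end

open ModelSetGabor

/-! Put `u j = M_β g_l` and `v j = M_β h_l` for `j = (l, β)`, so that both systems consist of
translates along the model set. For `f₁, f₂` in `L²` let `S(x) = ∑ⱼ ⟪T₋ₓ f₂, vⱼ⟫ ⟪uⱼ, T₋ₓ f₁⟫`
(`mixedSum`), and let `F = S ⊗ 1_Ω` on `ℝᵐ × ℝ` (`windowTensor`). The mixed frame form at `T₋ₓ f₁,
T₋ₓ f₂` is then the value at `(x, 0)` of the `Γ`-periodization of `F` (`tsum_windowTensor_zero`).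
Bessel families have a bounded mixed frame operator, so duality says that this periodization equals
`⟪f₂, f₁⟫` along `ℝᵐ × {0}`, for `f₁, f₂` in a dense set.

The slice `ℝᵐ × {0}` has dense image in the torus `(ℝᵐ × ℝ) / Γ`, because `p₂(Γ)` is dense. The
periodization is continuous along the slice, and it is continuous in the window direction at every
height that puts no lattice point on the boundary of the window; genericity makes `0` such a height.
Constancy on the slice is therefore constancy almost everywhere
(`forall_tsum_windowTensor_zero_eq_iff`), which is a condition on the Fourier coefficients at `η ∈
Γ*` (`ae_periodization_eq_const_iff`). The integrability of `F` that this needs follows from the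
Bessel bounds (`lintegral_energy_ne_top`).

The coefficient at `η` factors. The window contributes `|Ω| sinc(|Ω| p₂(η))`. If `f₁, f₂` have
Schwartz Fourier transforms `φ₁, φ₂`, Plancherel turns the other factor into the integral of `φ₁(t)
conj φ₂(t - p₁(η))` against the series over `l` and `β` (`integral_mixedSum_mul_exp`). Since `φ₁,
φ₂` are arbitrary, the integral conditions become identities for almost every `t`. It remains to
identify the constants: the density is `|Ω|` divided by the covolume of `Γ`, by packing and covering
with fundamental domains, and `Φ(t) = sinc(t |Ω|)`, because only the factor `s = 0` survives in `Ψ`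
and `|Ω| (Ψ * Ψ)` reproduces the sinc function. -/

set_option linter.unusedSectionVars false

namespace ModelSetGabor

/-! ### Plancherel for functions in `L¹ ∩ L²` -/

section Plancherel

variable {V : Type*} [NormedAddCommGroup V] [InnerProductSpace ℝ V] [FiniteDimensional ℝ V]
  [MeasurableSpace V] [BorelSpace V]

theorem continuous_fourier_of_integrable {f : V → ℂ} (hf : Integrable f) : Continuous (𝓕 f) :=
  VectorFourier.fourierIntegral_continuous Real.continuous_fourierChar continuous_inner hf

/-- The Fourier integral of a function in `L¹ ∩ L²` represents its `L²` Fourier transform. -/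
theorem coeFn_fourier_toLp {f : V → ℂ} (hf : Integrable f) (hf2 : MemLp f 2) :
    ((𝓕 (hf2.toLp f) : Lp ℂ 2 (volume : Measure V)) : V → ℂ) =ᵐ[volume] 𝓕 f := by
  refine ae_eq_of_integral_contDiff_smul_eq
    ((Lp.memLp _).locallyIntegrable (by norm_num))
    (continuous_fourier_of_integrable hf).locallyIntegrable ?_
  intro g hg hgs
  let φ : SchwartzMap V ℂ := HasCompactSupport.toSchwartzMap
    (f := fun x => (g x : ℂ)) (hgs.comp_left (g := fun t : ℝ => (t : ℂ)) (by simp))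
    (Complex.ofRealCLM.contDiff.comp hg)
  have hφ : ∀ x, φ x = (g x : ℂ) := fun x => rfl
  -- The `L²` transform is compatible with the distributional one, which moves the transform onto
  -- the test function; `h4` is the same duality for the Fourier integral.
  have h1 := congrArg (fun T => T φ) (Lp.fourier_toTemperedDistribution_eq (hf2.toLp f))
  have h2 : ∫ x, 𝓕 φ x • (hf2.toLp f : V → ℂ) x = ∫ x, φ x • (𝓕 (hf2.toLp f) : Lp ℂ 2 (volume : Measure V)) x := by
    simpa [TemperedDistribution.fourier_apply, Lp.toTemperedDistribution_apply] using h1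
  have h3 : ∫ x, 𝓕 φ x • (hf2.toLp f : V → ℂ) x = ∫ x, 𝓕 φ x • f x := by
    refine integral_congr_ae ?_
    filter_upwards [hf2.coeFn_toLp] with x hx
    rw [hx]
  have h4 : ∫ x, 𝓕 φ x • f x = ∫ x, φ x • 𝓕 f x := by
    have := VectorFourier.integral_fourierIntegral_smul_eq_flip (L := innerₗ V)
      (μ := (volume : Measure V)) (ν := volume)
      Real.continuous_fourierChar continuous_inner φ.integrable hf
    simpa using! this
  have e : ∀ u : V → ℂ, ∫ x, g x • u x = ∫ x, φ x • u x := fun u => by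
    refine integral_congr_ae (Eventually.of_forall fun x => ?_)
    simp [hφ]
  rw [e, e, ← h4, ← h3, h2]

theorem memLp_fourier {f : V → ℂ} (hf : Integrable f) (hf2 : MemLp f 2) : MemLp (𝓕 f) 2 :=
  (memLp_congr_ae (coeFn_fourier_toLp hf hf2)).1 (Lp.memLp _)

theorem eLpNorm_fourier {f : V → ℂ} (hf : Integrable f) (hf2 : MemLp f 2) :
    eLpNorm (𝓕 f) 2 volume = eLpNorm f 2 volume := by
  rw [← eLpNorm_congr_ae (coeFn_fourier_toLp hf hf2), ← eLpNorm_congr_ae hf2.coeFn_toLp,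
    ← Lp.enorm_def, ← Lp.enorm_def, ← ofReal_norm, ← ofReal_norm, Lp.norm_fourier_eq]

theorem integral_conj_fourier_mul {f g : V → ℂ} (hf : Integrable f) (hf2 : MemLp f 2)
    (hg : Integrable g) (hg2 : MemLp g 2) :
    ∫ x, conj (𝓕 f x) * 𝓕 g x = ∫ x, conj (f x) * g x := by
  have h := Lp.inner_fourier_eq (hf2.toLp f) (hg2.toLp g)
  rw [L2.inner_def, L2.inner_def] at h
  simp only [RCLike.inner_apply] at h
  calc _ = _ := integral_congr_ae ?_
    _ = _ := h
    _ = _ := integral_congr_ae ?_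
  · filter_upwards [coeFn_fourier_toLp hf hf2, coeFn_fourier_toLp hg hg2] with x h1 h2
    rw [h1, h2, mul_comm]
  · filter_upwards [hf2.coeFn_toLp, hg2.coeFn_toLp] with x h1 h2
    rw [h1, h2, mul_comm]

end Plancherel

theorem fourierInv_eq_fourier_neg_fun {V : Type*} [NormedAddCommGroup V] [InnerProductSpace ℝ V]
    [FiniteDimensional ℝ V] [MeasurableSpace V] [BorelSpace V] (f : V → ℂ) :
    𝓕⁻ f = fun x => 𝓕 f (-x) := funext fun x => Real.fourierInv_eq_fourier_neg f x

/-! ### The functions `Ψ` and `Φ` as sinc functions -/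

section Sinc

/-- A crude linear bound is enough to sum the deviations from `1` along a geometric sequence. From
`|x| = 2` on it follows from `|sinc| ≤ 1`, below that from `sin x > x - x³/6`. -/
theorem abs_sinc_sub_one_le (x : ℝ) : |Real.sinc x - 1| ≤ |x| := by
  rcases eq_or_ne x 0 with rfl | hx
  · simp
  wlog hpos : 0 < x generalizing x
  · have := this (-x) (by simpa using hx)
      (by rcases lt_or_gt_of_ne hx with h | h <;> [linarith; exact absurd h hpos])
    simpa using this
  rcases le_or_gt 2 x with h2 | h2
  · have := Real.abs_sinc_le_one x
    rw [abs_le] at this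
    rw [abs_le, abs_of_pos hpos]
    constructor <;> linarith
  · rw [abs_of_pos hpos, abs_le]
    refine ⟨?_, by linarith [Real.sinc_le_one x]⟩
    rw [Real.sinc_of_ne_zero hx, le_sub_iff_add_le, le_div_iff₀ hpos]
    have h1 : x - x ^ 3 / 6 < Real.sin x := Real.sin_gt_sub_cube hpos
    nlinarith [mul_pos hpos hpos, mul_nonneg (mul_pos hpos hpos).le (sub_nonneg.2 h2.le)]

theorem abs_sinc_mul_abs_le (x : ℝ) : |Real.sinc x| * |x| ≤ 1 := by
  rcases eq_or_ne x 0 with rfl | hx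
  · simp
  · rw [Real.sinc_of_ne_zero hx, ← abs_mul, div_mul_cancel₀ _ hx]
    exact Real.abs_sin_le_one x

/-- The bound does not depend on `x`, which is what makes the convergence to `Ψ` uniform. The
increment of the sine is at most `(1 - q) |x|`, and the denominator cancels `|x|`. -/
theorem abs_sinc_mul_sub_le {q : ℝ} (hq : 0 < q) (hq1 : q ≤ 1) (x : ℝ) :
    |Real.sinc (q * x) - Real.sinc x| ≤ 2 * (1 - q) := by
  rcases eq_or_ne x 0 with rfl | hx
  · simp; linarith
  have hqx : q * x ≠ 0 := mul_ne_zero hq.ne' hx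
  rw [Real.sinc_of_ne_zero hqx, Real.sinc_of_ne_zero hx]
  have e : Real.sin (q * x) / (q * x) - Real.sin x / x
      = (1 - q) * (Real.sin (q * x) / (q * x)) + (Real.sin (q * x) - Real.sin x) / x := by
    field_simp; ring
  have h1 : |Real.sin (q * x) / (q * x)| ≤ 1 := by
    rw [← Real.sinc_of_ne_zero hqx]; exact Real.abs_sinc_le_one _
  have h2 : |(Real.sin (q * x) - Real.sin x) / x| ≤ 1 - q := by
    rw [abs_div, div_le_iff₀ (abs_pos.2 hx)]
    have := Real.abs_sin_sub_sin_le (q * x) x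
    calc _ ≤ |q * x - x| := this
      _ = |(q - 1) * x| := by ring_nf
      _ = (1 - q) * |x| := by rw [abs_mul, abs_sub_comm, abs_of_nonneg (by linarith : 0 ≤ 1 - q)]
  rw [e]
  calc _ ≤ |(1 - q) * (Real.sin (q * x) / (q * x))| + |(Real.sin (q * x) - Real.sin x) / x| :=
        abs_add_le _ _
    _ ≤ (1 - q) * 1 + (1 - q) := by
        rw [abs_mul, abs_of_nonneg (by linarith : 0 ≤ 1 - q)]
        gcongr
    _ = _ := by ring

theorem abs_prod_sub_one_le {ι : Type*} (s : Finset ι) (f : ι → ℝ) (hf : ∀ i, |f i| ≤ 1) :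
    |∏ i ∈ s, f i - 1| ≤ ∑ i ∈ s, |f i - 1| := by
  classical
  induction s using Finset.induction_on with
  | empty => simp
  | insert a s ha ih =>
    rw [Finset.prod_insert ha, Finset.sum_insert ha]
    have : f a * ∏ i ∈ s, f i - 1 = f a * (∏ i ∈ s, f i - 1) + (f a - 1) := by ring
    rw [this]
    calc _ ≤ |f a * (∏ i ∈ s, f i - 1)| + |f a - 1| := abs_add_le _ _
      _ ≤ 1 * |∏ i ∈ s, f i - 1| + |f a - 1| := by rw [abs_mul]; gcongr; exact hf a
      _ ≤ _ := by linarith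

theorem multipliable_of_summable_sub_one {f : ℕ → ℝ} (hs : Summable fun i => |f i - 1|) :
    Multipliable f := by
  have := Real.multipliable_one_add_of_summable (f := fun i => f i - 1) (Summable.of_abs hs)
  simpa using this

theorem abs_tprod_sub_one_le {f : ℕ → ℝ} (hf : ∀ i, |f i| ≤ 1)
    (hs : Summable fun i => |f i - 1|) : |∏' i, f i - 1| ≤ ∑' i, |f i - 1| := by
  have h1 : Tendsto (fun n => |∏ i ∈ Finset.range n, f i - 1|) atTop (𝓝 |∏' i, f i - 1|) :=
    (((multipliable_of_summable_sub_one hs).hasProd.tendsto_prod_nat).sub_const 1).abs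
  refine le_of_tendsto h1 (Eventually.of_forall fun n => ?_)
  exact (abs_prod_sub_one_le _ _ hf).trans (hs.sum_le_tsum _ fun i _ => abs_nonneg _)

theorem volume_real_smul_window {ε : ℝ} (hε : 0 < ε) (hε' : ε < 1) (Ω : Set ℝ) (n s : ℕ) :
    volume.real (ε ^ (n * s) • ((1 - ε ^ n) • Ω))
      = (ε ^ n) ^ s * ((1 - ε ^ n) * volume.real Ω) := by
  have h0 : 0 ≤ 1 - ε ^ n := by linarith [pow_le_one₀ (n := n) hε.le hε'.le]
  rw [measureReal_def, Measure.addHaar_smul, Measure.addHaar_smul, measureReal_def]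
  simp [abs_of_nonneg h0, abs_of_pos hε, pow_mul, ENNReal.toReal_ofReal h0,
    ENNReal.toReal_ofReal (pow_nonneg (pow_nonneg hε.le _) _)]

/-- With `q = εⁿ` and `y = π t (1 - q) |Ω|`, the factors are `sinc (q ^ s * y)`. The product over `s
≥ 1` differs from `1` by at most `q |y| / (1 - q)`; this is unbounded in `t`, but the factor `s = 0`
compensates through `|sinc y| |y| ≤ 1`. The term `2 q` pays for replacing `|Ωₙ|` by `|Ω|` in that
factor. -/
theorem abs_psiHat_sub_sinc_le {ε : ℝ} (hε : 0 < ε) (hε' : ε < 1) (Ω : Set ℝ) {n : ℕ} (hn : n ≠ 0)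
    (t : ℝ) : |psiHat ε Ω n t - Real.sinc (Real.pi * (t * volume.real Ω))|
      ≤ ε ^ n / (1 - ε ^ n) + 2 * ε ^ n := by
  set q := ε ^ n with hq
  have hq0 : 0 < q := pow_pos hε _
  have hq1 : q < 1 := pow_lt_one₀ hε.le hε' hn
  set w := volume.real Ω
  set y := Real.pi * (t * ((1 - q) * w)) with hy
  have hterm : psiHat ε Ω n t = ∏' s : ℕ, Real.sinc (q ^ s * y) := by
    rw [psiHat]
    congr 1; funext s
    rw [volume_real_smul_window hε hε']
    congr 1
    rw [hy]; ring
  have hle : ∀ s : ℕ, |Real.sinc (q ^ s * y) - 1| ≤ q ^ s * |y| := fun s => by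
    refine (abs_sinc_sub_one_le _).trans ?_
    rw [abs_mul, abs_of_pos (pow_pos hq0 s)]
  have hsum : Summable fun s : ℕ => q ^ s * |y| :=
    (summable_geometric_of_lt_one hq0.le hq1).mul_right _
  have hS : Summable fun s : ℕ => |Real.sinc (q ^ s * y) - 1| :=
    Summable.of_nonneg_of_le (fun _ => abs_nonneg _) hle hsum
  have hS' := (summable_nat_add_iff (f := fun s : ℕ => |Real.sinc (q ^ s * y) - 1|) 1).2 hS
  have hsplit : ∏' s : ℕ, Real.sinc (q ^ s * y)
      = Real.sinc y * ∏' s : ℕ, Real.sinc (q ^ (s + 1) * y) := by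
    have := tprod_eq_zero_mul' (f := fun s : ℕ => Real.sinc (q ^ s * y))
      (multipliable_of_summable_sub_one hS')
    simpa using this
  have hP : |∏' s : ℕ, Real.sinc (q ^ (s + 1) * y) - 1| ≤ q / (1 - q) * |y| := by
    refine (abs_tprod_sub_one_le (fun _ => Real.abs_sinc_le_one _) hS').trans ?_
    have hsum' := (summable_nat_add_iff (f := fun s : ℕ => q ^ s * |y|) 1).2 hsum
    refine (hS'.tsum_le_tsum (fun s => hle (s + 1)) hsum').trans (le_of_eq ?_)
    simp_rw [pow_succ', mul_assoc]
    rw [tsum_mul_left, tsum_mul_right, tsum_geometric_of_lt_one hq0.le hq1]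
    ring
  have e : Real.pi * (t * volume.real Ω) = Real.pi * (t * w) := rfl
  have hlast : |Real.sinc y - Real.sinc (Real.pi * (t * w))| ≤ 2 * q := by
    have := abs_sinc_mul_sub_le (q := 1 - q) (by linarith) (by linarith) (Real.pi * (t * w))
    have e2 : (1 - q) * (Real.pi * (t * w)) = y := by rw [hy]; ring
    rw [e2] at this
    linarith
  rw [hterm, hsplit]
  set P := ∏' s : ℕ, Real.sinc (q ^ (s + 1) * y)
  have : Real.sinc y * P - Real.sinc (Real.pi * (t * w))
      = Real.sinc y * (P - 1) + (Real.sinc y - Real.sinc (Real.pi * (t * w))) := by ring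
  rw [this]
  refine (abs_add_le _ _).trans (add_le_add ?_ hlast)
  rw [abs_mul]
  have hqq : 0 ≤ q / (1 - q) := div_nonneg hq0.le (by linarith)
  calc _ ≤ |Real.sinc y| * (q / (1 - q) * |y|) := by gcongr
    _ = q / (1 - q) * (|Real.sinc y| * |y|) := by ring
    _ ≤ q / (1 - q) * 1 := by gcongr; exact abs_sinc_mul_abs_le y
    _ = _ := mul_one _

theorem tendstoUniformly_psiHat_sinc {ε : ℝ} (hε : 0 < ε) (hε' : ε < 1) (Ω : Set ℝ) :
    TendstoUniformly (psiHat ε Ω) (fun t => Real.sinc (Real.pi * (t * volume.real Ω))) atTop := by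
  have hlim : Tendsto (fun n : ℕ => ε ^ n / (1 - ε ^ n) + 2 * ε ^ n) atTop (𝓝 0) := by
    have h := tendsto_pow_atTop_nhds_zero_of_lt_one hε.le hε'
    have := (h.div (tendsto_const_nhds (x := (1 : ℝ)) |>.sub h) (by norm_num)).add (h.const_mul 2)
    simpa using this
  rw [Metric.tendstoUniformly_iff]
  intro δ hδ
  filter_upwards [hlim.eventually (gt_mem_nhds hδ), eventually_ne_atTop 0] with n hn hn0 t
  rw [dist_comm, Real.dist_eq]
  exact (abs_psiHat_sub_sinc_le hε hε' Ω hn0 t).trans_lt hn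

theorem Psi_eq_sinc {ε : ℝ} (hε : 0 < ε) (hε' : ε < 1) (Ω : Set ℝ) :
    Psi ε Ω = fun t => Real.sinc (Real.pi * (t * volume.real Ω)) :=
  funext fun t => ((tendstoUniformly_psiHat_sinc hε hε' Ω).tendsto_at t).limUnder_eq

theorem tendstoUniformly_psiHat {ε : ℝ} (hε : 0 < ε) (hε' : ε < 1) (Ω : Set ℝ) :
    TendstoUniformly (psiHat ε Ω) (Psi ε Ω) atTop := by
  rw [Psi_eq_sinc hε hε']
  exact tendstoUniformly_psiHat_sinc hε hε' Ω

/-- The character `t ↦ e^{2πiωt}` on the interval `[-a, a]`, extended by zero. -/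
noncomputable def windowExp (a ω : ℝ) : ℝ → ℂ :=
  (Set.Icc (-a) a).indicator fun t => Complex.exp ((2 * Real.pi * (ω * t) : ℝ) * Complex.I)

theorem memLp_windowExp (a ω : ℝ) (p : ℝ≥0∞) : MemLp (windowExp a ω) p := by
  refine ((memLp_indicator_const p (measurableSet_Icc (a := -a) (b := a)) (1 : ℂ)
    (Or.inr (by simp))).of_le (g := (Set.Icc (-a) a).indicator fun _ => (1 : ℂ)) ?_ ?_)
  · exact AEStronglyMeasurable.indicator (Continuous.aestronglyMeasurable (by fun_prop))
      measurableSet_Icc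
  · refine Eventually.of_forall fun t => ?_
    rw [windowExp, norm_indicator_eq_indicator_norm, norm_indicator_eq_indicator_norm]
    simp only [Complex.norm_exp_ofReal_mul_I, norm_one, le_refl]

theorem integral_exp_window {a : ℝ} (ha : 0 ≤ a) (ξ : ℝ) :
    ∫ y in Set.Icc (-a) a, Complex.exp ((-2 * Real.pi * (y * ξ) : ℝ) * Complex.I)
      = (2 * a) * Real.sinc (Real.pi * (ξ * (2 * a))) := by
  rw [integral_Icc_eq_integral_Ioc, ← intervalIntegral.integral_of_le (by linarith)]
  rcases eq_or_ne ξ 0 with rfl | hξ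
  · simp; ring
  have hc : (-2 * Real.pi * ξ : ℝ) ≠ 0 := by simp [hξ, Real.pi_ne_zero]
  have h := intervalIntegral.integral_comp_mul_right
    (fun u : ℝ => Complex.exp (u * Complex.I)) hc (a := -a) (b := a)
  have e : ∀ y : ℝ, (-2 * Real.pi * (y * ξ) : ℝ) = y * (-2 * Real.pi * ξ) := fun y => by ring
  simp_rw [e]
  rw [h]
  have e2 : -a * (-2 * Real.pi * ξ) = -(a * (-2 * Real.pi * ξ)) := by ring
  rw [e2, integral_exp_mul_I_eq_sinc]
  have e3 : a * (-2 * Real.pi * ξ) = -(Real.pi * (ξ * (2 * a))) := by ring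
  rw [e3, Real.sinc_neg]
  have hξ' : (ξ : ℂ) ≠ 0 := by exact_mod_cast hξ
  have hpi : (Real.pi : ℂ) ≠ 0 := by exact_mod_cast Real.pi_ne_zero
  rw [Complex.real_smul]
  push_cast
  field_simp

theorem fourier_windowExp {a : ℝ} (ha : 0 ≤ a) (ω ξ : ℝ) :
    𝓕 (windowExp a ω) ξ = (2 * a) * Real.sinc (Real.pi * ((ξ - ω) * (2 * a))) := by
  rw [← integral_exp_window ha, Real.fourier_eq', ← integral_indicator measurableSet_Icc]
  refine integral_congr_ae (Eventually.of_forall fun t => ?_)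
  by_cases ht : t ∈ Set.Icc (-a) a
  · simp only [windowExp, Set.indicator_of_mem ht, smul_eq_mul]
    rw [← Complex.exp_add]
    congr 1
    simp
    ring
  · simp [windowExp, Set.indicator_of_notMem ht]

/-- Up to the factor `2a`, the two sinc factors are the Fourier transforms of the indicator of `[-a,
a]` and of its modulation by `t`. Plancherel turns their pairing into the integral of `e^{2πitx}`
over `[-a, a]`, which is again a sinc. Integrability comes from the product of two `L²` functions.
-/
theorem sinc_convolution {a : ℝ} (ha : 0 < a) (t : ℝ) :
    Integrable (fun x : ℝ => Real.sinc (Real.pi * (x * (2 * a)))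
      * Real.sinc (Real.pi * ((t - x) * (2 * a)))) ∧
    ∫ x : ℝ, Real.sinc (Real.pi * (x * (2 * a))) * Real.sinc (Real.pi * ((t - x) * (2 * a)))
      = Real.sinc (Real.pi * (t * (2 * a))) / (2 * a) := by
  have hi : ∀ ω, Integrable (windowExp a ω) := fun ω => memLp_one_iff_integrable.1 (memLp_windowExp a ω 1)
  have h2 : ∀ ω, MemLp (windowExp a ω) 2 := fun ω => memLp_windowExp a ω 2
  have hF := memLp_fourier (hi 0) (h2 0)
  have hG := memLp_fourier (hi t) (h2 t)
  have hprod : ∀ x : ℝ, 𝓕 (windowExp a 0) x * 𝓕 (windowExp a t) x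
      = (((2 * a) ^ 2 * (Real.sinc (Real.pi * (x * (2 * a)))
          * Real.sinc (Real.pi * ((t - x) * (2 * a)))) : ℝ) : ℂ) := fun x => by
    rw [fourier_windowExp ha.le, fourier_windowExp ha.le, sub_zero, ← Real.sinc_neg
      (Real.pi * ((x - t) * (2 * a)))]
    have : -(Real.pi * ((x - t) * (2 * a))) = Real.pi * ((t - x) * (2 * a)) := by ring
    rw [this]
    push_cast
    ring
  have hconj : ∀ x : ℝ, conj (𝓕 (windowExp a 0) x) = 𝓕 (windowExp a 0) x := fun x => by
    rw [fourier_windowExp ha.le]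
    exact Complex.conj_eq_iff_real.2 ⟨2 * a * Real.sinc (Real.pi * ((x - 0) * (2 * a))), by push_cast; rfl⟩
  have hI : Integrable fun x => 𝓕 (windowExp a 0) x * 𝓕 (windowExp a t) x := hF.integrable_mul hG
  have hP := integral_conj_fourier_mul (hi 0) (h2 0) (hi t) (h2 t)
  have hR : ∫ x, conj (windowExp a 0 x) * windowExp a t x
      = (((2 * a) * Real.sinc (Real.pi * (t * (2 * a))) : ℝ) : ℂ) := by
    have := fourier_windowExp ha.le t 0
    rw [zero_sub, neg_mul, mul_neg, Real.sinc_neg] at this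
    push_cast
    rw [← this, Real.fourier_eq']
    refine integral_congr_ae (Eventually.of_forall fun x => ?_)
    by_cases hx : x ∈ Set.Icc (-a) a
    · simp [windowExp, Set.indicator_of_mem hx]
    · simp [windowExp, Set.indicator_of_notMem hx]
  simp_rw [hconj] at hP
  rw [hR] at hP
  simp_rw [hprod] at hP hI
  rw [integral_complex_ofReal, integral_const_mul] at hP
  have hP' := Complex.ofReal_injective hP
  have ha2 : (2 * a) ^ 2 ≠ 0 := by positivity
  refine ⟨?_, ?_⟩
  · have := hI.re
    simp only [RCLike.re_to_complex, Complex.ofReal_re] at this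
    exact (integrable_const_mul_iff (by simpa using ha.ne') _).1 this
  · field_simp at hP' ⊢
    linarith

theorem exists_window_eq_Icc {Ω : Set ℝ} (hΩ : IsSimpleWindow Ω) (hsymm : ∀ x ∈ Ω, -x ∈ Ω) :
    ∃ a : ℝ, 0 < a ∧ Ω = Set.Icc (-a) a := by
  have hint : (interior Ω).Nonempty := by
    by_contra h
    rw [Set.not_nonempty_iff_eq_empty] at h
    have := hΩ.closure_interior
    rw [h, closure_empty] at this
    exact hΩ.nonempty.ne_empty this.symm
  set a := sSup Ω
  have ha : a ∈ Ω := hΩ.isCompact.sSup_mem hΩ.nonempty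
  have hle : ∀ x ∈ Ω, x ≤ a := fun x hx => le_csSup hΩ.isCompact.bddAbove hx
  have heq : Ω = Set.Icc (-a) a := by
    apply Set.Subset.antisymm
    · intro x hx
      exact ⟨by linarith [hle _ (hsymm x hx)], hle x hx⟩
    · exact hΩ.ordConnected.out (hsymm a ha) ha
  refine ⟨a, ?_, heq⟩
  rw [heq, interior_Icc] at hint
  obtain ⟨x, hx1, hx2⟩ := hint
  linarith

theorem Psi_Icc {ε : ℝ} (hε : 0 < ε) (hε' : ε < 1) {a : ℝ} (ha : 0 < a) (t : ℝ) :
    Psi ε (Set.Icc (-a) a) t = Real.sinc (Real.pi * (t * (2 * a))) := by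
  rw [Psi_eq_sinc hε hε', Real.volume_real_Icc_of_le (by linarith)]
  ring_nf

theorem integrable_Psi_mul {ε : ℝ} (hε : 0 < ε) (hε' : ε < 1) {a : ℝ} (ha : 0 < a) (t : ℝ) :
    Integrable fun x => Psi ε (Set.Icc (-a) a) x * Psi ε (Set.Icc (-a) a) (t - x) := by
  simp_rw [Psi_Icc hε hε' ha]
  exact (sinc_convolution ha t).1

theorem Phi_Icc {ε : ℝ} (hε : 0 < ε) (hε' : ε < 1) {a : ℝ} (ha : 0 < a) (t : ℝ) :
    Phi ε (Set.Icc (-a) a) t = Real.sinc (Real.pi * (t * (2 * a))) := by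
  rw [Phi, Real.volume_real_Icc_of_le (by linarith)]
  simp_rw [Psi_Icc hε hε' ha]
  rw [(sinc_convolution ha t).2]
  field_simp
  ring_nf

end Sinc

/-! ### Fundamental domains and lattice point counts -/

section LatticeDomain

variable {V : Type*} [NormedAddCommGroup V] [NormedSpace ℝ V] [FiniteDimensional ℝ V]
  [MeasurableSpace V] [BorelSpace V]
  (Γ : Submodule ℤ V) [DiscreteTopology Γ] [IsZLattice ℝ Γ]

instance (μ : Measure V) [μ.IsAddHaarMeasure] : VAddInvariantMeasure Γ V μ :=
  inferInstanceAs (VAddInvariantMeasure Γ.toAddSubgroup V μ)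

/-- A bounded fundamental domain of the lattice `Γ`. -/
noncomputable def latticeDomain : Set V :=
  ZSpan.fundamentalDomain ((Module.Free.chooseBasis ℤ Γ).ofZLatticeBasis ℝ)

theorem isAddFundamentalDomain_latticeDomain (μ : Measure V) :
    IsAddFundamentalDomain Γ (latticeDomain Γ) μ :=
  ZLattice.isAddFundamentalDomain _ μ

theorem measurableSet_latticeDomain : MeasurableSet (latticeDomain Γ) :=
  ZSpan.fundamentalDomain_measurableSet _

theorem isBounded_latticeDomain : Bornology.IsBounded (latticeDomain Γ) :=
  ZSpan.fundamentalDomain_isBounded _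

theorem measure_latticeDomain_ne_zero (μ : Measure V) [μ.IsAddHaarMeasure] :
    μ (latticeDomain Γ) ≠ 0 :=
  ZSpan.measure_fundamentalDomain_ne_zero _

theorem measure_latticeDomain_ne_top (μ : Measure V) [μ.IsAddHaarMeasure] :
    μ (latticeDomain Γ) ≠ ∞ :=
  (isBounded_latticeDomain Γ).measure_lt_top.ne

theorem existsUnique_vadd_mem_latticeDomain (z : V) : ∃! γ : Γ, (γ : V) + z ∈ latticeDomain Γ := by
  have h := ZSpan.exist_unique_vadd_mem_fundamentalDomain
    ((Module.Free.chooseBasis ℤ Γ).ofZLatticeBasis ℝ) z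
  have hs := (Module.Free.chooseBasis ℤ Γ).ofZLatticeBasis_span ℝ
  obtain ⟨γ, h1, h2⟩ := h
  have hm : ∀ {x : V}, x ∈ Submodule.span ℤ
      (Set.range ((Module.Free.chooseBasis ℤ Γ).ofZLatticeBasis ℝ)) ↔ x ∈ Γ := by
    intro x; rw [hs]
  refine ⟨⟨γ, hm.1 γ.2⟩, h1, fun γ' hγ' => ?_⟩
  have := h2 ⟨γ', hm.2 γ'.2⟩ hγ'
  rw [← this]

/-- The counting measure of the lattice `Γ` on the ambient space. -/
noncomputable def latticeCount : Measure V := Measure.sum fun γ : Γ => Measure.dirac (γ : V)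

variable {Γ}

theorem latticeCount_apply {A : Set V} (hA : MeasurableSet A) :
    latticeCount Γ A = ∑' γ : Γ, A.indicator 1 (γ : V) := by
  rw [latticeCount, Measure.sum_apply _ hA]
  simp_rw [Measure.dirac_apply' _ hA]

theorem latticeCount_le_of_translate {A A' : Set V} (hA : MeasurableSet A) (hA' : MeasurableSet A')
    {γ₀ : V} (hγ₀ : γ₀ ∈ Γ) (h : ∀ p ∈ A, p + γ₀ ∈ A') : latticeCount Γ A ≤ latticeCount Γ A' := by
  rw [latticeCount_apply hA, latticeCount_apply hA',
    ← (Equiv.addRight (⟨γ₀, hγ₀⟩ : Γ)).tsum_eq fun γ : Γ => A'.indicator 1 (γ : V)]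
  refine ENNReal.tsum_le_tsum fun γ => ?_
  by_cases hγ : (γ : V) ∈ A
  · have h' : (γ : V) + γ₀ ∈ A' := h _ hγ
    simp [hγ, h']
  · simp [hγ]

/-- Packing: the domains attached to the lattice points of `A` are disjoint up to null sets and lie
in `A'`. -/
theorem latticeCount_mul_le {A A' : Set V} (hA : MeasurableSet A) (μ : Measure V)
    [μ.IsAddHaarMeasure] (h : ∀ p ∈ A, ∀ d ∈ latticeDomain Γ, p + d ∈ A') :
    latticeCount Γ A * μ (latticeDomain Γ) ≤ μ A' := by
  rw [(isAddFundamentalDomain_latticeDomain Γ μ).measure_eq_tsum' A', latticeCount_apply hA,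
    ← ENNReal.tsum_mul_right]
  refine ENNReal.tsum_le_tsum fun γ => ?_
  by_cases hγ : (γ : V) ∈ A
  · have hsub : γ +ᵥ latticeDomain Γ ⊆ A' := by
      rintro _ ⟨d, hd, rfl⟩
      exact h _ hγ d hd
    rw [Set.inter_eq_right.2 hsub, Set.indicator_of_mem hγ]
    have : μ (γ +ᵥ latticeDomain Γ) = μ (latticeDomain Γ) := measure_vadd μ (γ : V) _
    simp [this]
  · simp [Set.indicator_of_notMem hγ]

/-- Covering: the domains tile the space, and only those attached to lattice points of `A` can meet
`A'`. -/
theorem le_latticeCount_mul {A A' : Set V} (hA : MeasurableSet A) (μ : Measure V)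
    [μ.IsAddHaarMeasure] (h : ∀ p, ∀ d ∈ latticeDomain Γ, p + d ∈ A' → p ∈ A) :
    μ A' ≤ latticeCount Γ A * μ (latticeDomain Γ) := by
  rw [(isAddFundamentalDomain_latticeDomain Γ μ).measure_eq_tsum' A', latticeCount_apply hA,
    ← ENNReal.tsum_mul_right]
  refine ENNReal.tsum_le_tsum fun γ => ?_
  by_cases hγ : (γ : V) ∈ A
  · have : μ (γ +ᵥ latticeDomain Γ) = μ (latticeDomain Γ) := measure_vadd μ (γ : V) _
    rw [Set.indicator_of_mem hγ, ← this]
    simpa using measure_mono (μ := μ) (Set.inter_subset_right (s := A') (t := γ +ᵥ latticeDomain Γ))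
  · have : A' ∩ (γ +ᵥ latticeDomain Γ) = ∅ := by
      ext z
      simp only [Set.mem_inter_iff, Set.mem_empty_iff_false, iff_false, not_and]
      rintro hz ⟨d, hd, rfl⟩
      exact hγ (h _ d hd hz)
    simp [this]

end LatticeDomain

/-! ### The density of a model set -/

section Density

variable {m : ℕ}

theorem cube_eq_preimage (x : Rm m) (R : ℝ) :
    cube x R = (fun y : Rm m => WithLp.ofLp y) ⁻¹' Set.pi Set.univ (fun i => Set.Icc (x i) (x i + R)) := by
  ext y
  simp only [cube, Set.mem_ofPred_eq, Set.mem_preimage, Set.mem_pi, Set.mem_univ, true_imp_iff, Set.mem_Icc]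

theorem measurableSet_cube (x : Rm m) (R : ℝ) : MeasurableSet (cube x R) := by
  rw [cube_eq_preimage]
  exact (PiLp.volume_preserving_ofLp (Fin m)).measurable
    (MeasurableSet.univ_pi fun _ => measurableSet_Icc)

theorem volume_cube (x : Rm m) (R : ℝ) : volume (cube x R) = ENNReal.ofReal R ^ m := by
  rw [cube_eq_preimage, (PiLp.volume_preserving_ofLp (Fin m)).measure_preimage
    (MeasurableSet.univ_pi fun _ => measurableSet_Icc).nullMeasurableSet, volume_pi, Measure.pi_pi]
  simp

/-- The cube with side `R + 2C` that is concentric with `cube x R`. -/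
def cubeThicken (x : Rm m) (R C : ℝ) : Set (Rm m) :=
  cube (WithLp.toLp 2 fun i => x i - C) (R + 2 * C)

theorem add_mem_cubeThicken {x y d : Rm m} {R C : ℝ} (hy : y ∈ cube x R) (hd : ‖d‖ ≤ C) :
    y + d ∈ cubeThicken x R C := by
  intro i
  have h1 := hy i
  have h2 : |d i| ≤ C := (by simpa using PiLp.norm_apply_le d i : ‖d i‖ ≤ ‖d‖).trans hd
  rw [abs_le] at h2
  simp only [PiLp.add_apply]
  constructor <;> linarith

theorem mem_cube_of_add_mem {x y d : Rm m} {R C : ℝ} (hd : ‖d‖ ≤ C)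
    (h : y + d ∈ cubeThicken x R (-C)) : y ∈ cube x R := by
  intro i
  have h1 := h i
  have h2 : |d i| ≤ C := (by simpa using PiLp.norm_apply_le d i : ‖d i‖ ≤ ‖d‖).trans hd
  rw [abs_le] at h2
  simp only [PiLp.add_apply] at h1
  constructor <;> linarith

/-- The box `cubeThicken x R C × [a, b]`. -/
def box (x : Rm m) (R C a b : ℝ) : Set (Rm m × ℝ) := cubeThicken x R C ×ˢ Set.Icc a b

theorem measurableSet_box (x : Rm m) (R C a b : ℝ) : MeasurableSet (box x R C a b) :=
  (measurableSet_cube _ _).prod measurableSet_Icc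

theorem volume_box (x : Rm m) (R C a b : ℝ) :
    volume (box x R C a b) = ENNReal.ofReal (R + 2 * C) ^ m * ENNReal.ofReal (b - a) := by
  rw [box, Measure.volume_eq_prod, Measure.prod_prod, cubeThicken, volume_cube, Real.volume_Icc]

theorem cubeThicken_zero (x : Rm m) (R : ℝ) : cubeThicken x R 0 = cube x R := by
  simp [cubeThicken]

theorem add_mem_cubeThicken' {x y d : Rm m} {R C C' : ℝ} (hy : y ∈ cubeThicken x R C)
    (hd : ‖d‖ ≤ C') : y + d ∈ cubeThicken x R (C + C') := by
  have h := add_mem_cubeThicken hy hd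
  intro i
  have := h i
  simp only at this ⊢
  constructor <;> linarith

theorem mem_cubeThicken_of_add_mem {x y d : Rm m} {R C C' : ℝ}
    (hd : ‖d‖ ≤ C') (h : y + d ∈ cubeThicken x R (C - C')) : y ∈ cubeThicken x R C := by
  refine mem_cube_of_add_mem hd fun i => ?_
  have := h i
  simp only at this ⊢
  constructor <;> linarith

theorem exists_lattice_snd_mem_Ioo (Γ : Submodule ℤ (Rm m × ℝ))
    (hΓ : ProjectionsInjectiveDense Γ) {p q : ℝ} (h : p < q) :
    ∃ γ ∈ Γ, p < γ.2 ∧ γ.2 < q := by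
  obtain ⟨_, ⟨γ, hγ, rfl⟩, h1, h2⟩ := hΓ.dense_snd.exists_between h
  exact ⟨γ, hγ, h1, h2⟩

variable (Γ : Submodule ℤ (Rm m × ℝ)) [DiscreteTopology Γ] [IsZLattice ℝ Γ]

instance : (volume : Measure (Rm m × ℝ)).IsAddHaarMeasure := by
  rw [Measure.volume_eq_prod]; infer_instance

theorem exists_latticeDomain_bound :
    ∃ c : ℝ, 0 ≤ c ∧ ∀ d ∈ latticeDomain Γ, ‖d.1‖ ≤ c ∧ |d.2| ≤ c := by
  obtain ⟨c, hc⟩ := (isBounded_latticeDomain Γ).exists_norm_le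
  refine ⟨max c 0, le_max_right _ _, fun d hd => ?_⟩
  have h := hc d hd
  exact ⟨(norm_fst_le d).trans (h.trans (le_max_left _ _)),
    (norm_snd_le d).trans (h.trans (le_max_left _ _))⟩

/-- Packing bound for lattice points over an interval. -/
theorem latticeCount_box_upper (hΓ : ProjectionsInjectiveDense Γ) {a b : ℝ} {c : ℝ} (hc0 : 0 ≤ c)
    (hc : ∀ d ∈ latticeDomain Γ, ‖d.1‖ ≤ c ∧ |d.2| ≤ c) (K : ℕ) {δ : ℝ} (hδ : 0 < δ) :
    ∃ C : ℝ, 0 ≤ C ∧ ∀ (x : Rm m) (R : ℝ), (K : ℝ≥0∞) * latticeCount Γ (box x R 0 a b)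
        * volume (latticeDomain Γ)
      ≤ ENNReal.ofReal (R + 2 * C) ^ m * ENNReal.ofReal (K * (b - a + δ) + 2 * c) := by
  -- A single slab would lose a fixed error `2c` at the ends of the window. Instead `K` copies are
  -- stacked: with step `b - a + δ`, the slab shifted by `γ j` lies strictly between the heights `a
  -- + j (b - a + δ)` and `a + (j + 1) (b - a + δ)`. The copies are disjoint, and the error is paid
  -- once for all of them.
  choose γ hγ hγ1 hγ2 using fun j : ℕ => exists_lattice_snd_mem_Ioo Γ hΓ
    (p := j * (b - a + δ)) (q := j * (b - a + δ) + δ) (by linarith)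
  set C₀ := ∑ j ∈ Finset.range K, ‖(γ j).1‖
  have hC₀ : ∀ j ∈ Finset.range K, ‖(γ j).1‖ ≤ C₀ := fun j hj =>
    Finset.single_le_sum (f := fun j => ‖(γ j).1‖) (fun _ _ => norm_nonneg _) hj
  have hC₀0 : 0 ≤ C₀ := Finset.sum_nonneg fun _ _ => norm_nonneg _
  refine ⟨C₀ + c, by positivity, fun x R => ?_⟩
  rcases le_or_gt a b with hab | hab
  swap
  · have : box x R 0 a b = ∅ := by simp [box, Set.Icc_eq_empty (not_le.2 hab)]
    simp [this]
  have h1 : (K : ℝ≥0∞) * latticeCount Γ (box x R 0 a b)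
      ≤ ∑ j ∈ Finset.range K, latticeCount Γ (box x R C₀ (a + (γ j).2) (b + (γ j).2)) := by
    rw [← nsmul_eq_mul, ← Finset.card_range K, ← Finset.sum_const, Finset.card_range]
    refine Finset.sum_le_sum fun j hj => latticeCount_le_of_translate (measurableSet_box _ _ _ _ _)
      (measurableSet_box _ _ _ _ _) (hγ j) fun p hp => ⟨?_, ?_⟩
    · have := add_mem_cubeThicken' hp.1 (hC₀ j hj)
      rwa [zero_add] at this
    · exact ⟨add_le_add_left hp.2.1 _, add_le_add_left hp.2.2 _⟩
  have h2 : ∑ j ∈ Finset.range K, latticeCount Γ (box x R C₀ (a + (γ j).2) (b + (γ j).2))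
      ≤ latticeCount Γ (box x R C₀ a (a + K * (b - a + δ))) := by
    rw [← measure_biUnion_finset ?_ fun j _ => measurableSet_box _ _ _ _ _]
    · refine measure_mono (Set.iUnion₂_subset fun j hj => Set.prod_mono le_rfl ?_)
      refine Set.Icc_subset_Icc ?_ ?_
      · have : (0 : ℝ) ≤ j * (b - a + δ) := by positivity [sub_nonneg.2 hab]
        linarith [hγ1 j]
      · have : ((j : ℝ) + 1) ≤ K := by exact_mod_cast Finset.mem_range.1 hj
        nlinarith [hγ2 j]
    · intro i _ j _ hij
      wlog hlt : i < j generalizing i j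
      · exact (this (by assumption) (by assumption) hij.symm
          (lt_of_le_of_ne (not_lt.1 hlt) hij.symm)).symm
      refine Set.disjoint_left.2 fun z hz hz' => ?_
      have h3 := hz.2.2
      have h4 := hz'.2.1
      have : ((i : ℝ) + 1) ≤ j := by exact_mod_cast hlt
      nlinarith [hγ2 i, hγ1 j]
  have h3 : latticeCount Γ (box x R C₀ a (a + K * (b - a + δ))) * volume (latticeDomain Γ)
      ≤ volume (box x R (C₀ + c) (a - c) (a + K * (b - a + δ) + c)) := by
    refine latticeCount_mul_le (measurableSet_box _ _ _ _ _) _ fun p hp d hd => ⟨?_, ?_⟩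
    · exact add_mem_cubeThicken' hp.1 (hc d hd).1
    · have := abs_le.1 (hc d hd).2
      have hp1 := hp.2.1
      have hp2 := hp.2.2
      exact ⟨by simp only [Prod.snd_add]; linarith, by simp only [Prod.snd_add]; linarith⟩
  rw [volume_box] at h3
  refine (mul_le_mul_left (h1.trans h2) _).trans (h3.trans (le_of_eq ?_))
  congr 2
  ring

/-- Covering bound for lattice points over an interval. -/
theorem latticeCount_box_lower (hΓ : ProjectionsInjectiveDense Γ) {a b : ℝ} {c : ℝ} (hc0 : 0 ≤ c)
    (hc : ∀ d ∈ latticeDomain Γ, ‖d.1‖ ≤ c ∧ |d.2| ≤ c) (K : ℕ) {δ : ℝ} (hδ : 0 < δ)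
    (hδ' : δ < b - a) :
    ∃ C : ℝ, 0 ≤ C ∧ ∀ (x : Rm m) (R : ℝ),
      ENNReal.ofReal (R - 2 * C) ^ m * ENNReal.ofReal (K * (b - a - δ) - 2 * c)
      ≤ ((K + 1 : ℕ) : ℝ≥0∞) * latticeCount Γ (box x R 0 a b) * volume (latticeDomain Γ) := by
  -- With step `b - a - δ`, the slab shifted by `γ j` covers all heights from `a + j (b - a - δ)` to
  -- `a + (j + 1) (b - a - δ)`, so consecutive slabs leave no gap. The extra index `j = K` catches
  -- the top endpoint, where the floor below equals `K`.
  choose γ hγ hγ1 hγ2 using fun j : ℕ => exists_lattice_snd_mem_Ioo Γ hΓ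
    (p := j * (b - a - δ) - δ) (q := j * (b - a - δ)) (by linarith)
  set C₀ := ∑ j ∈ Finset.range (K + 1), ‖(γ j).1‖
  have hC₀ : ∀ j ∈ Finset.range (K + 1), ‖(γ j).1‖ ≤ C₀ := fun j hj =>
    Finset.single_le_sum (f := fun j => ‖(γ j).1‖) (fun _ _ => norm_nonneg _) hj
  have hC₀0 : 0 ≤ C₀ := Finset.sum_nonneg fun _ _ => norm_nonneg _
  refine ⟨C₀ + c, by positivity, fun x R => ?_⟩
  have h1 : ∑ j ∈ Finset.range (K + 1), latticeCount Γ (box x R (-C₀) (a + (γ j).2) (b + (γ j).2))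
      ≤ ((K + 1 : ℕ) : ℝ≥0∞) * latticeCount Γ (box x R 0 a b) := by
    rw [← nsmul_eq_mul, ← Finset.card_range (K + 1), ← Finset.sum_const, Finset.card_range]
    refine Finset.sum_le_sum fun j hj => latticeCount_le_of_translate (measurableSet_box _ _ _ _ _)
      (measurableSet_box _ _ _ _ _) (Γ.neg_mem (hγ j)) fun p hp => ⟨?_, ?_⟩
    · have := add_mem_cubeThicken' (d := -(γ j).1) hp.1 ((norm_neg _).trans_le (hC₀ j hj))
      rwa [neg_add_cancel] at this
    · have hp1 := hp.2.1
      have hp2 := hp.2.2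
      exact ⟨by simp only [Prod.snd_add, Prod.snd_neg]; linarith,
        by simp only [Prod.snd_add, Prod.snd_neg]; linarith⟩
  have h2 : latticeCount Γ (box x R (-C₀) a (a + K * (b - a - δ)))
      ≤ ∑ j ∈ Finset.range (K + 1), latticeCount Γ (box x R (-C₀) (a + (γ j).2) (b + (γ j).2)) := by
    refine (measure_mono ?_).trans (measure_biUnion_finset_le _ _)
    intro z hz
    have hs : 0 < b - a - δ := by linarith
    set j := ⌊(z.2 - a) / (b - a - δ)⌋₊
    have hz1 : 0 ≤ (z.2 - a) / (b - a - δ) := div_nonneg (sub_nonneg.2 hz.2.1) hs.le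
    have hj1 := Nat.floor_le hz1
    have hj2 := Nat.lt_floor_add_one ((z.2 - a) / (b - a - δ))
    rw [le_div_iff₀ hs] at hj1
    rw [div_lt_iff₀ hs] at hj2
    have hjK : j ≤ K := by
      refine Nat.floor_le_of_le ?_
      rw [div_le_iff₀ hs]
      linarith [hz.2.2]
    refine Set.mem_iUnion₂.2 ⟨j, Finset.mem_range.2 (Nat.lt_succ_of_le hjK), hz.1, ?_, ?_⟩
    · linarith [hγ2 j]
    · linarith [hγ1 j]
  have h3 : volume (box x R (-C₀ - c) (a + c) (a + K * (b - a - δ) - c))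
      ≤ latticeCount Γ (box x R (-C₀) a (a + K * (b - a - δ))) * volume (latticeDomain Γ) := by
    refine le_latticeCount_mul (measurableSet_box _ _ _ _ _) _ fun p d hd hp => ⟨?_, ?_⟩
    · exact mem_cubeThicken_of_add_mem (hc d hd).1 hp.1
    · have := abs_le.1 (hc d hd).2
      have hp1 := hp.2.1
      have hp2 := hp.2.2
      simp only [Prod.snd_add] at hp1 hp2
      exact ⟨by linarith, by linarith⟩
  rw [volume_box] at h3
  refine (le_of_eq ?_).trans (h3.trans (mul_le_mul_left (h2.trans h1) _))
  congr 2
  · ring_nf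
  · ring_nf

theorem ncard_modelSet_inter_cube (hΓ : ProjectionsInjectiveDense Γ) (a b : ℝ) (x : Rm m) (R : ℝ) :
    ((modelSet Γ (Set.Icc a b) ∩ cube x R).ncard : ℝ)
      = (latticeCount Γ (box x R 0 a b)).toReal := by
  have e : modelSet Γ (Set.Icc a b) ∩ cube x R
      = (fun γ : Γ => (γ : Rm m × ℝ).1) '' {γ : Γ | (γ : Rm m × ℝ) ∈ box x R 0 a b} := by
    ext z
    simp only [modelSet, box, cubeThicken_zero, Set.mem_inter_iff, Set.mem_image, Set.mem_ofPred_eq,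
      Set.mem_prod]
    constructor
    · rintro ⟨⟨γ, ⟨hγ, h1⟩, rfl⟩, h2⟩
      exact ⟨⟨γ, hγ⟩, ⟨h2, h1⟩, rfl⟩
    · rintro ⟨γ, ⟨h2, h1⟩, rfl⟩
      exact ⟨⟨γ, ⟨γ.2, h1⟩, rfl⟩, h2⟩
  have hinj : Set.InjOn (fun γ : Γ => (γ : Rm m × ℝ).1) {γ : Γ | (γ : Rm m × ℝ) ∈ box x R 0 a b} :=
    fun γ _ γ' _ h => Subtype.ext (hΓ.injOn_fst γ.2 γ'.2 h)
  rw [e, hinj.ncard_image, latticeCount_apply (measurableSet_box _ _ _ _ _)]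
  have h1 : ∑' γ : Γ, (box x R 0 a b).indicator (1 : Rm m × ℝ → ℝ≥0∞) (γ : Rm m × ℝ)
      = ({γ : Γ | (γ : Rm m × ℝ) ∈ box x R 0 a b}).encard := by
    rw [← ENNReal.tsum_set_one, tsum_subtype {γ : Γ | (γ : Rm m × ℝ) ∈ box x R 0 a b} (fun _ => (1 : ℝ≥0∞))]
    refine tsum_congr fun γ => ?_
    by_cases h : (γ : Rm m × ℝ) ∈ box x R 0 a b <;> simp [h]
  rw [h1, Set.ncard_def]
  cases ({γ : Γ | (γ : Rm m × ℝ) ∈ box x R 0 a b}).encard using ENat.recTopCoe <;> simp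

theorem tendsto_pow_shift_div (m : ℕ) (C : ℝ) :
    Tendsto (fun R : ℝ => (R + C) ^ m / R ^ m) atTop (𝓝 1) := by
  have h : Tendsto (fun R : ℝ => (1 + C * R⁻¹) ^ m) atTop (𝓝 ((1 + C * 0) ^ m)) :=
    ((tendsto_inv_atTop_zero.const_mul C).const_add 1).pow m
  simp only [mul_zero, add_zero, one_pow] at h
  refine h.congr' ?_
  filter_upwards [eventually_gt_atTop 0] with R hR
  rw [← div_pow]
  congr 1
  field_simp

/-- The density of a model set with window `[a, b]` is the length of the window divided by the
covolume of the lattice. -/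
theorem hasDensity_modelSet (hΓ : ProjectionsInjectiveDense Γ) {a b : ℝ} (hab : a < b) :
    HasDensity (modelSet Γ (Set.Icc a b)) ((b - a) / volume.real (latticeDomain Γ)) := by
  obtain ⟨c, hc0, hc⟩ := exists_latticeDomain_bound Γ
  intro x
  simp_rw [ncard_modelSet_inter_cube Γ hΓ]
  set v := volume.real (latticeDomain Γ) with hv
  have hv0 : 0 < v := ENNReal.toReal_pos (measure_latticeDomain_ne_zero Γ _)
    (measure_latticeDomain_ne_top Γ _)
  set n : ℝ → ℝ := fun R => (latticeCount Γ (box x R 0 a b)).toReal with hn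
  have hup : ∀ (K : ℕ) (δ : ℝ), 0 < δ → ∃ C : ℝ, 0 ≤ C ∧ ∀ R : ℝ, 0 < R →
      K * n R * v ≤ (R + 2 * C) ^ m * (K * (b - a + δ) + 2 * c) := by
    intro K δ hδ
    obtain ⟨C, hC, h⟩ := latticeCount_box_upper Γ hΓ (a := a) (b := b) hc0 hc K hδ
    refine ⟨C, hC, fun R hR => ?_⟩
    have h' := ENNReal.toReal_mono (by finiteness) (h x R)
    have e1 : 0 ≤ K * (b - a + δ) + 2 * c := by
      have : 0 ≤ b - a + δ := by linarith
      positivity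
    rwa [ENNReal.toReal_mul, ENNReal.toReal_mul, ENNReal.toReal_mul, ENNReal.toReal_pow,
      ENNReal.toReal_ofReal (by positivity), ENNReal.toReal_ofReal e1, ENNReal.toReal_natCast] at h'
  have hfin : ∀ R, latticeCount Γ (box x R 0 a b) ≠ ∞ := by
    intro R htop
    obtain ⟨C, hC, h⟩ := latticeCount_box_upper Γ hΓ (a := a) (b := b) hc0 hc 1 one_pos
    have := h x R
    rw [htop, Nat.cast_one, one_mul, ENNReal.top_mul (measure_latticeDomain_ne_zero Γ _), top_le_iff] at this
    exact absurd this (by finiteness)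
  have hlo : ∀ (K : ℕ) (δ : ℝ), 0 < δ → δ < b - a → ∃ C : ℝ, 0 ≤ C ∧ ∀ R : ℝ, 2 * C ≤ R →
      (R - 2 * C) ^ m * (K * (b - a - δ) - 2 * c) ≤ (K + 1) * n R * v := by
    intro K δ hδ hδ'
    obtain ⟨C, hC, h⟩ := latticeCount_box_lower Γ hΓ (a := a) (b := b) hc0 hc K hδ hδ'
    refine ⟨C, hC, fun R hR => ?_⟩
    have h' := ENNReal.toReal_mono (ENNReal.mul_ne_top (ENNReal.mul_ne_top (by finiteness) (hfin R))
      (measure_latticeDomain_ne_top Γ _)) (h x R)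
    rw [ENNReal.toReal_mul, ENNReal.toReal_mul, ENNReal.toReal_mul, ENNReal.toReal_pow,
      ENNReal.toReal_ofReal (by linarith), ENNReal.toReal_natCast, ENNReal.toReal_ofReal'] at h'
    push_cast at h'
    -- For small `K` the height may be negative; `ofReal` has truncated it to `0`, which only
    -- enlarges the product.
    refine le_trans ?_ h'
    exact mul_le_mul_of_nonneg_left (le_max_left _ _) (pow_nonneg (by linarith) _)
  have hK : ∀ p q : ℝ, Tendsto (fun K : ℕ => (K * p + q) / ((K + 1) * v)) atTop (𝓝 (p / v)) := by
    intro p q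
    have h1 : Tendsto (fun K : ℕ => 1 / ((K : ℝ) + 1)) atTop (𝓝 0) := tendsto_one_div_add_atTop_nhds_zero_nat
    have h2 : Tendsto (fun K : ℕ => p / v + (q - p) / v * (1 / ((K : ℝ) + 1))) atTop
        (𝓝 (p / v + (q - p) / v * 0)) := (h1.const_mul _).const_add _
    rw [mul_zero, add_zero] at h2
    refine h2.congr fun K => ?_
    have : (K : ℝ) + 1 ≠ 0 := by positivity
    field_simp
    ring
  -- In both halves `δ` is fixed first, then `K`, and only then `R` grows: the thickening `C`
  -- depends on `δ` and `K`, but not on `R`.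
  rw [tendsto_order]
  constructor
  · intro u hu
    rw [lt_div_iff₀ hv0] at hu
    set δ := min ((b - a - u * v) / 2) ((b - a) / 2)
    have hδ : 0 < δ := lt_min (by linarith) (by linarith)
    have hδ1 : δ ≤ (b - a - u * v) / 2 := min_le_left _ _
    have hδ2 : δ ≤ (b - a) / 2 := min_le_right _ _
    have hu' : u < (b - a - δ) / v := by rw [lt_div_iff₀ hv0]; linarith
    obtain ⟨K, hK'⟩ := ((hK (b - a - δ) (-(2 * c))).eventually (lt_mem_nhds hu')).exists
    obtain ⟨C, hC, h⟩ := hlo K δ hδ (by linarith)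
    have hlim := (tendsto_pow_shift_div m (-(2 * C))).mul_const
      ((K * (b - a - δ) + -(2 * c)) / ((K + 1) * v))
    rw [one_mul] at hlim
    filter_upwards [hlim.eventually (lt_mem_nhds hK'), eventually_gt_atTop 0,
      eventually_ge_atTop (2 * C)] with R h1 h2 h3
    refine h1.trans_le ?_
    have h4 := h R h3
    have hRm : 0 < R ^ m := pow_pos h2 m
    rw [div_mul_div_comm, div_le_div_iff₀ (by positivity) hRm]
    calc _ = ((R - 2 * C) ^ m * (K * (b - a - δ) - 2 * c)) * R ^ m := by ring
      _ ≤ ((K + 1) * n R * v) * R ^ m := by gcongr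
      _ = _ := by ring
  · intro u hu
    rw [gt_iff_lt, div_lt_iff₀ hv0] at hu
    set δ := (u * v - (b - a)) / 2
    have hδ : 0 < δ := by simp only [δ]; linarith
    have hu' : (b - a + δ) / v < u := by rw [div_lt_iff₀ hv0]; simp only [δ]; linarith
    -- The packing bound is applied with `K + 1` copies, to match the denominator in `hK`; hence the
    -- additional summand `b - a + δ`.
    obtain ⟨K, hK'⟩ := ((hK (b - a + δ) (b - a + δ + 2 * c)).eventually (gt_mem_nhds hu')).exists
    obtain ⟨C, hC, h⟩ := hup (K + 1) δ hδ
    have hlim := (tendsto_pow_shift_div m (2 * C)).mul_const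
      ((K * (b - a + δ) + (b - a + δ + 2 * c)) / ((K + 1) * v))
    rw [one_mul] at hlim
    filter_upwards [hlim.eventually (gt_mem_nhds hK'), eventually_gt_atTop 0] with R h1 h2
    refine lt_of_le_of_lt ?_ h1
    have h4 := h R h2
    push_cast at h4
    have hRm : 0 < R ^ m := pow_pos h2 m
    rw [div_mul_div_comm, div_le_div_iff₀ hRm (by positivity)]
    calc _ = ((K + 1) * n R * v) * R ^ m := by ring
      _ ≤ ((R + 2 * C) ^ m * ((K + 1) * (b - a + δ) + 2 * c)) * R ^ m := by gcongr
      _ = _ := by ring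

theorem density_modelSet (hΓ : ProjectionsInjectiveDense Γ) {a b : ℝ} (hab : a < b) :
    density (modelSet Γ (Set.Icc a b)) = (b - a) / volume.real (latticeDomain Γ) :=
  (hasDensity_modelSet Γ hΓ hab 0).limUnder_eq

end Density

/-! ### Interchanging sums and integrals -/

section Tsum

variable {α ι : Type*} [MeasurableSpace α] {μ : Measure α} [Countable ι] {f : ι → α → ℂ}

theorem ae_summable_of_tsum_lintegral_ne_top (hf : ∀ i, AEStronglyMeasurable (f i) μ)
    (hf' : ∑' i, ∫⁻ a, ‖f i a‖ₑ ∂μ ≠ ∞) : ∀ᵐ a ∂μ, Summable fun i => ‖f i a‖ := by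
  rw [← lintegral_tsum fun i => (hf i).enorm] at hf'
  filter_upwards [ae_lt_top' (AEMeasurable.tsum fun i => (hf i).enorm) hf'] with a ha
  exact tsum_enorm_ne_top_iff_summable_norm.1 ha.ne

theorem aestronglyMeasurable_tsum (hf : ∀ i, AEStronglyMeasurable (f i) μ)
    (hs : ∀ᵐ a ∂μ, Summable fun i => f i a) :
    AEStronglyMeasurable (fun a => ∑' i, f i a) μ := by
  refine aestronglyMeasurable_of_tendsto_ae (u := (atTop : Filter (Finset ι)))
    (f := fun s a => ∑ i ∈ s, f i a) (fun s => ?_) ?_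
  · exact Finset.aestronglyMeasurable_fun_sum s fun i _ => hf i
  · filter_upwards [hs] with a ha using ha.hasSum

theorem integrable_tsum (hf : ∀ i, AEStronglyMeasurable (f i) μ)
    (hf' : ∑' i, ∫⁻ a, ‖f i a‖ₑ ∂μ ≠ ∞) : Integrable (fun a => ∑' i, f i a) μ := by
  refine ⟨aestronglyMeasurable_tsum hf ?_, ?_⟩
  · filter_upwards [ae_summable_of_tsum_lintegral_ne_top hf hf'] with a ha using ha.of_norm
  · refine lt_of_le_of_lt (lintegral_mono fun a => enorm_tsum_le_tsum_enorm) ?_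
    rw [lintegral_tsum fun i => (hf i).enorm]
    exact hf'.lt_top

end Tsum

/-! ### Periodization and Fourier uniqueness on the torus -/

section Torus

variable {V : Type*} [NormedAddCommGroup V] [NormedSpace ℝ V] [FiniteDimensional ℝ V]
  [MeasurableSpace V] [BorelSpace V] {μ : Measure V} [μ.IsAddHaarMeasure]
  {Γ : Submodule ℤ V} [DiscreteTopology Γ] [IsZLattice ℝ Γ]

/-- The linear functional `l` takes integer values on `Γ`. -/
def IsIntegral (Γ : Submodule ℤ V) (l : V →L[ℝ] ℝ) : Prop := ∀ γ ∈ Γ, ∃ k : ℤ, l γ = k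

/-- The character `z ↦ e^{-2πi l(z)}`. -/
noncomputable def linChar (l : V →L[ℝ] ℝ) (z : V) : ℂ :=
  Complex.exp ((-2 * Real.pi * l z : ℝ) * Complex.I)

theorem continuous_linChar (l : V →L[ℝ] ℝ) : Continuous (linChar l) := by
  unfold linChar; fun_prop

theorem norm_linChar (l : V →L[ℝ] ℝ) (z : V) : ‖linChar l z‖ = 1 :=
  Complex.norm_exp_ofReal_mul_I _

theorem linChar_add (l : V →L[ℝ] ℝ) (z w : V) : linChar l (z + w) = linChar l z * linChar l w := by
  rw [linChar, linChar, linChar, ← Complex.exp_add]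
  congr 1
  push_cast [map_add]
  ring

theorem linChar_lattice {l : V →L[ℝ] ℝ} (hl : IsIntegral Γ l) {γ : V} (hγ : γ ∈ Γ) :
    linChar l γ = 1 := by
  obtain ⟨k, hk⟩ := hl γ hγ
  rw [linChar, hk, Complex.exp_eq_one_iff]
  exact ⟨-k, by push_cast; ring⟩

theorem linChar_vadd {l : V →L[ℝ] ℝ} (hl : IsIntegral Γ l) (γ : Γ) (z : V) :
    linChar l (γ +ᵥ z) = linChar l z := by
  change linChar l ((γ : V) + z) = _
  rw [linChar_add, linChar_lattice hl γ.2, one_mul]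

/-- The integral of a periodic function is the same over every fundamental domain. Translating the
domain by a vector `a` with `l a = 1/2` changes the sign of the character, so the integral equals
its own negative. -/
theorem setIntegral_linChar_latticeDomain {l : V →L[ℝ] ℝ} (hl : IsIntegral Γ l) (hl0 : l ≠ 0) :
    ∫ z in latticeDomain Γ, linChar l z ∂μ = 0 := by
  obtain ⟨a, ha⟩ : ∃ a, l a = 1 / 2 := by
    obtain ⟨v, hv⟩ := DFunLike.ne_iff.1 hl0
    refine ⟨(1 / (2 * l v)) • v, ?_⟩
    have : l v ≠ 0 := hv
    simp only [map_smul, smul_eq_mul]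
    field_simp
  have hchar : linChar l a = -1 := by
    rw [linChar, ha]
    have : ((-2 * Real.pi * (1 / 2) : ℝ) : ℂ) * Complex.I = -(Real.pi * Complex.I) := by
      push_cast; ring
    rw [this, Complex.exp_neg, Complex.exp_pi_mul_I]
    norm_num
  have hD := isAddFundamentalDomain_latticeDomain Γ μ
  have h1 := hD.setIntegral_eq (hD.vadd_of_comm a) (f := linChar l) (linChar_vadd hl)
  have h2 : ∫ z in a +ᵥ latticeDomain Γ, linChar l z ∂μ
      = ∫ z in latticeDomain Γ, linChar l (a + z) ∂μ :=
    (measurePreserving_add_left μ a).setIntegral_image_emb (measurableEmbedding_addLeft a) _ _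
  rw [h2] at h1
  simp_rw [linChar_add, hchar, neg_one_mul, integral_neg] at h1
  exact self_eq_neg.1 h1

theorem lattice_vadd_def (γ : Γ) (z : V) : γ +ᵥ z = (γ : V) + z := rfl

theorem quasiMeasurePreserving_lattice_add (γ : V) :
    Measure.QuasiMeasurePreserving (fun z => γ + z) μ μ :=
  (measurePreserving_add_left μ γ).quasiMeasurePreserving

theorem lintegral_eq_tsum_latticeDomain (f : V → ℝ≥0∞) :
    ∫⁻ z, f z ∂μ = ∑' γ : Γ, ∫⁻ z in latticeDomain Γ, f (γ + z) ∂μ :=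
  (isAddFundamentalDomain_latticeDomain Γ μ).lintegral_eq_tsum'' f

theorem integral_eq_tsum_latticeDomain {f : V → ℂ} (hf : Integrable f μ) :
    ∫ z, f z ∂μ = ∑' γ : Γ, ∫ z in latticeDomain Γ, f (γ + z) ∂μ :=
  (isAddFundamentalDomain_latticeDomain Γ μ).integral_eq_tsum'' f hf

/-- Unfolding over the tiles: an integral character is constant on cosets of `Γ` and factors out of
the sum. -/
theorem integral_mul_linChar_eq {H : V → ℂ} (hH : Integrable H μ) {l : V →L[ℝ] ℝ}
    (hl : IsIntegral Γ l) :
    ∫ z, H z * linChar l z ∂μ = ∫ z in latticeDomain Γ, (∑' γ : Γ, H (γ + z)) * linChar l z ∂μ := by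
  have hI : Integrable (fun z => H z * linChar l z) μ :=
    hH.mul_bdd (c := 1) (continuous_linChar l).aestronglyMeasurable
      (Eventually.of_forall fun z => (norm_linChar l z).le)
  rw [integral_eq_tsum_latticeDomain (Γ := Γ) hI, ← integral_tsum]
  · refine integral_congr_ae (Eventually.of_forall fun z => ?_)
    simp only
    rw [← tsum_mul_right]
    refine tsum_congr fun γ => ?_
    rw [← lattice_vadd_def γ z, linChar_vadd hl]
  · intro γ
    exact (hI.1.comp_quasiMeasurePreserving (quasiMeasurePreserving_lattice_add (γ : V))).restrict
  · rw [← lintegral_eq_tsum_latticeDomain (fun z => ‖H z * linChar l z‖ₑ)]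
    exact hI.2.ne

/-- The packing bound is uniform in the centre, since Haar measure does not see where a ball lies.
-/
theorem exists_tsum_indicator_closedBall_le (Γ : Submodule ℤ V) [DiscreteTopology Γ]
    [IsZLattice ℝ Γ] (R : ℝ) :
    ∃ M : ℝ≥0∞, M ≠ ∞ ∧ ∀ z : V,
      ∑' γ : Γ, (Metric.closedBall (0 : V) R).indicator (1 : V → ℝ≥0∞) (γ + z) ≤ M := by
  let ν : Measure V := Measure.addHaar
  obtain ⟨c, hc⟩ := (isBounded_latticeDomain Γ).exists_norm_le
  have hD := measure_latticeDomain_ne_zero Γ ν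
  refine ⟨ν (Metric.closedBall 0 (R + c)) / ν (latticeDomain Γ),
    ENNReal.div_ne_top (measure_closedBall_lt_top.ne) hD, fun z => ?_⟩
  rw [ENNReal.le_div_iff_mul_le (Or.inl hD) (Or.inl (measure_latticeDomain_ne_top Γ ν))]
  have h := latticeCount_mul_le (Γ := Γ) (A := Metric.closedBall (-z) R)
    (A' := Metric.closedBall (-z) (R + c)) Metric.isClosed_closedBall.measurableSet ν
    (fun p hp d hd => by
      rw [Metric.mem_closedBall, dist_eq_norm] at hp ⊢
      calc ‖p + d - -z‖ = ‖(p - -z) + d‖ := by congr 1; abel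
        _ ≤ _ := (norm_add_le _ _).trans (add_le_add hp (hc d hd)))
  rw [latticeCount_apply Metric.isClosed_closedBall.measurableSet,
    ← Measure.addHaar_closedBall_center ν (-z), ] at *
  refine le_trans (le_of_eq ?_) h
  congr 1
  refine tsum_congr fun γ => ?_
  simp only [Set.indicator, Metric.mem_closedBall, dist_eq_norm, sub_neg_eq_add, sub_zero,
    Pi.one_apply]

theorem finite_lattice_inter_of_isBounded {A : Set V} (hA : Bornology.IsBounded A) :
    {γ : Γ | (γ : V) ∈ A}.Finite := by
  have h : (A ∩ (Γ : Set V)).Finite := by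
    refine Metric.finite_isBounded_inter_isClosed DiscreteTopology.isDiscrete hA ?_
    exact AddSubgroup.isClosed_of_discrete (H := Γ.toAddSubgroup)
  refine (h.preimage (f := fun γ : Γ => (γ : V)) Subtype.val_injective.injOn).subset ?_
  intro γ hγ
  exact ⟨hγ, γ.2⟩

/-- Near each point only finitely many translates of the compact support contribute. -/
theorem continuous_periodization {φ : V → ℂ} (hφ : Continuous φ) (hs : HasCompactSupport φ) :
    Continuous fun z => ∑' γ : Γ, φ (γ + z) := by
  obtain ⟨R, hR⟩ := hs.isCompact.isBounded.exists_norm_le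
  have hsupp : ∀ x, φ x ≠ 0 → ‖x‖ ≤ R := fun x hx => hR x (subset_tsupport φ hx)
  have hfin : ∀ z : V, (Function.support fun γ : Γ => φ (γ + z)).Finite := fun z => by
    refine (finite_lattice_inter_of_isBounded (Γ := Γ)
      (Metric.isBounded_closedBall (x := -z) (r := R))).subset fun γ hγ => ?_
    have := hsupp _ hγ
    simpa [dist_eq_norm] using this
  have e : (fun z => ∑' γ : Γ, φ (γ + z)) = fun z => ∑ᶠ γ : Γ, φ (γ + z) :=
    funext fun z => tsum_eq_finsum (hfin z)
  rw [e]
  refine continuous_finsum (fun γ => by fun_prop) fun z => ?_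
  refine ⟨Metric.ball z 1, Metric.ball_mem_nhds z one_pos, ?_⟩
  refine (finite_lattice_inter_of_isBounded (Γ := Γ)
      (Metric.isBounded_closedBall (x := -z) (r := R + 1))).subset fun γ hγ => ?_
  obtain ⟨w, hw, hwz⟩ := hγ
  have h1 := hsupp _ hw
  rw [Metric.mem_ball, dist_eq_norm] at hwz
  have : ‖(γ : V) + z‖ ≤ R + 1 := by
    calc ‖(γ : V) + z‖ = ‖((γ : V) + w) - (w - z)‖ := by congr 1; abel
      _ ≤ _ := (norm_sub_le _ _).trans (add_le_add h1 hwz.le)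
  simpa [dist_eq_norm] using this

/-- The index set of a basis of the lattice. -/
abbrev latticeIndex (Γ : Submodule ℤ V) [DiscreteTopology Γ] [IsZLattice ℝ Γ] : Type _ :=
  Module.Free.ChooseBasisIndex ℤ Γ

/-- A basis of the ambient space that spans the lattice over the integers. -/
noncomputable def latticeBasis (Γ : Submodule ℤ V) [DiscreteTopology Γ] [IsZLattice ℝ Γ] :
    Module.Basis (latticeIndex Γ) ℝ V :=
  (Module.Free.chooseBasis ℤ Γ).ofZLatticeBasis ℝ

/-- The quotient map onto the torus `V / Γ`, in the coordinates of a basis of the lattice. -/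
noncomputable def torusMap (Γ : Submodule ℤ V) [DiscreteTopology Γ] [IsZLattice ℝ Γ] (z : V) :
    UnitAddTorus (latticeIndex Γ) :=
  fun i => (((latticeBasis Γ).repr z i : ℝ) : UnitAddCircle)

theorem isOpenQuotientMap_torusMap : IsOpenQuotientMap (torusMap Γ) := by
  have h1 : IsOpenQuotientMap (Pi.map fun (_ : latticeIndex Γ) (x : ℝ) => (x : UnitAddCircle)) :=
    IsOpenQuotientMap.piMap fun _ => QuotientAddGroup.isOpenQuotientMap_mk
  exact h1.comp ((latticeBasis Γ).equivFunL.toHomeomorph.isOpenQuotientMap)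

theorem exists_lattice_of_torusMap_eq {z w : V} (h : torusMap Γ z = torusMap Γ w) :
    ∃ γ : Γ, w = γ + z := by
  have hi : ∀ i, ∃ k : ℤ, (latticeBasis Γ).repr w i - (latticeBasis Γ).repr z i = k := fun i => by
    have := congrFun h i
    rw [torusMap, torusMap, eq_comm, ← sub_eq_zero, ← AddCircle.coe_sub,
      AddCircle.coe_eq_zero_iff] at this
    obtain ⟨k, hk⟩ := this
    exact ⟨k, by simpa using hk.symm⟩
  choose k hk using hi
  refine ⟨∑ i, k i • Module.Free.chooseBasis ℤ Γ i, ?_⟩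
  rw [← sub_eq_iff_eq_add]
  apply (latticeBasis Γ).repr.injective
  ext i
  rw [map_sub, Finsupp.sub_apply, hk, latticeBasis, Module.Basis.ofZLatticeBasis_repr_apply]
  simp [Finsupp.single_apply]

/-- Trigonometric monomials on the torus are characters of the ambient space. -/
theorem exists_mFourier_torusMap_eq_linChar (n : latticeIndex Γ → ℤ) :
    ∃ l : V →L[ℝ] ℝ, IsIntegral Γ l ∧ ∀ z, UnitAddTorus.mFourier n (torusMap Γ z) = linChar l z := by
  let l : V →L[ℝ] ℝ := LinearMap.toContinuousLinearMap
    (-∑ i, (n i : ℝ) • (latticeBasis Γ).coord i)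
  have hl : ∀ z, l z = -∑ i, (n i : ℝ) * (latticeBasis Γ).repr z i := fun z => by
    simp [l]
  refine ⟨l, fun γ hγ => ?_, fun z => ?_⟩
  · refine ⟨-∑ i, n i * (Module.Free.chooseBasis ℤ Γ).repr ⟨γ, hγ⟩ i, ?_⟩
    rw [hl]
    push_cast
    congr 1
    refine Finset.sum_congr rfl fun i _ => ?_
    congr 1
    exact (Module.Free.chooseBasis ℤ Γ).ofZLatticeBasis_repr_apply ℝ Γ ⟨γ, hγ⟩ i
  · rw [linChar, hl]
    simp only [UnitAddTorus.mFourier, ContinuousMap.coe_mk, torusMap, fourier_coe_apply]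
    rw [← Complex.exp_sum]
    congr 1
    push_cast
    rw [← Finset.sum_neg_distrib, Finset.mul_sum, Finset.sum_mul]
    refine Finset.sum_congr rfl fun i _ => ?_
    ring

/-- Integration against `H` is a bounded functional on the continuous functions of the torus, as `H`
is integrable. It vanishes on the trigonometric monomials, and these span a dense subspace. -/
theorem integral_mul_torus_eq_zero {H : V → ℂ} (hH : Integrable H μ)
    (h : ∀ l : V →L[ℝ] ℝ, IsIntegral Γ l → ∫ z, H z * linChar l z ∂μ = 0)
    (p : C(UnitAddTorus (latticeIndex Γ), ℂ)) : ∫ z, H z * p (torusMap Γ z) ∂μ = 0 := by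
  have hint : ∀ p : C(UnitAddTorus (latticeIndex Γ), ℂ),
      Integrable (fun z => H z * p (torusMap Γ z)) μ := fun p =>
    hH.mul_bdd (c := ‖p‖) (p.continuous.comp
      isOpenQuotientMap_torusMap.continuous).aestronglyMeasurable
      (Eventually.of_forall fun z => p.norm_coe_le_norm _)
  let T₀ : C(UnitAddTorus (latticeIndex Γ), ℂ) →ₗ[ℂ] ℂ :=
    { toFun := fun p => ∫ z, H z * p (torusMap Γ z) ∂μ
      map_add' := fun p q => by
        simp only [ContinuousMap.add_apply, mul_add]
        exact integral_add (hint p) (hint q)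
      map_smul' := fun c p => by
        simp only [ContinuousMap.smul_apply, smul_eq_mul, RingHom.id_apply]
        rw [← integral_const_mul]
        congr 1; funext z; ring }
  let T := T₀.mkContinuous (∫ z, ‖H z‖ ∂μ) fun p => by
    change ‖∫ z, H z * p (torusMap Γ z) ∂μ‖ ≤ _
    rw [← integral_mul_const]
    refine norm_integral_le_of_norm_le (hH.norm.mul_const _) (Eventually.of_forall fun z => ?_)
    rw [norm_mul]
    gcongr
    exact p.norm_coe_le_norm _
  have hle : (Submodule.span ℂ (Set.range <| UnitAddTorus.mFourier
      (d := latticeIndex Γ))).topologicalClosure ≤ T.ker := by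
    refine Submodule.topologicalClosure_minimal _ (Submodule.span_le.2 ?_) T.isClosed_ker
    rintro _ ⟨n, rfl⟩
    obtain ⟨l, hl, he⟩ := exists_mFourier_torusMap_eq_linChar n
    change ∫ z, H z * UnitAddTorus.mFourier n (torusMap Γ z) ∂μ = 0
    simp_rw [he]
    exact h l hl
  rw [UnitAddTorus.span_mFourier_closure_eq_top] at hle
  exact hle (Submodule.mem_top (x := p))

/-- The torus map is a quotient map, and points with the same image differ by a lattice vector, so a
periodic function descends. -/
theorem exists_continuousMap_torus_eq {p : V → ℂ} (hp : Continuous p)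
    (hper : ∀ (γ : Γ) z, p (γ + z) = p z) :
    ∃ q : C(UnitAddTorus (latticeIndex Γ), ℂ), ∀ z, q (torusMap Γ z) = p z := by
  have hq := isOpenQuotientMap_torusMap (Γ := Γ)
  have he : ∀ z, p (Function.surjInv hq.surjective (torusMap Γ z)) = p z := fun z => by
    obtain ⟨γ, hγ⟩ := exists_lattice_of_torusMap_eq
      (Function.surjInv_eq hq.surjective (torusMap Γ z)).symm
    rw [hγ, hper]
  refine ⟨⟨fun t => p (Function.surjInv hq.surjective t), ?_⟩, he⟩
  rw [hq.isQuotientMap.continuous_iff]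
  exact hp.congr fun z => (he z).symm

/-- This justifies every interchange of the sum over `Γ` with a local integral. Invariance of the
measure moves the lattice shift from `H` to the ball, and a ball shifted along `Γ` covers each point
a bounded number of times. -/
theorem tsum_lintegral_indicator_lattice_ne_top {H : V → ℂ} (hH : Integrable H μ) (R : ℝ) :
    ∑' γ : Γ, ∫⁻ z, (Metric.closedBall (0 : V) R).indicator 1 z * ‖H (γ + z)‖ₑ ∂μ ≠ ∞ := by
  obtain ⟨M, hM, hMle⟩ := exists_tsum_indicator_closedBall_le Γ R
  have hmeas : Measurable ((Metric.closedBall (0 : V) R).indicator (1 : V → ℝ≥0∞)) :=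
    measurable_one.indicator Metric.isClosed_closedBall.measurableSet
  have e : ∑' γ : Γ, ∫⁻ z, (Metric.closedBall (0 : V) R).indicator 1 z * ‖H (γ + z)‖ₑ ∂μ
      = ∑' γ : Γ, ∫⁻ z, (Metric.closedBall (0 : V) R).indicator 1 (γ + z) * ‖H z‖ₑ ∂μ := by
    rw [← (Equiv.neg Γ).tsum_eq]
    refine tsum_congr fun γ => ?_
    rw [← lintegral_add_left_eq_self _ (γ : V)]
    simp
  have hm : ∀ γ : Γ, AEMeasurable
      (fun z => (Metric.closedBall (0 : V) R).indicator (1 : V → ℝ≥0∞) (γ + z) * ‖H z‖ₑ) μ := fun γ =>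
    (hmeas.comp (measurable_const_add (γ : V))).aemeasurable.mul hH.1.enorm
  rw [e, ← lintegral_tsum hm]
  simp_rw [ENNReal.tsum_mul_right]
  refine ne_top_of_le_ne_top ?_ (lintegral_mono fun z => mul_le_mul_left (hMle z) _)
  rw [lintegral_const_mul'' _ hH.1.enorm]
  exact ENNReal.mul_ne_top hM hH.2.ne

theorem aestronglyMeasurable_lattice_translate {H : V → ℂ} (hH : Integrable H μ) (γ : V) :
    AEStronglyMeasurable (fun z => H (γ + z)) μ :=
  hH.1.comp_quasiMeasurePreserving (quasiMeasurePreserving_lattice_add γ)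

theorem locallyIntegrable_periodization {H : V → ℂ} (hH : Integrable H μ) :
    LocallyIntegrable (fun z => ∑' γ : Γ, H (γ + z)) μ := by
  rw [locallyIntegrable_iff]
  intro K hK
  obtain ⟨R, hR⟩ := hK.isBounded.subset_closedBall (0 : V)
  refine IntegrableOn.mono_set ?_ hR
  refine integrable_tsum (fun γ => (aestronglyMeasurable_lattice_translate hH (γ : V)).restrict) ?_
  have h := tsum_lintegral_indicator_lattice_ne_top (Γ := Γ) hH R
  have e : ∀ γ : Γ, ∫⁻ z in Metric.closedBall (0 : V) R, ‖H (γ + z)‖ₑ ∂μ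
      = ∫⁻ z, (Metric.closedBall (0 : V) R).indicator 1 z * ‖H (γ + z)‖ₑ ∂μ := fun γ => by
    rw [← lintegral_indicator Metric.isClosed_closedBall.measurableSet]
    congr 1; funext z
    by_cases hz : z ∈ Metric.closedBall (0 : V) R <;> simp [Set.indicator, hz]
  simp_rw [e]
  exact h

/-- If all Fourier coefficients of the periodization of `H` vanish, then the periodization
vanishes almost everywhere. -/
theorem ae_periodization_eq_zero {H : V → ℂ} (hH : Integrable H μ)
    (h : ∀ l : V →L[ℝ] ℝ, IsIntegral Γ l → ∫ z, H z * linChar l z ∂μ = 0) :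
    ∀ᵐ z ∂μ, ∑' γ : Γ, H (γ + z) = 0 := by
  refine ae_eq_zero_of_integral_contDiff_smul_eq_zero (locallyIntegrable_periodization hH) ?_
  intro φ hφ hs
  set ψ : V → ℂ := fun z => (φ z : ℂ) with hψ
  have hψc : Continuous ψ := Complex.continuous_ofReal.comp hφ.continuous
  have hψs : HasCompactSupport ψ := hs.comp_left (g := fun t : ℝ => (t : ℂ)) (by simp)
  obtain ⟨R, hR⟩ := hψs.isCompact.isBounded.subset_closedBall (0 : V)
  obtain ⟨C, hC⟩ := hψs.exists_bound_of_continuous hψc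
  have hbound : ∀ z, ‖ψ z‖ₑ ≤ ENNReal.ofReal C * (Metric.closedBall (0 : V) R).indicator 1 z := by
    intro z
    by_cases hz : z ∈ Metric.closedBall (0 : V) R
    · rw [Set.indicator_of_mem hz, Pi.one_apply, mul_one, ← ofReal_norm]
      exact ENNReal.ofReal_le_ofReal (hC z)
    · have : ψ z = 0 := by
        by_contra h0
        exact hz (hR (subset_tsupport ψ h0))
      simp [this]
  have hmeas : ∀ γ : Γ, AEStronglyMeasurable (fun z => ψ z * H (γ + z)) μ := fun γ =>
    hψc.aestronglyMeasurable.mul (aestronglyMeasurable_lattice_translate hH (γ : V))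
  have hfin : ∑' γ : Γ, ∫⁻ z, ‖ψ z * H (γ + z)‖ₑ ∂μ ≠ ∞ := by
    refine ne_top_of_le_ne_top (ENNReal.mul_ne_top ENNReal.ofReal_ne_top
      (tsum_lintegral_indicator_lattice_ne_top (Γ := Γ) hH R) : ENNReal.ofReal C * _ ≠ ∞) ?_
    rw [← ENNReal.tsum_mul_left]
    refine ENNReal.tsum_le_tsum fun γ => ?_
    rw [← lintegral_const_mul' _ _ ENNReal.ofReal_ne_top]
    refine lintegral_mono fun z => ?_
    rw [enorm_mul, ← mul_assoc]
    exact mul_le_mul_left (hbound z) _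
  have hshift : ∀ γ : Γ, ∫ z, ψ z * H (γ + z) ∂μ = ∫ z, ψ (((-γ : Γ) : V) + z) * H z ∂μ := fun γ => by
    rw [← integral_add_left_eq_self (fun z => ψ (((-γ : Γ) : V) + z) * H z) (γ : V)]
    simp
  have hmeas' : ∀ γ : Γ, AEStronglyMeasurable (fun z => ψ (γ + z) * H z) μ := fun γ =>
    (hψc.comp (continuous_const.add continuous_id)).aestronglyMeasurable.mul hH.1
  have hfin' : ∑' γ : Γ, ∫⁻ z, ‖ψ (γ + z) * H z‖ₑ ∂μ ≠ ∞ := by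
    rw [← (Equiv.neg Γ).tsum_eq]
    convert hfin using 3 with γ
    rw [← lintegral_add_left_eq_self _ (γ : V)]
    simp
  -- The periodized test function lives on the torus. The computation below moves the periodization
  -- from `H` to the test function, after which the hypothesis on the coefficients applies.
  obtain ⟨q, hq⟩ := exists_continuousMap_torus_eq (Γ := Γ) (continuous_periodization (Γ := Γ) hψc hψs)
    (fun γ z => by
      rw [← (Equiv.addRight γ).tsum_eq fun γ' : Γ => ψ (γ' + z)]
      simp [add_assoc])
  calc ∫ z, φ z • ∑' γ : Γ, H (γ + z) ∂μ = ∫ z, ∑' γ : Γ, ψ z * H (γ + z) ∂μ := by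
        congr 1; funext z
        rw [tsum_mul_left, Complex.real_smul]
    _ = ∑' γ : Γ, ∫ z, ψ z * H (γ + z) ∂μ := integral_tsum hmeas hfin
    _ = ∑' γ : Γ, ∫ z, ψ (γ + z) * H z ∂μ := by
        rw [← (Equiv.neg Γ).tsum_eq]
        refine tsum_congr fun γ => ?_
        simp only [Equiv.neg_apply]
        rw [hshift, neg_neg]
    _ = ∫ z, ∑' γ : Γ, ψ (γ + z) * H z ∂μ := (integral_tsum hmeas' hfin').symm
    _ = ∫ z, H z * q (torusMap Γ z) ∂μ := by
        congr 1; funext z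
        rw [tsum_mul_right, hq, mul_comm]
    _ = 0 := integral_mul_torus_eq_zero hH h q

theorem tsum_indicator_latticeDomain (z : V) :
    ∑' γ : Γ, (latticeDomain Γ).indicator (1 : V → ℂ) (γ + z) = 1 := by
  obtain ⟨γ₀, h1, h2⟩ := existsUnique_vadd_mem_latticeDomain Γ z
  rw [tsum_eq_single γ₀ fun γ hγ => Set.indicator_of_notMem (fun hm => hγ (h2 γ hm)) _,
    Set.indicator_of_mem h1, Pi.one_apply]

theorem summable_indicator_latticeDomain (z : V) :
    Summable fun γ : Γ => (latticeDomain Γ).indicator (1 : V → ℂ) (γ + z) := by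
  by_contra h
  have := tsum_indicator_latticeDomain (Γ := Γ) z
  rw [tsum_eq_zero_of_not_summable h] at this
  exact zero_ne_one this

theorem ae_summable_periodization {H : V → ℂ} (hH : Integrable H μ) :
    ∀ᵐ z ∂μ, Summable fun γ : Γ => H (γ + z) := by
  have h : ∀ n : ℕ, ∀ᵐ z ∂μ, z ∈ Metric.closedBall (0 : V) n → Summable fun γ : Γ => ‖H (γ + z)‖ := by
    intro n
    rw [← ae_restrict_iff' Metric.isClosed_closedBall.measurableSet]
    refine ae_summable_of_tsum_lintegral_ne_top
      (fun γ => (aestronglyMeasurable_lattice_translate hH (γ : V)).restrict) ?_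
    have h := tsum_lintegral_indicator_lattice_ne_top (Γ := Γ) hH n
    have e : ∀ γ : Γ, ∫⁻ z in Metric.closedBall (0 : V) n, ‖H (γ + z)‖ₑ ∂μ
        = ∫⁻ z, (Metric.closedBall (0 : V) n).indicator 1 z * ‖H (γ + z)‖ₑ ∂μ := fun γ => by
      rw [← lintegral_indicator Metric.isClosed_closedBall.measurableSet]
      congr 1; funext z
      by_cases hz : z ∈ Metric.closedBall (0 : V) n <;> simp [Set.indicator, hz]
    simp_rw [e]
    exact h
  filter_upwards [ae_all_iff.2 h] with z hz
  obtain ⟨n, hn⟩ := exists_nat_ge ‖z‖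
  exact (hz n (by simpa using hn)).of_norm

/-- The periodization of `H` is almost everywhere equal to the constant `κ` if and only if its
Fourier coefficients are those of `κ`. -/
theorem ae_periodization_eq_const_iff {H : V → ℂ} (hH : Integrable H μ) (κ : ℂ) :
    (∀ᵐ z ∂μ, ∑' γ : Γ, H (γ + z) = κ) ↔
      ∫ z, H z ∂μ = κ * μ.real (latticeDomain Γ) ∧
      ∀ l : V →L[ℝ] ℝ, IsIntegral Γ l → l ≠ 0 → ∫ z, H z * linChar l z ∂μ = 0 := by
  have hchar0 : ∀ z : V, linChar (0 : V →L[ℝ] ℝ) z = 1 := fun z => by simp [linChar]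
  have hint0 : IsIntegral Γ (0 : V →L[ℝ] ℝ) := fun γ _ => ⟨0, by simp⟩
  constructor
  · intro h
    have key : ∀ l : V →L[ℝ] ℝ, IsIntegral Γ l → ∫ z, H z * linChar l z ∂μ
        = κ * ∫ z in latticeDomain Γ, linChar l z ∂μ := fun l hl => by
      rw [integral_mul_linChar_eq hH hl, ← integral_const_mul]
      refine integral_congr_ae (ae_restrict_of_ae ?_)
      filter_upwards [h] with z hz
      rw [hz]
    refine ⟨?_, fun l hl hl0 => by rw [key l hl, setIntegral_linChar_latticeDomain hl hl0, mul_zero]⟩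
    have := key 0 hint0
    simp_rw [hchar0, mul_one] at this
    rw [this]
    simp
  · rintro ⟨h0, h1⟩
    have hDm := measurableSet_latticeDomain Γ
    have hDi : Integrable ((latticeDomain Γ).indicator (1 : V → ℂ)) μ :=
      (integrable_indicator_iff hDm).2 (integrableOn_const (measure_latticeDomain_ne_top Γ μ))
    have hDl : ∀ l : V →L[ℝ] ℝ, ∫ z, (latticeDomain Γ).indicator (1 : V → ℂ) z * linChar l z ∂μ
        = ∫ z in latticeDomain Γ, linChar l z ∂μ := fun l => by
      rw [← integral_indicator hDm]
      congr 1; funext z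
      by_cases hz : z ∈ latticeDomain Γ <;> simp [hz]
    -- The indicator of a fundamental domain has periodization `1`, so subtracting `κ` times it
    -- reduces the claim to vanishing coefficients.
    have hH' : Integrable (fun z => H z - κ * (latticeDomain Γ).indicator (1 : V → ℂ) z) μ :=
      hH.sub (hDi.const_mul κ)
    have hb : ∀ (l : V →L[ℝ] ℝ) {f : V → ℂ}, Integrable f μ → Integrable (fun z => f z * linChar l z) μ :=
      fun l f hf => hf.mul_bdd (c := 1) (continuous_linChar l).aestronglyMeasurable
        (Eventually.of_forall fun z => (norm_linChar l z).le)
    have hz := ae_periodization_eq_zero (Γ := Γ) hH' fun l hl => by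
      simp_rw [sub_mul, mul_assoc]
      rw [integral_sub (hb l hH) ((hb l hDi).const_mul κ), integral_const_mul, hDl]
      rcases eq_or_ne l 0 with rfl | hl0
      · simp_rw [hchar0, mul_one, h0]
        simp
      · rw [h1 l hl hl0, setIntegral_linChar_latticeDomain hl hl0]
        simp
    filter_upwards [hz, ae_summable_periodization (Γ := Γ) hH] with z h1 h2
    rw [h2.tsum_sub ((summable_indicator_latticeDomain z).mul_left κ), tsum_mul_left,
      tsum_indicator_latticeDomain, mul_one, sub_eq_zero] at h1
    exact h1

end Torus

/-! ### Analysis operators and mixed frame operators of Bessel families -/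

section BesselFamily

variable {ι H : Type*} [NormedAddCommGroup H] [InnerProductSpace ℂ H] {e e' : ι → H}

/-- The coefficient sequence of `f` with respect to a Bessel family, in `ℓ²`. -/
noncomputable def besselCoeff (he : IsBessel e) (f : H) : lp (fun _ : ι => ℂ) 2 :=
  ⟨fun i => ⟪e i, f⟫_ℂ, memℓp_gen (by
    simpa using (Classical.choose_spec he).2 f |>.1)⟩

theorem besselCoeff_apply (he : IsBessel e) (f : H) (i : ι) : besselCoeff he f i = ⟪e i, f⟫_ℂ := rfl

/-- The analysis operator of a Bessel family. -/
noncomputable def analysis (he : IsBessel e) : H →L[ℂ] lp (fun _ : ι => ℂ) 2 :=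
  LinearMap.mkContinuousOfExistsBound
    { toFun := besselCoeff he
      map_add' := fun f g => by ext i; simp [besselCoeff_apply]
      map_smul' := fun c f => by ext i; simp [besselCoeff_apply] }
    (by
      obtain ⟨B, hB, h⟩ := id he
      refine ⟨Real.sqrt B, fun f => ?_⟩
      rw [← Real.sqrt_sq (norm_nonneg f), ← Real.sqrt_mul hB.le]
      refine Real.le_sqrt_of_sq_le ?_
      have h1 := lp.norm_rpow_eq_tsum (p := 2) (by norm_num) (besselCoeff he f)
      simp only [ENNReal.toReal_ofNat, Real.rpow_ofNat] at h1
      change ‖besselCoeff he f‖ ^ 2 ≤ _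
      rw [h1]
      exact (h f).2)

theorem analysis_apply (he : IsBessel e) (f : H) (i : ι) : analysis he f i = ⟪e i, f⟫_ℂ := rfl

theorem hasSum_inner_analysis (he : IsBessel e) (he' : IsBessel e') (f₁ f₂ : H) :
    HasSum (fun i => ⟪f₂, e' i⟫_ℂ * ⟪e i, f₁⟫_ℂ) ⟪analysis he' f₂, analysis he f₁⟫_ℂ := by
  have h := lp.hasSum_inner (𝕜 := ℂ) (analysis he' f₂) (analysis he f₁)
  have e : (fun i => ⟪analysis he' f₂ i, analysis he f₁ i⟫_ℂ)
      = fun i => ⟪f₂, e' i⟫_ℂ * ⟪e i, f₁⟫_ℂ := funext fun i => by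
    rw [analysis_apply, analysis_apply, RCLike.inner_apply, inner_conj_symm, mul_comm]
  rwa [e] at h

/-- A sequence in `ℓ²` is the unconditional sum of its coordinates, and the adjoint of the analysis
operator carries this sum to the frame expansion. Unconditional convergence is thus automatic. -/
theorem hasSum_frame [CompleteSpace H] (he : IsBessel e) (he' : IsBessel e') (f : H) :
    HasSum (fun i => ⟪e i, f⟫_ℂ • e' i)
      (ContinuousLinearMap.adjoint (analysis he') (analysis he f)) := by
  classical
  have h := (lp.hasSum_single (by norm_num) (analysis he f)).mapL
    (ContinuousLinearMap.adjoint (analysis he'))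
  convert h using 1
  funext i
  refine ext_inner_left ℂ fun v => ?_
  rw [ContinuousLinearMap.adjoint_inner_right, lp.inner_single_right, analysis_apply, analysis_apply,
    RCLike.inner_apply, inner_conj_symm, inner_smul_right]

/-- Duality says that a bounded operator is the identity, which can be tested weakly on a dense set.
-/
theorem isDualSystem_iff [CompleteSpace H] (he : IsBessel e) (he' : IsBessel e') {D : Set H}
    (hD : Dense D) :
    IsDualSystem e' e ↔ ∀ f₁ ∈ D, ∀ f₂ ∈ D, ∑' i, ⟪f₂, e' i⟫_ℂ * ⟪e i, f₁⟫_ℂ = ⟪f₂, f₁⟫_ℂ := by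
  have hS : ∀ f₁ f₂, ∑' i, ⟪f₂, e' i⟫_ℂ * ⟪e i, f₁⟫_ℂ
      = ⟪f₂, ContinuousLinearMap.adjoint (analysis he') (analysis he f₁)⟫_ℂ := fun f₁ f₂ => by
    rw [(hasSum_inner_analysis he he' f₁ f₂).tsum_eq, ContinuousLinearMap.adjoint_inner_right]
  simp_rw [hS]
  constructor
  · intro h f₁ _ f₂ _
    rw [(hasSum_frame he he' f₁).unique (h f₁)]
  · intro h
    have h1 : ∀ f₁ ∈ D, ContinuousLinearMap.adjoint (analysis he') (analysis he f₁) = f₁ :=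
      fun f₁ hf₁ => hD.eq_of_inner_right (𝕜 := ℂ) fun f₂ hf₂ => h f₁ hf₁ f₂ hf₂
    have h2 : (fun f => ContinuousLinearMap.adjoint (analysis he') (analysis he f)) = id :=
      Continuous.ext_on hD (by fun_prop) continuous_id h1
    intro f
    have h3 := hasSum_frame he he' f
    rwa [show ContinuousLinearMap.adjoint (analysis he') (analysis he f) = f from
      congrFun h2 f] at h3

theorem continuous_tsum_inner (he : IsBessel e) (he' : IsBessel e') {X : Type*} [TopologicalSpace X]
    {f₁ f₂ : X → H} (h₁ : Continuous f₁) (h₂ : Continuous f₂) :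
    Continuous fun x => ∑' i, ⟪f₂ x, e' i⟫_ℂ * ⟪e i, f₁ x⟫_ℂ := by
  simp_rw [fun x => (hasSum_inner_analysis he he' (f₁ x) (f₂ x)).tsum_eq]
  exact ((analysis he').continuous.comp h₂).inner ((analysis he).continuous.comp h₁)

/-- In `ℝ≥0∞` the sums can be rearranged and compared without separate summability proofs. -/
theorem isBessel_iff_tsum_enorm :
    IsBessel e ↔ ∃ B : ℝ≥0, ∀ f : H, ∑' i, ‖⟪e i, f⟫_ℂ‖ₑ ^ 2 ≤ B * ‖f‖ₑ ^ 2 := by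
  have hs : ∀ f : H, ∀ i, ‖⟪e i, f⟫_ℂ‖ₑ ^ 2 = ENNReal.ofReal (‖⟪e i, f⟫_ℂ‖ ^ 2) := fun f i => by
    rw [ENNReal.ofReal_pow (norm_nonneg _), ofReal_norm]
  constructor
  · rintro ⟨B, hB, h⟩
    refine ⟨B.toNNReal, fun f => ?_⟩
    simp_rw [hs]
    rw [← ENNReal.ofReal_tsum_of_nonneg (fun i => by positivity) (h f).1, ← ofReal_norm,
      ← ENNReal.ofReal_pow (norm_nonneg _)]
    change _ ≤ ENNReal.ofReal B * _
    rw [← ENNReal.ofReal_mul hB.le]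
    exact ENNReal.ofReal_le_ofReal (h f).2
  · rintro ⟨B, h⟩
    refine ⟨B + 1, by positivity, fun f => ?_⟩
    have hf := h f
    simp_rw [hs] at hf
    have hne : ∑' i, ENNReal.ofReal (‖⟪e i, f⟫_ℂ‖ ^ 2) ≠ ∞ :=
      ne_top_of_le_ne_top (by finiteness) hf
    have hsum : Summable fun i => ‖⟪e i, f⟫_ℂ‖ ^ 2 := by
      have := ENNReal.summable_toReal hne
      exact this.congr fun i => by rw [ENNReal.toReal_ofReal (by positivity)]
    refine ⟨hsum, ?_⟩
    rw [← ENNReal.ofReal_tsum_of_nonneg (fun i => by positivity) hsum] at hf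
    have h1 := ENNReal.toReal_mono (by finiteness) hf
    rw [ENNReal.toReal_ofReal (tsum_nonneg fun i => by positivity)] at h1
    simp only [ENNReal.toReal_mul, ENNReal.coe_toReal, ENNReal.toReal_pow, toReal_enorm] at h1
    nlinarith [sq_nonneg ‖f‖]

end BesselFamily

/-! ### Translations and modulations on `L²` -/

section Translation

variable {m : ℕ}

/-- Translation by `x` on `L²(ℝᵐ)`. -/
noncomputable def transL2 (x : Rm m) : L2 m →ₗᵢ[ℂ] L2 m :=
  Lp.compMeasurePreservingₗᵢ ℂ (fun t => t - x) (measurePreserving_sub_right volume x)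

theorem coeFn_transL2 (x : Rm m) (f : L2 m) : transL2 x f =ᵐ[volume] fun t => f (t - x) :=
  Lp.coeFn_compMeasurePreserving f (measurePreserving_sub_right volume x)

theorem transL2_add (x y : Rm m) (f : L2 m) : transL2 (x + y) f = transL2 x (transL2 y f) := by
  apply Lp.ext
  have h := (measurePreserving_sub_right volume x).quasiMeasurePreserving.ae_eq_comp
    (coeFn_transL2 y f)
  filter_upwards [coeFn_transL2 (x + y) f, coeFn_transL2 x (transL2 y f), h] with t h1 h2 h3
  rw [h1, h2]
  simp only [Function.comp_apply] at h3
  rw [h3, sub_sub]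

theorem transL2_zero (f : L2 m) : transL2 0 f = f := by
  apply Lp.ext
  filter_upwards [coeFn_transL2 0 f] with t h1
  rw [h1, sub_zero]

theorem inner_transL2 (x : Rm m) (f g : L2 m) : ⟪transL2 x f, g⟫_ℂ = ⟪f, transL2 (-x) g⟫_ℂ := by
  rw [← (transL2 (-x)).inner_map_map, ← transL2_add, neg_add_cancel, transL2_zero]

theorem inner_transL2_right (x : Rm m) (f g : L2 m) :
    ⟪f, transL2 x g⟫_ℂ = ⟪transL2 (-x) f, g⟫_ℂ := by
  rw [inner_transL2, neg_neg]

theorem enorm_transL2 (x : Rm m) (f : L2 m) : ‖transL2 x f‖ₑ = ‖f‖ₑ := by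
  rw [← ofReal_norm, ← ofReal_norm, LinearIsometry.norm_map]

theorem continuous_transL2 (f : L2 m) : Continuous fun x : Rm m => transL2 x f := by
  let c : Rm m → C(Rm m, Rm m) := fun x => ⟨fun t => t - x, by fun_prop⟩
  have hc : Continuous c := ContinuousMap.continuous_of_continuous_uncurry _ (by
    simp only [Function.uncurry_def, c, ContinuousMap.coe_mk]; fun_prop)
  exact (continuous_const (y := f)).compMeasurePreservingLp hc
    (fun x => measurePreserving_sub_right volume x) (by norm_num)

theorem memLp_modulate (ω : Rm m) (f : L2 m) : MemLp (modulate ω f) 2 (volume : Measure (Rm m)) := by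
  have h := memLp_translate_modulate 0 ω f
  have e : translate 0 (modulate ω (f : Rm m → ℂ)) = modulate ω f := funext fun t => by
    simp [translate]
  rwa [e] at h

/-- The modulation `M_ω f` on `L²(ℝᵐ)`. -/
noncomputable def modL2 (ω : Rm m) (f : L2 m) : L2 m := (memLp_modulate ω f).toLp

end Translation

/-! ### Translates along a model set and the periodized mixed form -/

section ModelSystem

variable {m : ℕ} {J : Type*}

/-- The family of translates of `u` along `Λ`. -/
noncomputable def modelSystem (u : J → L2 m) (Λ : Set (Rm m)) : J × Λ → L2 m :=
  fun i => transL2 (i.2 : Rm m) (u i.1)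

/-- The sum of the squares of the coefficients of `f` with respect to `u`. -/
noncomputable def energy (u : J → L2 m) (f : L2 m) : ℝ≥0∞ := ∑' j, ‖⟪u j, f⟫_ℂ‖ₑ ^ 2

/-- The sum of the squares of the coefficients of `f` with respect to the translates of `u` by the
lattice points over the window `W`. -/
noncomputable def latticeEnergy (Γ : Submodule ℤ (Rm m × ℝ)) (u : J → L2 m) (W : Set ℝ) (f : L2 m) :
    ℝ≥0∞ :=
  ∑' γ : Γ, W.indicator 1 (γ : Rm m × ℝ).2 * energy u (transL2 (-(γ : Rm m × ℝ).1) f)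

/-- The mixed coefficient sum `∑ⱼ ⟨T₋ₓ f₁, uⱼ⟩ ⟨vⱼ, T₋ₓ f₂⟩`. -/
noncomputable def mixedSum (u v : J → L2 m) (f₁ f₂ : L2 m) (x : Rm m) : ℂ :=
  ∑' j, ⟪transL2 (-x) f₂, v j⟫_ℂ * ⟪u j, transL2 (-x) f₁⟫_ℂ

variable {Γ : Submodule ℤ (Rm m × ℝ)}

theorem exists_lattice_of_mem_modelSet {Ω : Set ℝ} (l : modelSet Γ Ω) :
    ∃ γ : Γ, (γ : Rm m × ℝ).1 = l ∧ (γ : Rm m × ℝ).2 ∈ Ω := by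
  obtain ⟨_, ⟨γ, ⟨hγ, h⟩, rfl⟩⟩ := l
  exact ⟨⟨γ, hγ⟩, rfl, h⟩

/-- The lattice point over a point of the model set. -/
noncomputable def modelLift {Ω : Set ℝ} (l : modelSet Γ Ω) : Γ :=
  (exists_lattice_of_mem_modelSet l).choose

theorem modelLift_fst {Ω : Set ℝ} (l : modelSet Γ Ω) : (modelLift l : Rm m × ℝ).1 = l :=
  (exists_lattice_of_mem_modelSet l).choose_spec.1

theorem modelLift_snd {Ω : Set ℝ} (l : modelSet Γ Ω) : (modelLift l : Rm m × ℝ).2 ∈ Ω :=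
  (exists_lattice_of_mem_modelSet l).choose_spec.2

/-- Injectivity of `p₁` on `Γ` makes points of the model set correspond to lattice points over the
window; the summand on `Γ` is extended by zero. -/
theorem tsum_modelSet (hΓ : ProjectionsInjectiveDense Γ) {M : Type*} [AddCommMonoid M]
    [TopologicalSpace M] [T2Space M] {Ω : Set ℝ} (φ : Rm m → M) (ψ : Γ → M)
    (h : ∀ γ : Γ, (γ : Rm m × ℝ).2 ∈ Ω → ψ γ = φ (γ : Rm m × ℝ).1)
    (h0 : ∀ γ : Γ, (γ : Rm m × ℝ).2 ∉ Ω → ψ γ = 0) :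
    ∑' l : modelSet Γ Ω, φ l = ∑' γ : Γ, ψ γ := by
  have hinj : Function.Injective (modelLift : modelSet Γ Ω → Γ) := fun l l' hl => by
    apply Subtype.ext
    rw [← modelLift_fst l, ← modelLift_fst l', hl]
  rw [← hinj.tsum_eq (f := ψ)]
  · refine tsum_congr fun l => ?_
    rw [h _ (modelLift_snd l), modelLift_fst]
  · intro γ hγ
    have hm : (γ : Rm m × ℝ).2 ∈ Ω := by
      by_contra hn
      exact hγ (h0 γ hn)
    refine ⟨⟨(γ : Rm m × ℝ).1, γ, ⟨γ.2, hm⟩, rfl⟩, Subtype.ext (hΓ.injOn_fst (modelLift _).2 γ.2 ?_)⟩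
    exact modelLift_fst _

theorem tsum_modelSystem_enorm (hΓ : ProjectionsInjectiveDense Γ) (u : J → L2 m) (Ω : Set ℝ)
    (f : L2 m) : ∑' i, ‖⟪modelSystem u (modelSet Γ Ω) i, f⟫_ℂ‖ₑ ^ 2 = latticeEnergy Γ u Ω f := by
  rw [ENNReal.tsum_prod (f := fun j (l : modelSet Γ Ω) => ‖⟪modelSystem u _ (j, l), f⟫_ℂ‖ₑ ^ 2), ENNReal.tsum_comm,
    latticeEnergy]
  refine tsum_modelSet hΓ (fun x => ∑' j, ‖⟪transL2 x (u j), f⟫_ℂ‖ₑ ^ 2) _ (fun γ hγ => ?_)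
    fun γ hγ => ?_
  · simp_rw [Set.indicator_of_mem hγ, Pi.one_apply, one_mul, energy, inner_transL2]
  · rw [Set.indicator_of_notMem hγ, zero_mul]

/-- Moving the window by `p₂(γ₀)` amounts to translating `f` by `-p₁(γ₀)`, which preserves its norm.
Bounds for one window thus pass to its shifts along `p₂(Γ)`. -/
theorem latticeEnergy_translate (u : J → L2 m) (W : Set ℝ) (γ₀ : Γ) (f : L2 m) :
    latticeEnergy Γ u {s | s - (γ₀ : Rm m × ℝ).2 ∈ W} f
      = latticeEnergy Γ u W (transL2 (-(γ₀ : Rm m × ℝ).1) f) := by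
  rw [latticeEnergy, ← (Equiv.addRight γ₀).tsum_eq, latticeEnergy]
  refine tsum_congr fun γ => ?_
  have e : transL2 (-((γ + γ₀ : Γ) : Rm m × ℝ).1) f
      = transL2 (-(γ : Rm m × ℝ).1) (transL2 (-(γ₀ : Rm m × ℝ).1) f) := by
    rw [← transL2_add]
    congr 2
    simp [add_comm]
  simp only [Equiv.coe_addRight, e]
  congr 1
  have hm : ((γ + γ₀ : Γ) : Rm m × ℝ).2 ∈ {s | s - (γ₀ : Rm m × ℝ).2 ∈ W} ↔ (γ : Rm m × ℝ).2 ∈ W := by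
    simp
  by_cases h : (γ : Rm m × ℝ).2 ∈ W
  · rw [Set.indicator_of_mem h, Set.indicator_of_mem (hm.2 h)]
    rfl
  · rw [Set.indicator_of_notMem h, Set.indicator_of_notMem (mt hm.1 h)]

theorem latticeEnergy_mono (u : J → L2 m) {W W' : Set ℝ} (h : W ⊆ W') (f : L2 m) :
    latticeEnergy Γ u W f ≤ latticeEnergy Γ u W' f :=
  ENNReal.tsum_le_tsum fun _ => mul_le_mul_left
    (Set.indicator_le_indicator_of_subset h (fun _ => zero_le) _) _

theorem latticeEnergy_iUnion_le (u : J → L2 m) {α : Type*} (s : Finset α) (W : α → Set ℝ) (f : L2 m) :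
    latticeEnergy Γ u (⋃ i ∈ s, W i) f ≤ ∑ i ∈ s, latticeEnergy Γ u (W i) f := by
  simp_rw [latticeEnergy]
  rw [← Summable.tsum_finsetSum fun _ _ => ENNReal.summable]
  refine ENNReal.tsum_le_tsum fun γ => ?_
  rw [← Finset.sum_mul]
  refine mul_le_mul_left ?_ _
  by_cases h : (γ : Rm m × ℝ).2 ∈ ⋃ i ∈ s, W i
  · obtain ⟨i, hi, hm⟩ := Set.mem_iUnion₂.1 h
    rw [Set.indicator_of_mem h]
    refine le_trans ?_ (Finset.single_le_sum (fun _ _ => zero_le) hi)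
    rw [Set.indicator_of_mem hm]
  · rw [Set.indicator_of_notMem h]
    exact zero_le

/-- The Bessel bound for one window extends to all bounded windows. -/
theorem exists_latticeEnergy_le (hΓ : ProjectionsInjectiveDense Γ) {u : J → L2 m} {a : ℝ} (ha : 0 < a)
    (hu : IsBessel (modelSystem u (modelSet Γ (Set.Icc (-a) a)))) (R : ℝ) :
    ∃ B : ℝ≥0, ∀ f, latticeEnergy Γ u (Set.Icc (-R) R) f ≤ B * ‖f‖ₑ ^ 2 := by
  obtain ⟨B, hB⟩ := isBessel_iff_tsum_enorm.1 hu
  simp_rw [tsum_modelSystem_enorm hΓ] at hB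
  -- By density of `p₂(Γ)`, the lattice shifts of the open window cover the line; compactness leaves
  -- finitely many.
  have hcover : Set.Icc (-R) R ⊆ ⋃ γ : Γ, {s | s - (γ : Rm m × ℝ).2 ∈ Set.Ioo (-a) a} := by
    intro s _
    obtain ⟨γ, hγ, h1, h2⟩ := exists_lattice_snd_mem_Ioo Γ hΓ (p := s - a) (q := s + a) (by linarith)
    exact Set.mem_iUnion.2 ⟨⟨γ, hγ⟩, by simp only [Set.mem_ofPred_eq, Set.mem_Ioo]; constructor <;> linarith⟩
  obtain ⟨t, ht⟩ := isCompact_Icc.elim_finite_subcover _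
    (fun γ : Γ => isOpen_Ioo.preimage (continuous_id.sub continuous_const)) hcover
  refine ⟨t.card * B, fun f => ?_⟩
  have hsub : Set.Icc (-R) R ⊆ ⋃ γ ∈ t, {s | s - (γ : Rm m × ℝ).2 ∈ Set.Icc (-a) a} :=
    ht.trans (Set.iUnion₂_mono fun γ _ s hs => Set.Ioo_subset_Icc_self hs)
  calc _ ≤ ∑ γ ∈ t, latticeEnergy Γ u {s | s - (γ : Rm m × ℝ).2 ∈ Set.Icc (-a) a} f :=
        (latticeEnergy_mono u hsub f).trans (latticeEnergy_iUnion_le u t _ f)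
    _ ≤ ∑ γ ∈ t, B * ‖f‖ₑ ^ 2 := Finset.sum_le_sum fun γ _ => by
        rw [latticeEnergy_translate]
        exact (hB _).trans (by rw [enorm_transL2])
    _ = _ := by
        rw [Finset.sum_const, nsmul_eq_mul]
        push_cast
        ring

/-- The lattice point `0` alone already contributes the full energy of `f` with respect to `u`. -/
theorem isBessel_of_modelSystem (hΓ : ProjectionsInjectiveDense Γ) {u : J → L2 m} {a : ℝ} (ha : 0 < a)
    (hu : IsBessel (modelSystem u (modelSet Γ (Set.Icc (-a) a)))) : IsBessel u := by
  obtain ⟨B, hB⟩ := exists_latticeEnergy_le hΓ ha hu 1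
  refine isBessel_iff_tsum_enorm.2 ⟨B, fun f => le_trans ?_ (hB f)⟩
  rw [latticeEnergy]
  refine le_trans (le_of_eq ?_) (ENNReal.le_tsum (0 : Γ))
  have h0 : ((0 : Γ) : Rm m × ℝ).2 ∈ Set.Icc (-1 : ℝ) 1 := by simp
  rw [Set.indicator_of_mem h0, Pi.one_apply, one_mul]
  simp [transL2_zero, energy]

theorem continuous_inner_transL2 (u f : L2 m) : Continuous fun x : Rm m => ⟪u, transL2 (-x) f⟫_ℂ :=
  continuous_const.inner ((continuous_transL2 f).comp continuous_neg)

theorem measurable_energy_transL2 [Countable J] (u : J → L2 m) (f : L2 m) :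
    Measurable fun x : Rm m => energy u (transL2 (-x) f) :=
  Measurable.tsum fun j => ((continuous_inner_transL2 (u j) f).enorm.measurable).pow_const 2

/-- The energy tensored with the window is integrated tile by tile. At a point of the fundamental
domain, the sum over `Γ` is at most a lattice energy for the window enlarged by `c`, hence bounded
by the Bessel inequality; the domain has finite measure. Fubini then removes the factor `2a`. -/
theorem lintegral_energy_ne_top [Countable J] [DiscreteTopology Γ] [IsZLattice ℝ Γ]
    (hΓ : ProjectionsInjectiveDense Γ) {u : J → L2 m} {a : ℝ} (ha : 0 < a)
    (hu : IsBessel (modelSystem u (modelSet Γ (Set.Icc (-a) a)))) (f : L2 m) :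
    ∫⁻ x : Rm m, energy u (transL2 (-x) f) ≠ ∞ := by
  obtain ⟨c, hc0, hc⟩ := exists_latticeDomain_bound Γ
  obtain ⟨B, hB⟩ := exists_latticeEnergy_le hΓ ha hu (a + c)
  have hm := measurable_energy_transL2 u f
  have hi : Measurable ((Set.Icc (-a) a).indicator (1 : ℝ → ℝ≥0∞)) :=
    measurable_one.indicator measurableSet_Icc
  have h1 : ∫⁻ z : Rm m × ℝ, energy u (transL2 (-z.1) f) * (Set.Icc (-a) a).indicator 1 z.2
      = (∫⁻ x : Rm m, energy u (transL2 (-x) f)) * ENNReal.ofReal (2 * a) := by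
    rw [Measure.volume_eq_prod, lintegral_prod_mul hm.aemeasurable hi.aemeasurable,
      lintegral_indicator_one measurableSet_Icc, Real.volume_Icc]
    congr 2; ring
  have h2 : ∫⁻ z : Rm m × ℝ, energy u (transL2 (-z.1) f) * (Set.Icc (-a) a).indicator 1 z.2
      ≤ volume (latticeDomain Γ) * (B * ‖f‖ₑ ^ 2) := by
    rw [lintegral_eq_tsum_latticeDomain (Γ := Γ), ← lintegral_tsum]
    swap
    · intro γ
      have hm1 : Measurable fun z : Rm m × ℝ => energy u (transL2 (-z.1) f)
          * (Set.Icc (-a) a).indicator 1 z.2 :=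
        (hm.comp measurable_fst).mul (hi.comp measurable_snd)
      exact (hm1.comp (measurable_const_add (γ : Rm m × ℝ))).aemeasurable
    rw [mul_comm, ← setLIntegral_const]
    refine setLIntegral_mono measurable_const fun z hz => ?_
    refine le_trans ?_ ((hB (transL2 (-z.1) f)).trans (by rw [enorm_transL2]))
    refine ENNReal.tsum_le_tsum fun γ => ?_
    rw [mul_comm, ← transL2_add]
    simp only [Prod.fst_add, Prod.snd_add]
    rw [neg_add]
    refine mul_le_mul_left ?_ _
    by_cases hw : (γ : Rm m × ℝ).2 + z.2 ∈ Set.Icc (-a) a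
    · have h3 := abs_le.1 (hc z hz).2
      have : (γ : Rm m × ℝ).2 ∈ Set.Icc (-(a + c)) (a + c) :=
        ⟨by linarith [hw.1], by linarith [hw.2]⟩
      rw [Set.indicator_of_mem this]
      exact Set.indicator_le_self _ _ _
    · rw [Set.indicator_of_notMem hw]
      exact zero_le
  rw [h1] at h2
  intro htop
  rw [htop, ENNReal.top_mul (by simpa using ha), top_le_iff] at h2
  have := measure_latticeDomain_ne_top Γ (volume : Measure (Rm m × ℝ))
  exact ENNReal.mul_ne_top this (by finiteness) h2

theorem mul_le_sq_add_sq_ennreal (p q : ℝ≥0∞) : p * q ≤ p ^ 2 + q ^ 2 := by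
  rcases le_total p q with h | h
  · calc p * q ≤ q * q := mul_le_mul_left h q
      _ = q ^ 2 := (sq q).symm
      _ ≤ _ := le_add_self
  · calc p * q ≤ p * p := mul_le_mul_right h p
      _ = p ^ 2 := (sq p).symm
      _ ≤ _ := le_self_add

theorem tsum_enorm_mixed_le (u v : J → L2 m) (f₁ f₂ : L2 m) (x : Rm m) :
    ∑' j, ‖⟪transL2 (-x) f₂, v j⟫_ℂ * ⟪u j, transL2 (-x) f₁⟫_ℂ‖ₑ
      ≤ energy u (transL2 (-x) f₁) + energy v (transL2 (-x) f₂) := by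
  rw [energy, energy, ← ENNReal.tsum_add]
  refine ENNReal.tsum_le_tsum fun j => ?_
  rw [enorm_mul, mul_comm, ← ofReal_norm ⟪transL2 (-x) f₂, v j⟫_ℂ, norm_inner_symm, ofReal_norm]
  exact mul_le_sq_add_sq_ennreal _ _

theorem enorm_mixedSum_le (u v : J → L2 m) (f₁ f₂ : L2 m) (x : Rm m) :
    ‖mixedSum u v f₁ f₂ x‖ₑ ≤ energy u (transL2 (-x) f₁) + energy v (transL2 (-x) f₂) :=
  enorm_tsum_le_tsum_enorm.trans (tsum_enorm_mixed_le u v f₁ f₂ x)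

theorem continuous_mixedSum (hΓ : ProjectionsInjectiveDense Γ) {u v : J → L2 m} {a : ℝ} (ha : 0 < a)
    (hu : IsBessel (modelSystem u (modelSet Γ (Set.Icc (-a) a))))
    (hv : IsBessel (modelSystem v (modelSet Γ (Set.Icc (-a) a)))) (f₁ f₂ : L2 m) :
    Continuous (mixedSum u v f₁ f₂) :=
  continuous_tsum_inner (isBessel_of_modelSystem hΓ ha hu) (isBessel_of_modelSystem hΓ ha hv)
    ((continuous_transL2 f₁).comp continuous_neg) ((continuous_transL2 f₂).comp continuous_neg)

theorem integrable_mixedSum [Countable J] [DiscreteTopology Γ] [IsZLattice ℝ Γ]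
    (hΓ : ProjectionsInjectiveDense Γ) {u v : J → L2 m} {a : ℝ} (ha : 0 < a)
    (hu : IsBessel (modelSystem u (modelSet Γ (Set.Icc (-a) a))))
    (hv : IsBessel (modelSystem v (modelSet Γ (Set.Icc (-a) a)))) (f₁ f₂ : L2 m) :
    Integrable (mixedSum u v f₁ f₂) := by
  refine ⟨(continuous_mixedSum hΓ ha hu hv f₁ f₂).aestronglyMeasurable, ?_⟩
  refine lt_of_le_of_lt (lintegral_mono fun x => enorm_mixedSum_le u v f₁ f₂ x) ?_
  rw [lintegral_add_left (measurable_energy_transL2 u f₁)]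
  exact ENNReal.add_lt_top.2 ⟨(lintegral_energy_ne_top hΓ ha hu f₁).lt_top,
    (lintegral_energy_ne_top hΓ ha hv f₂).lt_top⟩

/-- The mixed coefficient sum tensored with the indicator function of the window. -/
noncomputable def windowTensor (u v : J → L2 m) (a : ℝ) (f₁ f₂ : L2 m) (z : Rm m × ℝ) : ℂ :=
  mixedSum u v f₁ f₂ z.1 * (Set.Icc (-a) a).indicator 1 z.2

theorem integrable_windowTensor [Countable J] [DiscreteTopology Γ] [IsZLattice ℝ Γ]
    (hΓ : ProjectionsInjectiveDense Γ) {u v : J → L2 m} {a : ℝ} (ha : 0 < a)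
    (hu : IsBessel (modelSystem u (modelSet Γ (Set.Icc (-a) a))))
    (hv : IsBessel (modelSystem v (modelSet Γ (Set.Icc (-a) a)))) (f₁ f₂ : L2 m) :
    Integrable (windowTensor u v a f₁ f₂) := by
  rw [Measure.volume_eq_prod]
  refine (integrable_mixedSum hΓ ha hu hv f₁ f₂).mul_prod ?_
  exact (integrable_indicator_iff measurableSet_Icc).2 (integrableOn_const (by simp))

theorem summable_mixedSum_lattice (hΓ : ProjectionsInjectiveDense Γ) {u v : J → L2 m} {a : ℝ}
    (ha : 0 < a) (hu : IsBessel (modelSystem u (modelSet Γ (Set.Icc (-a) a))))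
    (hv : IsBessel (modelSystem v (modelSet Γ (Set.Icc (-a) a)))) (f₁ f₂ : L2 m) (x : Rm m) (R : ℝ) :
    Summable fun γ : Γ => ‖(Set.Icc (-R) R).indicator (1 : ℝ → ℂ) (γ : Rm m × ℝ).2
      * mixedSum u v f₁ f₂ ((γ : Rm m × ℝ).1 + x)‖ := by
  obtain ⟨B, hB⟩ := exists_latticeEnergy_le hΓ ha hu R
  obtain ⟨B', hB'⟩ := exists_latticeEnergy_le hΓ ha hv R
  rw [← tsum_enorm_ne_top_iff_summable_norm]
  refine ne_top_of_le_ne_top (ENNReal.add_ne_top.2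
    ⟨ne_top_of_le_ne_top (by finiteness) (hB (transL2 (-x) f₁)),
      ne_top_of_le_ne_top (by finiteness) (hB' (transL2 (-x) f₂))⟩) ?_
  rw [latticeEnergy, latticeEnergy, ← ENNReal.tsum_add]
  refine ENNReal.tsum_le_tsum fun γ => ?_
  rw [← mul_add, enorm_mul, ← transL2_add, ← transL2_add, ← neg_add]
  refine mul_le_mul' (le_of_eq ?_) (enorm_mixedSum_le u v f₁ f₂ _)
  by_cases h : (γ : Rm m × ℝ).2 ∈ Set.Icc (-R) R <;> simp [Set.indicator, h]

/-- The periodization along the fibre over the origin is the mixed frame form of the systems. -/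
theorem tsum_windowTensor_zero (hΓ : ProjectionsInjectiveDense Γ) {u v : J → L2 m} {a : ℝ}
    (hu : IsBessel (modelSystem u (modelSet Γ (Set.Icc (-a) a))))
    (hv : IsBessel (modelSystem v (modelSet Γ (Set.Icc (-a) a)))) (f₁ f₂ : L2 m) (x : Rm m) :
    ∑' γ : Γ, windowTensor u v a f₁ f₂ ((γ : Rm m × ℝ) + (x, 0))
      = ∑' i, ⟪transL2 (-x) f₂, modelSystem v (modelSet Γ (Set.Icc (-a) a)) i⟫_ℂ
        * ⟪modelSystem u (modelSet Γ (Set.Icc (-a) a)) i, transL2 (-x) f₁⟫_ℂ := by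
  have hs := (hasSum_inner_analysis hu hv (transL2 (-x) f₁) (transL2 (-x) f₂)).summable
  rw [← (Equiv.prodComm _ _).tsum_eq]
  refine Eq.trans ?_ (Summable.tsum_prod ((Equiv.prodComm _ _).summable_iff.2 hs)).symm
  symm
  refine tsum_modelSet hΓ (fun y => ∑' j, ⟪transL2 (-x) f₂, transL2 y (v j)⟫_ℂ
    * ⟪transL2 y (u j), transL2 (-x) f₁⟫_ℂ) _ (fun γ hγ => ?_) fun γ hγ => ?_
  · rw [windowTensor, Prod.snd_add, add_zero, Set.indicator_of_mem hγ, Pi.one_apply, mul_one, mixedSum]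
    refine tsum_congr fun j => ?_
    rw [inner_transL2_right _ (transL2 (-x) f₂), inner_transL2 _ _ (transL2 (-x) f₁), ← transL2_add,
      ← transL2_add, ← neg_add]
    rfl
  · rw [windowTensor, Prod.snd_add, add_zero, Set.indicator_of_notMem hγ, mul_zero]

theorem continuous_tsum_windowTensor_zero (hΓ : ProjectionsInjectiveDense Γ) {u v : J → L2 m} {a : ℝ}
    (hu : IsBessel (modelSystem u (modelSet Γ (Set.Icc (-a) a))))
    (hv : IsBessel (modelSystem v (modelSet Γ (Set.Icc (-a) a)))) (f₁ f₂ : L2 m) :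
    Continuous fun x : Rm m => ∑' γ : Γ, windowTensor u v a f₁ f₂ ((γ : Rm m × ℝ) + (x, 0)) := by
  simp_rw [tsum_windowTensor_zero hΓ hu hv]
  exact continuous_tsum_inner hu hv ((continuous_transL2 f₁).comp continuous_neg)
    ((continuous_transL2 f₂).comp continuous_neg)

/-- In the direction of the window the periodization is continuous at the generic points. -/
theorem continuousAt_tsum_windowTensor (hΓ : ProjectionsInjectiveDense Γ) {u v : J → L2 m} {a : ℝ}
    (ha : 0 < a) (hu : IsBessel (modelSystem u (modelSet Γ (Set.Icc (-a) a))))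
    (hv : IsBessel (modelSystem v (modelSet Γ (Set.Icc (-a) a)))) (f₁ f₂ : L2 m) (x : Rm m) {y : ℝ}
    (hy : ∀ γ ∈ Γ, γ.2 + y ∉ frontier (Set.Icc (-a) a)) :
    ContinuousAt (fun y : ℝ => ∑' γ : Γ, windowTensor u v a f₁ f₂ ((γ : Rm m × ℝ) + (x, y))) y := by
  -- The window of half-length `a + |y| + 1` contains every lattice height that meets the window
  -- shifted by some `s` with `|s - y| < 1`, so it dominates all nearby series at once.
  have hsum := summable_mixedSum_lattice hΓ ha hu hv f₁ f₂ x (a + |y| + 1)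
  refine tendsto_tsum_of_dominated_convergence hsum (fun γ => ?_) ?_
  · have h1 : ContinuousAt ((Set.Icc (-a) a).indicator (1 : ℝ → ℂ)) ((γ : Rm m × ℝ).2 + y) := by
      have := hy γ γ.2
      by_cases hm : (γ : Rm m × ℝ).2 + y ∈ Set.Icc (-a) a
      · have hi : Set.Icc (-a) a ∈ 𝓝 ((γ : Rm m × ℝ).2 + y) := by
          rw [frontier, Set.mem_sdiff, not_and_not_right] at this
          exact mem_interior_iff_mem_nhds.1 (this (subset_closure hm))
        refine (continuousAt_const (y := (1 : ℂ))).congr ?_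
        filter_upwards [hi] with s hs
        rw [Set.indicator_of_mem hs, Pi.one_apply]
      · refine (continuousAt_const (y := (0 : ℂ))).congr ?_
        filter_upwards [isClosed_Icc.isOpen_compl.mem_nhds hm] with s hs
        rw [Set.indicator_of_notMem hs]
    have h2 : ContinuousAt (fun s : ℝ => (Set.Icc (-a) a).indicator (1 : ℝ → ℂ)
        ((γ : Rm m × ℝ).2 + s)) y :=
      ContinuousAt.comp (f := fun s : ℝ => (γ : Rm m × ℝ).2 + s) h1 (by fun_prop)
    exact (continuousAt_const (y := mixedSum u v f₁ f₂ ((γ : Rm m × ℝ).1 + x))).mul h2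
  · filter_upwards [Metric.ball_mem_nhds y one_pos] with s hs γ
    rw [Metric.mem_ball, Real.dist_eq] at hs
    simp only [windowTensor, Prod.fst_add, Prod.snd_add]
    rw [norm_mul, norm_mul, mul_comm]
    refine mul_le_mul_of_nonneg_right ?_ (norm_nonneg _)
    by_cases hw : (γ : Rm m × ℝ).2 + s ∈ Set.Icc (-a) a
    · have h3 := abs_lt.1 hs
      have h4 := neg_abs_le y
      have h5 := le_abs_self y
      have : (γ : Rm m × ℝ).2 ∈ Set.Icc (-(a + |y| + 1)) (a + |y| + 1) :=
        ⟨by linarith [hw.1], by linarith [hw.2]⟩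
      rw [Set.indicator_of_mem hw, Set.indicator_of_mem this]
      simp
    · rw [Set.indicator_of_notMem hw]
      simp

theorem tsum_windowTensor_add_lattice (u v : J → L2 m) (a : ℝ) (f₁ f₂ : L2 m) (γ₀ : Γ) (z : Rm m × ℝ) :
    ∑' γ : Γ, windowTensor u v a f₁ f₂ (γ + (γ₀ + z)) = ∑' γ : Γ, windowTensor u v a f₁ f₂ (γ + z) := by
  rw [← (Equiv.addRight γ₀).tsum_eq fun γ : Γ => windowTensor u v a f₁ f₂ (γ + z)]
  simp [add_assoc]

/-- Only countably many heights put a lattice point on one of the two endpoints. -/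
theorem ae_generic [Countable Γ] (a : ℝ) :
    ∀ᵐ z : Rm m × ℝ, ∀ γ ∈ Γ, γ.2 + z.2 ∉ frontier (Set.Icc (-a) a) := by
  have hc : (⋃ γ : Γ, (fun y : ℝ => (γ : Rm m × ℝ).2 + y) ⁻¹' frontier (Set.Icc (-a) a)).Countable := by
    refine Set.countable_iUnion fun γ => Set.Countable.preimage_of_injOn ?_ (add_right_injective _).injOn
    rcases le_or_gt (-a) a with h | h
    · rw [frontier_Icc h]
      exact (Set.toFinite _).countable
    · rw [Set.Icc_eq_empty (not_le.2 h)]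
      simp
  have h1 : ∀ᵐ y : ℝ, y ∉ ⋃ γ : Γ, (fun y : ℝ => (γ : Rm m × ℝ).2 + y) ⁻¹' frontier (Set.Icc (-a) a) :=
    measure_eq_zero_iff_ae_notMem.1 (hc.measure_zero volume)
  rw [Measure.volume_eq_prod]
  filter_upwards [Measure.quasiMeasurePreserving_snd.ae h1] with z hz γ hγ hf
  exact hz (Set.mem_iUnion.2 ⟨⟨γ, hγ⟩, hf⟩)

/-- The mixed frame form is constant along all translates if and only if the periodization is
almost everywhere constant. -/
theorem forall_tsum_windowTensor_zero_eq_iff [Countable Γ]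
    (hΓ : ProjectionsInjectiveDense Γ) {u v : J → L2 m} {a : ℝ}
    (ha : 0 < a) (hgen : IsGeneric Γ (Set.Icc (-a) a))
    (hu : IsBessel (modelSystem u (modelSet Γ (Set.Icc (-a) a))))
    (hv : IsBessel (modelSystem v (modelSet Γ (Set.Icc (-a) a)))) (f₁ f₂ : L2 m) (κ : ℂ) :
    (∀ x : Rm m, ∑' γ : Γ, windowTensor u v a f₁ f₂ ((γ : Rm m × ℝ) + (x, 0)) = κ) ↔
      ∀ᵐ z : Rm m × ℝ, ∑' γ : Γ, windowTensor u v a f₁ f₂ (γ + z) = κ := by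
  constructor
  · intro h
    filter_upwards [ae_generic (Γ := Γ) a] with z hz
    have hcont := continuousAt_tsum_windowTensor hΓ ha hu hv f₁ f₂ z.1 hz
    -- At a height `γ.2` with `γ ∈ Γ`, periodicity moves `(z.1, γ.2)` to `(z.1 - γ.1, 0)`, where the
    -- value is `κ`. Such heights accumulate at `z.2`, a point of continuity.
    refine tendsto_nhds_unique_of_frequently_eq hcont (tendsto_const_nhds (x := κ)) ?_
    refine (mem_closure_iff_frequently.1 (hΓ.dense_snd z.2)).mono ?_
    rintro _ ⟨γ, hγ, rfl⟩
    have := tsum_windowTensor_add_lattice u v a f₁ f₂ ⟨γ, hγ⟩ (z.1 - γ.1, 0)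
    rw [h] at this
    rw [← this, show (γ + (z.1 - γ.1, (0 : ℝ)) : Rm m × ℝ) = (z.1, γ.2) by ext1 <;> simp]
  · intro h
    have hz : ∀ γ ∈ Γ, γ.2 + 0 ∉ frontier (Set.Icc (-a) a) := fun γ hγ => by
      rw [add_zero]; exact hgen γ hγ
    rw [Measure.volume_eq_prod] at h
    have h1 : ∀ᵐ x : Rm m, ∑' γ : Γ, windowTensor u v a f₁ f₂ ((γ : Rm m × ℝ) + (x, 0)) = κ := by
      -- By Fubini almost every vertical line carries the value `κ` on a dense set, and genericity
      -- makes height `0` a point of continuity. Continuity in `x` afterwards removes the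
      -- exceptional null set.
      filter_upwards [Measure.ae_ae_of_ae_prod h] with x hx
      have hcont := continuousAt_tsum_windowTensor hΓ ha hu hv f₁ f₂ x hz
      refine tendsto_nhds_unique_of_frequently_eq hcont (tendsto_const_nhds (x := κ)) ?_
      exact mem_closure_iff_frequently.1 (Measure.dense_of_ae hx 0)
    intro x
    have h2 := (continuous_tsum_windowTensor_zero hΓ hu hv f₁ f₂).ae_eq_iff_eq volume
      (continuous_const (y := κ))
    exact congrFun (h2.1 h1) x

end ModelSystem

/-! ### Coefficients on the Fourier side -/

section FiberFunctions

variable {m : ℕ}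

/-- On a cube of volume one the `L¹` norm is at most the `L²` norm. Integrability makes the Fourier
integral a continuous function, so the symbol has a meaning at each point. -/
theorem integrable_of_memWiener {f : L2 m} (hf : MemWiener f) : Integrable (f : Rm m → ℂ) := by
  refine ⟨Lp.aestronglyMeasurable f, ?_⟩
  set c : (Fin m → ℤ) → Set (Rm m) := fun k => cube (WithLp.toLp 2 fun i => (k i : ℝ)) 1 with hc
  have hcover : (⋃ k, c k) = Set.univ := by
    refine Set.eq_univ_of_forall fun y => Set.mem_iUnion.2 ⟨fun i => ⌊y i⌋, fun i => ?_⟩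
    exact ⟨Int.floor_le _, (Int.lt_floor_add_one _).le⟩
  have hvol : ∀ k, volume (c k) = 1 := fun k => by simp [hc, volume_cube]
  calc ∫⁻ t, ‖f t‖ₑ = ∫⁻ t in ⋃ k, c k, ‖f t‖ₑ := by rw [hcover, setLIntegral_univ]
    _ ≤ ∑' k, ∫⁻ t in c k, ‖f t‖ₑ := lintegral_iUnion_le _ _
    _ ≤ ∑' k, eLpNorm ((c k).indicator (f : Rm m → ℂ)) 2 volume := by
        refine ENNReal.tsum_le_tsum fun k => ?_
        rw [← eLpNorm_one_eq_lintegral_enorm, eLpNorm_indicator_eq_eLpNorm_restrict (measurableSet_cube _ _)]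
        refine (eLpNorm_le_eLpNorm_mul_rpow_measure_univ (q := 2) (by norm_num)
          (Lp.aestronglyMeasurable f).restrict).trans (le_of_eq ?_)
        rw [Measure.restrict_apply_univ, hvol, ENNReal.one_rpow, mul_one]
    _ < ∞ := hf

/-- The square integrable function whose Fourier transform is the Schwartz function `φ`. -/
noncomputable def synth (φ : SchwartzMap (Rm m) ℂ) : L2 m :=
  (𝓕⁻ φ : SchwartzMap (Rm m) ℂ).toLp 2 volume

theorem coeFn_synth (φ : SchwartzMap (Rm m) ℂ) : synth φ =ᵐ[volume] 𝓕⁻ (φ : Rm m → ℂ) := by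
  rw [← SchwartzMap.fourierInv_coe]
  exact SchwartzMap.coeFn_toLp _ 2 volume

theorem dense_range_synth : Dense (Set.range (synth (m := m))) := by
  have h := SchwartzMap.denseRange_toLpCLM (F := ℂ) (E := Rm m) (p := 2) (by norm_num)
    (μ := volume)
  refine h.mono ?_
  rintro _ ⟨φ, rfl⟩
  refine ⟨𝓕 φ, ?_⟩
  rw [synth, FourierTransform.fourierInv_fourier_eq]
  rfl

/-- The product of `φ` with the conjugate of a shift of the Fourier transform of `g`. -/
noncomputable def fiberFun (φ : SchwartzMap (Rm m) ℂ) (g : Rm m → ℂ) (b v : Rm m) : ℂ :=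
  φ v * conj (𝓕 g (v - b))

theorem continuous_fiber {g : Rm m → ℂ} (hg : Integrable g) (b : Rm m) :
    Continuous fun v => conj (𝓕 g (v - b)) :=
  Complex.continuous_conj.comp
    ((continuous_fourier_of_integrable hg).comp (continuous_id.sub continuous_const))

theorem norm_fiber_le (g : Rm m → ℂ) (b v : Rm m) : ‖conj (𝓕 g (v - b))‖ ≤ ∫ t, ‖g t‖ := by
  rw [RCLike.norm_conj]
  exact VectorFourier.norm_fourierIntegral_le_integral_norm _ _ _ _ _

theorem integrable_fiberFun (φ : SchwartzMap (Rm m) ℂ) {g : Rm m → ℂ} (hg : Integrable g) (b : Rm m) :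
    Integrable (fiberFun φ g b) :=
  φ.integrable.mul_bdd (continuous_fiber hg b).aestronglyMeasurable
    (Eventually.of_forall fun v => norm_fiber_le g b v)

theorem memLp_fiberFun (φ : SchwartzMap (Rm m) ℂ) {g : Rm m → ℂ} (hg : Integrable g) (b : Rm m) :
    MemLp (fiberFun φ g b) 2 := by
  refine (φ.memLp 2).of_le_mul (c := ∫ t, ‖g t‖) (integrable_fiberFun φ hg b).1
    (Eventually.of_forall fun v => ?_)
  rw [fiberFun, norm_mul, mul_comm]
  exact mul_le_mul_of_nonneg_right (norm_fiber_le g b v) (norm_nonneg _)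

theorem inner_synth (φ₁ φ₂ : SchwartzMap (Rm m) ℂ) :
    ⟪synth φ₂, synth φ₁⟫_ℂ = ∫ v, conj (φ₂ v) * φ₁ v := by
  rw [L2.inner_def]
  have h := integral_conj_fourier_mul φ₂.integrable (φ₂.memLp 2) φ₁.integrable (φ₁.memLp 2)
  rw [← h, ← integral_neg_eq_self fun x => conj (𝓕 (φ₂ : Rm m → ℂ) x) * 𝓕 (φ₁ : Rm m → ℂ) x]
  refine integral_congr_ae ?_
  filter_upwards [coeFn_synth φ₁, coeFn_synth φ₂] with t h1 h2
  rw [RCLike.inner_apply, h1, h2, fourierInv_eq_fourier_neg_fun, fourierInv_eq_fourier_neg_fun,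
    mul_comm]

/-- The coefficients of a translate with respect to a modulated function. -/
theorem inner_modL2_transL2_synth {g : L2 m} (hg : Integrable (g : Rm m → ℂ)) (b x : Rm m)
    (φ : SchwartzMap (Rm m) ℂ) :
    ⟪modL2 b g, transL2 (-x) (synth φ)⟫_ℂ = 𝓕⁻ (fiberFun φ g b) x := by
  -- The factors are arranged for the multiplication formula `∫ 𝓕 k · ψ = ∫ k · 𝓕 ψ`: the
  -- exponential in `ψ` encodes the translation by `x`, the one in `k` the modulation by `b`.
  let ψ : Rm m → ℂ := fun v => Complex.exp ((2 * Real.pi * ⟪v, x⟫_ℝ : ℝ) * Complex.I) * φ v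
  let k : Rm m → ℂ := fun t =>
    conj (g (-t)) * Complex.exp ((2 * Real.pi * ⟪b, t⟫_ℝ : ℝ) * Complex.I)
  have hψ : Integrable ψ := by
    refine φ.integrable.bdd_mul (c := 1) (by fun_prop) (Eventually.of_forall fun v => ?_)
    rw [Complex.norm_exp_ofReal_mul_I]
  have hk : Integrable k := by
    refine Integrable.mul_bdd (c := 1) ?_ (by fun_prop) (Eventually.of_forall fun v => ?_)
    · exact (Complex.conjLIE.integrable_comp_iff).2 hg.comp_neg
    · rw [Complex.norm_exp_ofReal_mul_I]
  have h1 : ∀ t, 𝓕⁻ (φ : Rm m → ℂ) (t + x) = 𝓕 ψ (-t) := fun t => by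
    rw [Real.fourierInv_eq', Real.fourier_eq']
    refine integral_congr_ae (Eventually.of_forall fun v => ?_)
    simp only [ψ, smul_eq_mul]
    rw [← mul_assoc, ← Complex.exp_add, inner_add_right, inner_neg_right]
    congr 2
    push_cast
    ring
  have h2 : ∀ v, 𝓕 k v = conj (𝓕 (g : Rm m → ℂ) (v - b)) := fun v => by
    rw [Real.fourier_eq', Real.fourier_eq', ← integral_conj, ← integral_neg_eq_self]
    refine integral_congr_ae (Eventually.of_forall fun t => ?_)
    simp only [k, smul_eq_mul, map_mul, ← Complex.exp_conj, neg_neg, Complex.conj_I, Complex.conj_ofReal]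
    rw [mul_comm, mul_assoc, ← Complex.exp_add, mul_comm, inner_neg_left, inner_neg_right,
      inner_sub_right, real_inner_comm b t]
    congr 2
    push_cast
    ring
  have h3 : ∫ t, 𝓕 k t • ψ t = ∫ t, k t • 𝓕 ψ t := by
    have := VectorFourier.integral_fourierIntegral_smul_eq_flip (L := innerₗ (Rm m))
      (μ := (volume : Measure (Rm m))) (ν := volume)
      Real.continuous_fourierChar continuous_inner hk hψ
    simpa using! this
  calc ⟪modL2 b g, transL2 (-x) (synth φ)⟫_ℂ = ∫ t, k (-t) • 𝓕 ψ (-t) := by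
        rw [L2.inner_def]
        refine integral_congr_ae ?_
        have h4 := (measurePreserving_sub_right volume (-x)).quasiMeasurePreserving.ae_eq_comp
          (coeFn_synth φ)
        filter_upwards [coeFn_transL2 (-x) (synth φ), h4, (memLp_modulate b g).coeFn_toLp]
          with t h5 h6 h7
        simp only [Function.comp_apply] at h6
        rw [RCLike.inner_apply, h5, h6, modL2, h7, sub_neg_eq_add, h1]
        simp only [k, modulate, neg_neg, smul_eq_mul, map_mul, ← Complex.exp_conj, inner_neg_right,
          Complex.conj_I, Complex.conj_ofReal, map_ofNat]
        rw [mul_comm]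
        congr 1
        rw [mul_comm]
        congr 2
        push_cast
        ring
    _ = ∫ t, k t • 𝓕 ψ t := integral_neg_eq_self (fun t => k t • 𝓕 ψ t) volume
    _ = ∫ t, 𝓕 k t • ψ t := h3.symm
    _ = 𝓕⁻ (fiberFun φ g b) x := by
        rw [Real.fourierInv_eq']
        refine integral_congr_ae (Eventually.of_forall fun v => ?_)
        simp only [h2, ψ, fiberFun, smul_eq_mul]
        ring

theorem lintegral_enorm_sq_fourierInv {f : Rm m → ℂ} (hf : Integrable f) (hf2 : MemLp f 2) :
    ∫⁻ x, ‖𝓕⁻ f x‖ₑ ^ 2 = ∫⁻ v, ‖f v‖ₑ ^ 2 := by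
  have key : ∀ F : Rm m → ℂ, ∫⁻ x, ‖F x‖ₑ ^ 2 = eLpNorm F 2 volume ^ 2 := fun F => by
    have h := eLpNorm_nnreal_pow_eq_lintegral (μ := volume) (f := F) (p := 2) (by norm_num)
    simpa using h.symm
  rw [fourierInv_eq_fourier_neg_fun, key f, ← eLpNorm_fourier hf hf2, ← key]
  exact lintegral_neg_eq_self (fun x => ‖𝓕 f x‖ₑ ^ 2)

/-- The exponential is absorbed into the second inverse transform as a shift by `ξ`; what remains is
Plancherel. -/
theorem integral_conj_fourierInv_mul_exp {f g : Rm m → ℂ} (hf : Integrable f) (hf2 : MemLp f 2)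
    (hg : Integrable g) (hg2 : MemLp g 2) (ξ : Rm m) :
    ∫ x, conj (𝓕⁻ f x) * 𝓕⁻ g x * Complex.exp ((-2 * Real.pi * ⟪x, ξ⟫_ℝ : ℝ) * Complex.I)
      = ∫ t, conj (f (t - ξ)) * g t := by
  have h1 : ∀ x, 𝓕⁻ g x * Complex.exp ((-2 * Real.pi * ⟪x, ξ⟫_ℝ : ℝ) * Complex.I)
      = 𝓕⁻ (fun v => g (v + ξ)) x := fun x => by
    rw [Real.fourierInv_eq', Real.fourierInv_eq', ← integral_mul_const]
    rw [← integral_add_right_eq_self _ ξ]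
    refine integral_congr_ae (Eventually.of_forall fun v => ?_)
    simp only [smul_eq_mul]
    rw [mul_right_comm, ← Complex.exp_add, inner_add_left, real_inner_comm x ξ]
    congr 2
    push_cast
    ring
  have hg' : Integrable fun v => g (v + ξ) := hg.comp_add_right ξ
  have hg2' : MemLp (fun v => g (v + ξ)) 2 :=
    hg2.comp_measurePreserving (measurePreserving_add_right volume ξ)
  simp_rw [fun x => mul_assoc (conj (𝓕⁻ f x)) (𝓕⁻ g x), h1]
  calc _ = ∫ x, conj (𝓕 f x) * 𝓕 (fun v => g (v + ξ)) x := by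
        rw [← integral_neg_eq_self, fourierInv_eq_fourier_neg_fun, fourierInv_eq_fourier_neg_fun]
        simp
    _ = ∫ v, conj (f v) * g (v + ξ) := integral_conj_fourier_mul hf hf2 hg' hg2'
    _ = _ := by
        rw [← integral_sub_right_eq_self _ ξ]
        simp

end FiberFunctions

/-- A smooth compactly supported real function as a complex valued Schwartz function. -/
noncomputable def realSchwartz {m : ℕ} {g : Rm m → ℝ} (hg : ContDiff ℝ ((⊤ : ℕ∞) : WithTop ℕ∞) g) (hgs : HasCompactSupport g) :
    SchwartzMap (Rm m) ℂ :=
  HasCompactSupport.toSchwartzMap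
    (f := fun x => (g x : ℂ)) (hgs.comp_left (g := fun t : ℝ => (t : ℂ)) (by simp))
    (Complex.ofRealCLM.contDiff.comp hg)

theorem realSchwartz_apply {m : ℕ} {g : Rm m → ℝ} (hg : ContDiff ℝ ((⊤ : ℕ∞) : WithTop ℕ∞) g) (hgs : HasCompactSupport g)
    (x : Rm m) : realSchwartz hg hgs x = g x := rfl

theorem exists_schwartz_eq_one (m : ℕ) (R : ℝ) :
    ∃ φ : SchwartzMap (Rm m) ℂ, ∀ v, ‖v‖ ≤ R → φ v = 1 := by
  let f : ContDiffBump (0 : Rm m) := ⟨|R| + 1, |R| + 2, by positivity, by linarith⟩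
  refine ⟨realSchwartz f.contDiff f.hasCompactSupport, fun v hv => ?_⟩
  rw [realSchwartz_apply, f.one_of_mem_closedBall, Complex.ofReal_one]
  rw [mem_closedBall_zero_iff]
  exact hv.trans ((le_abs_self R).trans (by simp [f]))

/-! ### The symbol series -/

section Symbol

variable {m : ℕ} {J : Type*} [Countable J] {G H : J → L2 m} {b : J → Rm m}
  {Γ : Submodule ℤ (Rm m × ℝ)} [DiscreteTopology Γ] [IsZLattice ℝ Γ]

/-- The modulated family `M_{b j} G_j`. -/
noncomputable def modFamily (G : J → L2 m) (b : J → Rm m) (j : J) : L2 m := modL2 (b j) (G j)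

/-- The sum over the family of the products of the Fourier transforms on the fibre `t`, `t - ξ`. -/
noncomputable def symbolSum (G H : J → L2 m) (b : J → Rm m) (ξ t : Rm m) : ℂ :=
  ∑' j, conj (𝓕 (G j : Rm m → ℂ) (t - b j)) * 𝓕 (H j : Rm m → ℂ) (t - b j - ξ)

/-- Plancherel for each `j` carries the energy bound to the frequency side. -/
theorem tsum_lintegral_fiberFun (hG : ∀ j, Integrable (G j : Rm m → ℂ)) (φ : SchwartzMap (Rm m) ℂ) :
    ∑' j, ∫⁻ v, ‖fiberFun φ (G j) (b j) v‖ₑ ^ 2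
      = ∫⁻ x, energy (modFamily G b) (transL2 (-x) (synth φ)) := by
  simp_rw [energy]
  rw [lintegral_tsum fun j => ((continuous_inner_transL2 _ _).enorm.measurable.pow_const 2).aemeasurable]
  refine tsum_congr fun j => ?_
  rw [← lintegral_enorm_sq_fourierInv (integrable_fiberFun φ (hG j) _) (memLp_fiberFun φ (hG j) _)]
  simp_rw [modFamily, inner_modL2_transL2_synth (hG j)]

/-- A test function equal to `1` on the ball of radius `n` turns the finite energy into finiteness
almost everywhere on that ball; then `n` runs through the naturals. -/
theorem ae_tsum_enorm_sq_fiber_ne_top (hΓ : ProjectionsInjectiveDense Γ)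
    (hG : ∀ j, Integrable (G j : Rm m → ℂ)) {a : ℝ} (ha : 0 < a)
    (hu : IsBessel (modelSystem (modFamily G b) (modelSet Γ (Set.Icc (-a) a)))) :
    ∀ᵐ t : Rm m, ∑' j, ‖𝓕 (G j : Rm m → ℂ) (t - b j)‖ₑ ^ 2 ≠ ∞ := by
  have h : ∀ n : ℕ, ∀ᵐ t : Rm m, ‖t‖ ≤ n → ∑' j, ‖𝓕 (G j : Rm m → ℂ) (t - b j)‖ₑ ^ 2 ≠ ∞ := by
    intro n
    obtain ⟨φ, hφ⟩ := exists_schwartz_eq_one m n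
    have h1 := lintegral_energy_ne_top hΓ ha hu (synth φ)
    have hm : ∀ j, Measurable fun v => ‖fiberFun φ (G j) (b j) v‖ₑ ^ 2 := fun j =>
      ((φ.continuous.mul (continuous_fiber (hG j) (b j))).enorm.measurable.pow_const 2)
    rw [← tsum_lintegral_fiberFun hG, ← lintegral_tsum fun j => (hm j).aemeasurable] at h1
    filter_upwards [ae_lt_top (Measurable.tsum hm) h1] with t ht hn
    refine ne_of_eq_of_ne (tsum_congr fun j => ?_) ht.ne
    rw [fiberFun, hφ t hn, one_mul, RCLike.enorm_conj]
  filter_upwards [ae_all_iff.2 h] with t ht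
  obtain ⟨n, hn⟩ := exists_nat_ge ‖t‖
  exact ht n hn

/-- The series of the symbol converges absolutely almost everywhere. -/
theorem ae_summable_symbol (hΓ : ProjectionsInjectiveDense Γ)
    (hG : ∀ j, Integrable (G j : Rm m → ℂ)) (hH : ∀ j, Integrable (H j : Rm m → ℂ))
    {a : ℝ} (ha : 0 < a)
    (hu : IsBessel (modelSystem (modFamily G b) (modelSet Γ (Set.Icc (-a) a))))
    (hv : IsBessel (modelSystem (modFamily H b) (modelSet Γ (Set.Icc (-a) a)))) (ξ : Rm m) :
    ∀ᵐ t : Rm m, Summable fun j =>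
      conj (𝓕 (G j : Rm m → ℂ) (t - b j)) * 𝓕 (H j : Rm m → ℂ) (t - b j - ξ) := by
  have h2 := (measurePreserving_sub_right volume ξ).quasiMeasurePreserving.ae
    (ae_tsum_enorm_sq_fiber_ne_top hΓ hH ha hv)
  filter_upwards [ae_tsum_enorm_sq_fiber_ne_top hΓ hG ha hu, h2] with t h3 h4
  refine Summable.of_norm (tsum_enorm_ne_top_iff_summable_norm.1 ?_)
  refine ne_top_of_le_ne_top (ENNReal.add_ne_top.2 ⟨h3, h4⟩) ?_
  rw [← ENNReal.tsum_add]
  refine ENNReal.tsum_le_tsum fun j => ?_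
  rw [enorm_mul, RCLike.enorm_conj, sub_right_comm]
  exact mul_le_sq_add_sq_ennreal _ _

theorem tsum_lintegral_fiber_mul_ne_top (hΓ : ProjectionsInjectiveDense Γ)
    (hG : ∀ j, Integrable (G j : Rm m → ℂ)) (hH : ∀ j, Integrable (H j : Rm m → ℂ))
    {a : ℝ} (ha : 0 < a)
    (hu : IsBessel (modelSystem (modFamily G b) (modelSet Γ (Set.Icc (-a) a))))
    (hv : IsBessel (modelSystem (modFamily H b) (modelSet Γ (Set.Icc (-a) a))))
    (φ₁ φ₂ : SchwartzMap (Rm m) ℂ) (ξ : Rm m) :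
    ∑' j, ∫⁻ t, ‖conj (fiberFun φ₂ (H j) (b j) (t - ξ)) * fiberFun φ₁ (G j) (b j) t‖ₑ ≠ ∞ := by
  have h1 := lintegral_energy_ne_top hΓ ha hu (synth φ₁)
  have h2 := lintegral_energy_ne_top hΓ ha hv (synth φ₂)
  rw [← tsum_lintegral_fiberFun hG] at h1
  rw [← tsum_lintegral_fiberFun hH] at h2
  refine ne_top_of_le_ne_top (ENNReal.add_ne_top.2 ⟨h2, h1⟩) ?_
  rw [← ENNReal.tsum_add]
  refine ENNReal.tsum_le_tsum fun j => ?_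
  rw [← lintegral_sub_right_eq_self (fun v => ‖fiberFun φ₂ (H j) (b j) v‖ₑ ^ 2) ξ]
  rw [← lintegral_add_right]
  · refine lintegral_mono fun t => ?_
    rw [enorm_mul, RCLike.enorm_conj]
    exact mul_le_sq_add_sq_ennreal _ _
  · exact ((φ₁.continuous.mul (continuous_fiber (hG j) (b j))).enorm.measurable.pow_const 2)

theorem conj_fiberFun_mul_fiberFun (φ₁ φ₂ : SchwartzMap (Rm m) ℂ) (ξ t : Rm m) (j : J) :
    conj (fiberFun φ₂ (H j) (b j) (t - ξ)) * fiberFun φ₁ (G j) (b j) t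
      = φ₁ t * conj (φ₂ (t - ξ)) *
        (conj (𝓕 (G j : Rm m → ℂ) (t - b j)) * 𝓕 (H j : Rm m → ℂ) (t - b j - ξ)) := by
  simp only [fiberFun, map_mul, Complex.conj_conj]
  rw [sub_right_comm]
  ring

theorem aestronglyMeasurable_fiber_mul (hG : ∀ j, Integrable (G j : Rm m → ℂ))
    (hH : ∀ j, Integrable (H j : Rm m → ℂ)) (φ₁ φ₂ : SchwartzMap (Rm m) ℂ) (ξ : Rm m) (j : J) :
    AEStronglyMeasurable
      (fun t => conj (fiberFun φ₂ (H j) (b j) (t - ξ)) * fiberFun φ₁ (G j) (b j) t) volume := by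
  have h1 : Continuous (fiberFun φ₁ (G j) (b j)) := φ₁.continuous.mul (continuous_fiber (hG j) (b j))
  have h2 : Continuous (fiberFun φ₂ (H j) (b j)) := φ₂.continuous.mul (continuous_fiber (hH j) (b j))
  exact ((Complex.continuous_conj.comp (h2.comp (continuous_id.sub continuous_const))).mul
    h1).aestronglyMeasurable

theorem integrable_mul_symbolSum (hΓ : ProjectionsInjectiveDense Γ)
    (hG : ∀ j, Integrable (G j : Rm m → ℂ)) (hH : ∀ j, Integrable (H j : Rm m → ℂ))
    {a : ℝ} (ha : 0 < a)
    (hu : IsBessel (modelSystem (modFamily G b) (modelSet Γ (Set.Icc (-a) a))))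
    (hv : IsBessel (modelSystem (modFamily H b) (modelSet Γ (Set.Icc (-a) a))))
    (φ₁ φ₂ : SchwartzMap (Rm m) ℂ) (ξ : Rm m) :
    Integrable fun t => φ₁ t * conj (φ₂ (t - ξ)) * symbolSum G H b ξ t := by
  have h := integrable_tsum (aestronglyMeasurable_fiber_mul hG hH φ₁ φ₂ ξ)
    (tsum_lintegral_fiber_mul_ne_top hΓ hG hH ha hu hv φ₁ φ₂ ξ)
  refine h.congr (Eventually.of_forall fun t => ?_)
  simp only [conj_fiberFun_mul_fiberFun, tsum_mul_left, symbolSum]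

/-- The Fourier transform of the mixed coefficient sum. -/
theorem integral_mixedSum_mul_exp (hΓ : ProjectionsInjectiveDense Γ)
    (hG : ∀ j, Integrable (G j : Rm m → ℂ)) (hH : ∀ j, Integrable (H j : Rm m → ℂ))
    {a : ℝ} (ha : 0 < a)
    (hu : IsBessel (modelSystem (modFamily G b) (modelSet Γ (Set.Icc (-a) a))))
    (hv : IsBessel (modelSystem (modFamily H b) (modelSet Γ (Set.Icc (-a) a))))
    (φ₁ φ₂ : SchwartzMap (Rm m) ℂ) (ξ : Rm m) :
    ∫ x, mixedSum (modFamily G b) (modFamily H b) (synth φ₁) (synth φ₂) x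
        * Complex.exp ((-2 * Real.pi * ⟪x, ξ⟫_ℝ : ℝ) * Complex.I)
      = ∫ t, φ₁ t * conj (φ₂ (t - ξ)) * symbolSum G H b ξ t := by
  have hA : ∀ j, ∀ x, ⟪modFamily G b j, transL2 (-x) (synth φ₁)⟫_ℂ = 𝓕⁻ (fiberFun φ₁ (G j) (b j)) x :=
    fun j x => inner_modL2_transL2_synth (hG j) _ _ _
  have hB : ∀ j, ∀ x, ⟪transL2 (-x) (synth φ₂), modFamily H b j⟫_ℂ
      = conj (𝓕⁻ (fiberFun φ₂ (H j) (b j)) x) := fun j x => by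
    rw [← inner_conj_symm, modFamily, inner_modL2_transL2_synth (hH j)]
  have hterm : ∀ j, ∫ x, ⟪transL2 (-x) (synth φ₂), modFamily H b j⟫_ℂ
        * ⟪modFamily G b j, transL2 (-x) (synth φ₁)⟫_ℂ
        * Complex.exp ((-2 * Real.pi * ⟪x, ξ⟫_ℝ : ℝ) * Complex.I)
      = ∫ t, conj (fiberFun φ₂ (H j) (b j) (t - ξ)) * fiberFun φ₁ (G j) (b j) t := fun j => by
    simp_rw [hA, hB]
    exact integral_conj_fourierInv_mul_exp (integrable_fiberFun _ (hH j) _) (memLp_fiberFun _ (hH j) _)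
      (integrable_fiberFun _ (hG j) _) (memLp_fiberFun _ (hG j) _) ξ
  have hcont : ∀ j, Continuous fun x => ⟪transL2 (-x) (synth φ₂), modFamily H b j⟫_ℂ
        * ⟪modFamily G b j, transL2 (-x) (synth φ₁)⟫_ℂ
        * Complex.exp ((-2 * Real.pi * ⟪x, ξ⟫_ℝ : ℝ) * Complex.I) := fun j => by
    refine Continuous.mul (Continuous.mul ?_ (continuous_inner_transL2 _ _)) (by fun_prop)
    simp_rw [← inner_conj_symm (transL2 _ (synth φ₂))]
    exact Complex.continuous_conj.comp (continuous_inner_transL2 _ _)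
  -- The two energies dominate the mixed terms, so the sum over `j` may leave the integral; term by
  -- term it then becomes an integral over the frequencies.
  have hfin : ∑' j, ∫⁻ x, ‖⟪transL2 (-x) (synth φ₂), modFamily H b j⟫_ℂ
        * ⟪modFamily G b j, transL2 (-x) (synth φ₁)⟫_ℂ
        * Complex.exp ((-2 * Real.pi * ⟪x, ξ⟫_ℝ : ℝ) * Complex.I)‖ₑ ≠ ∞ := by
    rw [← lintegral_tsum fun j => (hcont j).enorm.measurable.aemeasurable]
    have h1 := lintegral_energy_ne_top hΓ ha hu (synth φ₁)
    have h2 := lintegral_energy_ne_top hΓ ha hv (synth φ₂)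
    refine ne_top_of_le_ne_top (ENNReal.add_ne_top.2 ⟨h1, h2⟩) ?_
    rw [← lintegral_add_left (measurable_energy_transL2 _ _)]
    refine lintegral_mono fun x => ?_
    refine le_trans (le_of_eq (tsum_congr fun j => ?_)) (tsum_enorm_mixed_le _ _ _ _ x)
    rw [enorm_mul _ (Complex.exp _), ← ofReal_norm (Complex.exp _), Complex.norm_exp_ofReal_mul_I,
      ENNReal.ofReal_one, mul_one]
  simp_rw [mixedSum, ← tsum_mul_right]
  rw [integral_tsum (fun j => (hcont j).aestronglyMeasurable) hfin]
  simp_rw [hterm]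
  rw [← integral_tsum (aestronglyMeasurable_fiber_mul hG hH φ₁ φ₂ ξ)
    (tsum_lintegral_fiber_mul_ne_top hΓ hG hH ha hu hv φ₁ φ₂ ξ)]
  simp only [conj_fiberFun_mul_fiberFun, tsum_mul_left, symbolSum]

theorem locallyIntegrable_symbolSum (hΓ : ProjectionsInjectiveDense Γ)
    (hG : ∀ j, Integrable (G j : Rm m → ℂ)) (hH : ∀ j, Integrable (H j : Rm m → ℂ))
    {a : ℝ} (ha : 0 < a)
    (hu : IsBessel (modelSystem (modFamily G b) (modelSet Γ (Set.Icc (-a) a))))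
    (hv : IsBessel (modelSystem (modFamily H b) (modelSet Γ (Set.Icc (-a) a)))) (ξ : Rm m) :
    LocallyIntegrable (symbolSum G H b ξ) := by
  intro x
  refine ⟨Metric.closedBall x 1, Metric.closedBall_mem_nhds x one_pos, ?_⟩
  obtain ⟨φ₁, h₁⟩ := exists_schwartz_eq_one m (‖x‖ + 1)
  obtain ⟨φ₂, h₂⟩ := exists_schwartz_eq_one m (‖x‖ + 1 + ‖ξ‖)
  have h := (integrable_mul_symbolSum hΓ hG hH ha hu hv φ₁ φ₂ ξ).integrableOn (s := Metric.closedBall x 1)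
  refine h.congr_fun (fun t ht => ?_) measurableSet_closedBall
  have ht1 : ‖t‖ ≤ ‖x‖ + 1 := by
    rw [mem_closedBall_iff_norm'] at ht
    have := norm_sub_le x (x - t)
    rw [sub_sub_cancel] at this
    linarith
  have ht2 : ‖t - ξ‖ ≤ ‖x‖ + 1 + ‖ξ‖ := (norm_sub_le _ _).trans (by linarith)
  simp only [h₁ t ht1, h₂ _ ht2, map_one, one_mul]

end Symbol

/-! ### Integral functionals and the dual lattice -/

section DualLattice

variable {m : ℕ} {Γ : Submodule ℤ (Rm m × ℝ)}

/-- The linear functional `z ↦ z · η`. -/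
noncomputable def dotFunctional (η : Rm m × ℝ) : (Rm m × ℝ) →L[ℝ] ℝ :=
  (innerSL ℝ η.1).comp (ContinuousLinearMap.fst ℝ (Rm m) ℝ)
    + η.2 • ContinuousLinearMap.snd ℝ (Rm m) ℝ

theorem dotFunctional_apply (η z : Rm m × ℝ) :
    dotFunctional η z = ⟪z.1, η.1⟫_ℝ + z.2 * η.2 := by
  simp [dotFunctional, real_inner_comm, mul_comm]

theorem isIntegral_dotFunctional {η : Rm m × ℝ} : IsIntegral Γ (dotFunctional η) ↔ η ∈ dualLattice Γ := by
  simp only [IsIntegral, dotFunctional_apply, dualLattice, Set.mem_ofPred_eq]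

theorem dotFunctional_eq_zero {η : Rm m × ℝ} : dotFunctional η = 0 ↔ η = 0 := by
  constructor
  · intro h
    have h1 := congrArg (fun l : (Rm m × ℝ) →L[ℝ] ℝ => l (η.1, 0)) h
    have h2 := congrArg (fun l : (Rm m × ℝ) →L[ℝ] ℝ => l (0, 1)) h
    simp only [dotFunctional_apply] at h1 h2
    exact Prod.ext (by simpa using h1) (by simpa using h2)
  · rintro rfl
    ext <;> simp [dotFunctional_apply]

theorem exists_dotFunctional_eq (l : (Rm m × ℝ) →L[ℝ] ℝ) : ∃ η, dotFunctional η = l := by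
  refine ⟨((InnerProductSpace.toDual ℝ (Rm m)).symm (l.comp (ContinuousLinearMap.inl ℝ (Rm m) ℝ)),
    l (0, 1)), ContinuousLinearMap.ext fun z => ?_⟩
  rw [dotFunctional_apply, real_inner_comm, InnerProductSpace.toDual_symm_apply]
  have : z = (z.1, 0) + z.2 • ((0, 1) : Rm m × ℝ) := by ext1 <;> simp
  conv_rhs => rw [this, map_add, map_smul]
  simp

theorem ae_periodization_eq_const_iff_dualLattice [DiscreteTopology Γ] [IsZLattice ℝ Γ]
    {F : Rm m × ℝ → ℂ} (hF : Integrable F) (κ : ℂ) :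
    (∀ᵐ z, ∑' γ : Γ, F (γ + z) = κ) ↔ ∀ η ∈ dualLattice Γ,
      ∫ z, F z * linChar (dotFunctional η) z = delta η * (κ * volume.real (latticeDomain Γ)) := by
  have h0 : ∀ z : Rm m × ℝ, linChar (dotFunctional (0 : Rm m × ℝ)) z = 1 := fun z => by
    simp [linChar, dotFunctional_eq_zero.2 rfl]
  rw [ae_periodization_eq_const_iff hF]
  constructor
  · rintro ⟨h1, h2⟩ η hη
    by_cases h : η = 0
    · subst h
      simp_rw [h0, mul_one, delta, if_true, one_mul, h1]
    · rw [h2 _ (isIntegral_dotFunctional.2 hη) (mt dotFunctional_eq_zero.1 h), delta, if_neg h,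
        zero_mul]
  · intro h
    refine ⟨?_, fun l hl hl0 => ?_⟩
    · have := h 0 (fun γ _ => ⟨0, by simp⟩)
      simpa [h0, delta] using this
    · obtain ⟨η, rfl⟩ := exists_dotFunctional_eq l
      rw [h η (isIntegral_dotFunctional.1 hl), delta, if_neg (mt dotFunctional_eq_zero.2 hl0), zero_mul]

end DualLattice

/-! ### The characterization of duality -/

section Characterization

variable {m : ℕ} {J : Type*} [Countable J] {G H : J → L2 m} {b : J → Rm m}
  {Γ : Submodule ℤ (Rm m × ℝ)} [DiscreteTopology Γ] [IsZLattice ℝ Γ]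

/-- Both the tensor and the character split into factors in `x` and `y`, so Fubini gives a product
of two Fourier transforms. -/
theorem integral_windowTensor_mul_linChar (hΓ : ProjectionsInjectiveDense Γ)
    (hG : ∀ j, Integrable (G j : Rm m → ℂ)) (hH : ∀ j, Integrable (H j : Rm m → ℂ))
    {a : ℝ} (ha : 0 < a)
    (hu : IsBessel (modelSystem (modFamily G b) (modelSet Γ (Set.Icc (-a) a))))
    (hv : IsBessel (modelSystem (modFamily H b) (modelSet Γ (Set.Icc (-a) a))))
    (φ₁ φ₂ : SchwartzMap (Rm m) ℂ) (η : Rm m × ℝ) :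
    ∫ z, windowTensor (modFamily G b) (modFamily H b) a (synth φ₁) (synth φ₂) z
        * linChar (dotFunctional η) z
      = (∫ t, φ₁ t * conj (φ₂ (t - η.1)) * symbolSum G H b η.1 t)
        * ((2 * a) * Real.sinc (Real.pi * (η.2 * (2 * a))) : ℝ) := by
  rw [← integral_mixedSum_mul_exp hΓ hG hH ha hu hv]
  have h2 : (((2 * a) * Real.sinc (Real.pi * (η.2 * (2 * a))) : ℝ) : ℂ)
      = ∫ y : ℝ, (Set.Icc (-a) a).indicator 1 y
        * Complex.exp ((-2 * Real.pi * (y * η.2) : ℝ) * Complex.I) := by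
    rw [Complex.ofReal_mul, Complex.ofReal_mul, Complex.ofReal_ofNat, ← integral_exp_window ha.le, ← integral_indicator measurableSet_Icc]
    refine integral_congr_ae (Eventually.of_forall fun y => ?_)
    by_cases hy : y ∈ Set.Icc (-a) a
    · simp only [Set.indicator_of_mem hy, Pi.one_apply, one_mul]
    · simp only [Set.indicator_of_notMem hy, zero_mul]
  rw [h2, Measure.volume_eq_prod, ← integral_prod_mul]
  refine integral_congr_ae (Eventually.of_forall fun z => ?_)
  have h3 : linChar (dotFunctional η) z
      = Complex.exp ((-2 * Real.pi * ⟪z.1, η.1⟫_ℝ : ℝ) * Complex.I)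
        * Complex.exp ((-2 * Real.pi * (z.2 * η.2) : ℝ) * Complex.I) := by
    rw [linChar, dotFunctional_apply, ← Complex.exp_add]
    congr 1
    push_cast
    ring
  simp only [windowTensor, h3]
  ring

/-- The symbol is almost everywhere constant if and only if its integrals against all test
functions are those of a constant. -/
theorem forall_integral_symbolSum_iff (hΓ : ProjectionsInjectiveDense Γ)
    (hG : ∀ j, Integrable (G j : Rm m → ℂ)) (hH : ∀ j, Integrable (H j : Rm m → ℂ))
    {a : ℝ} (ha : 0 < a)
    (hu : IsBessel (modelSystem (modFamily G b) (modelSet Γ (Set.Icc (-a) a))))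
    (hv : IsBessel (modelSystem (modFamily H b) (modelSet Γ (Set.Icc (-a) a))))
    (ξ : Rm m) (c d : ℂ) (hd : d = 0 ∨ ξ = 0) :
    (∀ φ₁ φ₂ : SchwartzMap (Rm m) ℂ,
      c * ∫ t, φ₁ t * conj (φ₂ (t - ξ)) * symbolSum G H b ξ t = d * ∫ t, conj (φ₂ t) * φ₁ t) ↔
      ∀ᵐ t : Rm m, c * symbolSum G H b ξ t = d := by
  -- The right-hand side carries no shift by `ξ`. By `hd` this is harmless: either it vanishes, or
  -- there is no shift.
  have hR : ∀ φ₁ φ₂ : SchwartzMap (Rm m) ℂ,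
      d * ∫ t, conj (φ₂ t) * φ₁ t = ∫ t, φ₁ t * conj (φ₂ (t - ξ)) * d := fun φ₁ φ₂ => by
    rcases hd with rfl | rfl
    · simp
    · rw [← integral_const_mul]
      refine integral_congr_ae (Eventually.of_forall fun t => ?_)
      simp only [sub_zero]
      ring
  simp_rw [hR, ← integral_const_mul]
  constructor
  · intro h
    have hloc : LocallyIntegrable fun t => c * symbolSum G H b ξ t - d :=
      ((locallyIntegrable_symbolSum hΓ hG hH ha hu hv ξ).smul c).sub (locallyIntegrable_const d)
    have h0 := ae_eq_zero_of_integral_contDiff_smul_eq_zero hloc fun g hg hgs => by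
      obtain ⟨R, hR⟩ := hgs.isCompact.isBounded.exists_norm_le
      -- With `φ₂ = 1` on the support of `g` shifted by `ξ`, the product of the two test functions
      -- is just `g`.
      obtain ⟨φ₂, h₂⟩ := exists_schwartz_eq_one m (R + ‖ξ‖)
      have h1 := h (realSchwartz hg hgs) φ₂
      have hi1 := (integrable_mul_symbolSum hΓ hG hH ha hu hv (realSchwartz hg hgs) φ₂ ξ).const_mul c
      have hone : ∀ t, realSchwartz hg hgs t * conj (φ₂ (t - ξ)) = g t := fun t => by
        rw [realSchwartz_apply]
        by_cases ht : t ∈ tsupport g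
        · rw [h₂ _ ((norm_sub_le _ _).trans (by linarith [hR t ht])), map_one, mul_one]
        · rw [image_eq_zero_of_notMem_tsupport ht, Complex.ofReal_zero, zero_mul]
      simp_rw [hone] at h1 hi1
      have hi2 : Integrable fun t => (g t : ℂ) * d :=
        ((realSchwartz hg hgs).integrable (μ := volume)).mul_const d
      rw [← sub_eq_zero, ← integral_sub hi1 hi2] at h1
      rw [← h1]
      refine integral_congr_ae (Eventually.of_forall fun t => ?_)
      simp only [Complex.real_smul]
      ring
    filter_upwards [h0] with t ht
    exact sub_eq_zero.1 ht
  · intro h φ₁ φ₂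
    refine integral_congr_ae ?_
    filter_upwards [h] with t ht
    rw [← ht]
    ring

/-- Duality of the systems over a model set in terms of the Fourier coefficients of the
periodizations. -/
theorem isDualSystem_modelSystem_iff (hΓ : ProjectionsInjectiveDense Γ) {u v : J → L2 m} {a : ℝ}
    (ha : 0 < a) (hgen : IsGeneric Γ (Set.Icc (-a) a))
    (hu : IsBessel (modelSystem u (modelSet Γ (Set.Icc (-a) a))))
    (hv : IsBessel (modelSystem v (modelSet Γ (Set.Icc (-a) a)))) :
    IsDualSystem (modelSystem v (modelSet Γ (Set.Icc (-a) a)))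
        (modelSystem u (modelSet Γ (Set.Icc (-a) a))) ↔
      ∀ φ₁ φ₂ : SchwartzMap (Rm m) ℂ, ∀ η ∈ dualLattice Γ,
        ∫ z, windowTensor u v a (synth φ₁) (synth φ₂) z * linChar (dotFunctional η) z
          = delta η * (⟪synth φ₂, synth φ₁⟫_ℂ * volume.real (latticeDomain Γ)) := by
  have key : ∀ f₁ f₂ : L2 m,
      (∀ x : Rm m, ∑' i, ⟪transL2 (-x) f₂, modelSystem v (modelSet Γ (Set.Icc (-a) a)) i⟫_ℂ
        * ⟪modelSystem u (modelSet Γ (Set.Icc (-a) a)) i, transL2 (-x) f₁⟫_ℂ = ⟪f₂, f₁⟫_ℂ) ↔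
      ∀ η ∈ dualLattice Γ, ∫ z, windowTensor u v a f₁ f₂ z * linChar (dotFunctional η) z
          = delta η * (⟪f₂, f₁⟫_ℂ * volume.real (latticeDomain Γ)) := fun f₁ f₂ => by
    rw [← ae_periodization_eq_const_iff_dualLattice (integrable_windowTensor hΓ ha hu hv f₁ f₂),
      ← forall_tsum_windowTensor_zero_eq_iff hΓ ha hgen hu hv]
    simp_rw [tsum_windowTensor_zero hΓ hu hv]
  -- Translations are isometries, so duality gives the value `⟪f₂, f₁⟫` at every `x`. Conversely, `x
  -- = 0` and a dense set of functions suffice.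
  constructor
  · intro h φ₁ φ₂
    refine (key _ _).1 fun x => ?_
    rw [(isDualSystem_iff hu hv dense_univ).1 h _ trivial _ trivial, LinearIsometry.inner_map_map]
  · intro h
    refine (isDualSystem_iff hu hv dense_range_synth).2 ?_
    rintro _ ⟨φ₁, rfl⟩ _ ⟨φ₂, rfl⟩
    simpa [transL2_zero] using (key _ _).2 (h φ₁ φ₂) 0

/-- Dividing the coefficient identity by the covolume produces the density as a factor. The
quantifiers over test functions and over `η` are then exchanged, and for each `η` the test functions
recover the identity for almost every `t`. -/
theorem isDualSystem_modFamily_iff (hΓ : ProjectionsInjectiveDense Γ)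
    (hG : ∀ j, Integrable (G j : Rm m → ℂ)) (hH : ∀ j, Integrable (H j : Rm m → ℂ))
    {a : ℝ} (ha : 0 < a) (hgen : IsGeneric Γ (Set.Icc (-a) a))
    (hu : IsBessel (modelSystem (modFamily G b) (modelSet Γ (Set.Icc (-a) a))))
    (hv : IsBessel (modelSystem (modFamily H b) (modelSet Γ (Set.Icc (-a) a)))) :
    IsDualSystem (modelSystem (modFamily H b) (modelSet Γ (Set.Icc (-a) a)))
        (modelSystem (modFamily G b) (modelSet Γ (Set.Icc (-a) a))) ↔
      ∀ η ∈ dualLattice Γ, ∀ᵐ t : Rm m,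
        ((2 * a) / volume.real (latticeDomain Γ) * Real.sinc (Real.pi * (η.2 * (2 * a))) : ℝ)
          * symbolSum G H b η.1 t = delta η := by
  rw [isDualSystem_modelSystem_iff hΓ ha hgen hu hv]
  have hvol : ((volume.real (latticeDomain Γ) : ℝ) : ℂ) ≠ 0 := by
    have := measure_latticeDomain_ne_zero Γ (volume : Measure (Rm m × ℝ))
    exact Complex.ofReal_ne_zero.2
      (ENNReal.toReal_pos this (measure_latticeDomain_ne_top Γ _)).ne'
  have hd : ∀ η : Rm m × ℝ, delta η = 0 ∨ η.1 = 0 := fun η => by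
    by_cases h : η = 0
    · exact Or.inr (by rw [h]; rfl)
    · exact Or.inl (if_neg h)
  simp_rw [fun η : Rm m × ℝ => (forall_integral_symbolSum_iff hΓ hG hH ha hu hv η.1
    (((2 * a) / volume.real (latticeDomain Γ) * Real.sinc (Real.pi * (η.2 * (2 * a))) : ℝ))
    (delta η) (hd η)).symm, integral_windowTensor_mul_linChar hΓ hG hH ha hu hv, inner_synth]
  have e : ∀ (φ₁ φ₂ : SchwartzMap (Rm m) ℂ) (η : Rm m × ℝ) (I : ℂ),
      (I * ((2 * a) * Real.sinc (Real.pi * (η.2 * (2 * a))) : ℝ)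
        = delta η * ((∫ v, conj (φ₂ v) * φ₁ v) * volume.real (latticeDomain Γ))) ↔
      ((2 * a) / volume.real (latticeDomain Γ) * Real.sinc (Real.pi * (η.2 * (2 * a))) : ℝ) * I
        = delta η * ∫ v, conj (φ₂ v) * φ₁ v := fun φ₁ φ₂ η I => by
    push_cast
    rw [← mul_assoc (delta η), ← div_eq_iff hvol]
    refine Eq.congr_left ?_
    field_simp
  simp_rw [e]
  exact ⟨fun h η hη φ₁ φ₂ => h φ₁ φ₂ η hη, fun h φ₁ φ₂ η hη => h η hη φ₁ φ₂⟩

end Characterization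

/-- A discrete subspace of a separable metric space is countable. Countability of the index set is
what the exchanges of sums and integrals use. -/
theorem IsUniformlyDiscrete.countable {m : ℕ} {Δ : Set (Rm m)} (hΔ : IsUniformlyDiscrete Δ) :
    Δ.Countable := by
  obtain ⟨r, hr, h⟩ := hΔ
  have : DiscreteTopology Δ := DiscreteTopology.of_forall_le_dist hr fun x y hxy =>
    h x x.2 y y.2 (fun h => hxy (Subtype.ext h))
  exact Set.countable_coe_iff.1 (TopologicalSpace.separableSpace_iff_countable.1 inferInstance)

end ModelSetGabor

/-! ### The main theorem -/

theorem corollary5p3 {m L : ℕ}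
    -- the lattice and its projections
    (Γ : Submodule ℤ (Rm m × ℝ)) [DiscreteTopology Γ] [IsZLattice ℝ Γ]
    (hΓ : ProjectionsInjectiveDense Γ)
    -- the window, symmetric around the origin; the simple model set is generic
    (Ω : Set ℝ) (hΩ : IsSimpleWindow Ω) (hsymm : ∀ x ∈ Ω, -x ∈ Ω) (hgen : IsGeneric Γ Ω)
    -- the parameter in the construction of `Φ`
    (ε : ℝ) (hε : 0 < ε) (hε' : ε < 1)
    (Δ : Set (Rm m)) (hΔ : IsRelativelyDense Δ) (hΔ' : IsUniformlyDiscrete Δ)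
    (g h : Fin L → L2 m) (hg : ∀ l, MemWiener (g l)) (hh : ∀ l, MemWiener (h l))
    (hgB : IsBessel (gaborSystem g (modelSet Γ Ω) Δ))
    (hhB : IsBessel (gaborSystem h (modelSet Γ Ω) Δ)) :
    -- the limits that define the density and `Ψ` exist, the convolution `Ψ * Ψ` and the series
    -- below converge absolutely
    HasDensity (modelSet Γ Ω) (density (modelSet Γ Ω)) ∧
    TendstoUniformly (psiHat ε Ω) (Psi ε Ω) atTop ∧
    (∀ t : ℝ, Integrable (fun x : ℝ => Psi ε Ω x * Psi ε Ω (t - x))) ∧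
    (∀ η ∈ dualLattice Γ, ∀ l, ∀ᵐ t : Rm m, Summable (fun β : Δ =>
      conj (𝓕 (g l : Rm m → ℂ) (t - β)) * 𝓕 (h l : Rm m → ℂ) (t - β - η.1))) ∧
    -- the characterization
    (IsDualSystem (gaborSystem h (modelSet Γ Ω) Δ) (gaborSystem g (modelSet Γ Ω) Δ) ↔
      ∀ η ∈ dualLattice Γ, ∀ᵐ t : Rm m,
        (density (modelSet Γ Ω) : ℂ) * (Phi ε Ω (-η.2) : ℂ) *
          ∑ l, ∑' β : Δ,
            conj (𝓕 (g l : Rm m → ℂ) (t - β)) * 𝓕 (h l : Rm m → ℂ) (t - β - η.1)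
          = delta η) := by
  obtain ⟨a, ha, rfl⟩ := exists_window_eq_Icc hΩ hsymm
  have haa : -a < a := by linarith
  have := hΔ'.countable.to_subtype
  let G : Fin L × Δ → L2 m := fun j => g j.1
  let H : Fin L × Δ → L2 m := fun j => h j.1
  let b : Fin L × Δ → Rm m := fun j => j.2
  have hG : ∀ j, Integrable (G j : Rm m → ℂ) := fun j => integrable_of_memWiener (hg j.1)
  have hH : ∀ j, Integrable (H j : Rm m → ℂ) := fun j => integrable_of_memWiener (hh j.1)
  -- The Gabor systems unfold definitionally to the translates of the modulated families, so the
  -- Bessel hypotheses apply as they stand.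
  have hsum := ae_summable_symbol (G := G) (H := H) (b := b) hΓ hG hH ha hgB hhB
  refine ⟨?_, tendstoUniformly_psiHat hε hε' _, integrable_Psi_mul hε hε' ha, fun η _ l => ?_, ?_⟩
  · rw [density_modelSet Γ hΓ haa]
    exact hasDensity_modelSet Γ hΓ haa
  · filter_upwards [hsum η.1] with t ht
    exact ht.prod_factor l
  · refine (isDualSystem_modFamily_iff (G := G) (H := H) (b := b) hΓ hG hH ha hgen hgB hhB).trans ?_
    refine forall₂_congr fun η _ => eventually_congr ?_
    filter_upwards [hsum η.1] with t ht
    have hK : symbolSum G H b η.1 t = ∑ l, ∑' β : Δ,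
        conj (𝓕 (g l : Rm m → ℂ) (t - β)) * 𝓕 (h l : Rm m → ℂ) (t - β - η.1) := by
      rw [symbolSum, ht.tsum_prod, tsum_fintype]
    -- The sinc function is even, so the sign in `Φ(-p₂*(η))` disappears.
    rw [hK, density_modelSet Γ hΓ haa, Phi_Icc hε hε' ha, neg_mul, mul_neg, Real.sinc_neg,
      sub_neg_eq_add, ← two_mul, ← Complex.ofReal_mul]
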